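/- Let $S$ be a complex superspace (algebraic or analytic; more generally, a topological space with a sheaf $\mathcal O_S=\mathcal O_S^+\oplus\mathcal O_S^-$ of supercommutative $\mathbb C$-superalgebras with local stalks). Let $\mathcal V$ be a vector bundle of rank $2m|2n$ on $S$ with a symplectic form, i.e. an even bilinear form $(\cdot,\cdot):\mathcal V\times\mathcal V\to\mathcal O_S$, skew-symmetric in the super sense (skew-symmetric on even sections, symmetric on odd ones), that induces an isomorphism $\mathcal V\to\mathcal V^\vee$. Let $L_1,L_2\subset\mathcal V$ be maximal isotropic subbundles of rank $m|n$; this means that $L_i$ is isotropic and the morphism $\mathcal V/L_i\to L_i^\vee$ induced by the form is an isomorphism. Let $\delta:L_1\to\mathcal V/L_2$ be the natural map and $C=[L_1\xrightarrow{\ \delta\ }\mathcal V/L_2]$, so that $\operatorname{Ber}(C)=\operatorname{Ber}(L_1)\otimes\operatorname{Ber}(\mathcal V/L_2)^{-1}$. Assume that there is an open subset $j:U\hookrightarrow S$ such that $\mathcal O_S\to j_*\mathcal O_U$ is injective and $L_1,L_2$ are transversal over $U$, i.e. $L_1\oplus L_2\to\mathcal V$ is an isomorphism over $U$; let $\theta=\theta(L_1,L_2)=\operatorname{ber}(\delta|_U)$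 be the resulting nowhere vanishing even section of $\operatorname{Ber}(C)^{-1}$ over $U$. Let $s\in S$ be a point such that the even parts of the fibres of $L_1$ and $L_2$ at $s$ satisfy $L_{1,s}^+\cap L_{2,s}^+=0$ in the fibre $\mathcal V_s$. Then there are an open neighbourhood $W$ of $s$, a trivialization $t$ (an even generating section) of the line bundle $\operatorname{Ber}(C)$ over $W$ and an even function $f\in\mathcal O_S(W)$ such that $$\theta^{-1}=f^2\,t\quad\text{over } W\cap U .$$ Furthermore, $f$ belongs to the support ideal $\mathcal I(C)$, i.e. locally on $W$ the endomorphism $f\cdot\operatorname{id}$ of the complex $C$ is homotopic to zero. In other words, $f\delta^{-1}$ is regular near $s$: the morphism $f\delta^{-1}:\mathcal V/L_2\to L_1$ over $W\cap U$ extends to a morphism over $W$. -/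

import Mathlib

open TopologicalSpace Opposite CategoryTheory

universe u

noncomputable section

/-- The structure of a supercommutative ring on a (noncommutative) ring `R`: a decomposition
`R = even ⊕ odd`, compatible with multiplication, such that homogeneous elements commute up to the
usual sign. -/
structure SuperGrading (R : Type u) [Ring R] where
  even : Subring R
  odd : AddSubgroup R
  isCompl : IsCompl even.toAddSubgroup odd
  even_mul_odd : ∀ a ∈ even, ∀ b ∈ odd, a * b ∈ odd
  odd_mul_odd : ∀ a ∈ odd, ∀ b ∈ odd, a * b ∈ even
  even_comm : ∀ a ∈ even, ∀ b, a * b = b * a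
  odd_anticomm : ∀ a ∈ odd, ∀ b ∈ odd, a * b = -(b * a)

namespace SuperGrading

variable {R : Type u} [Ring R] (σ : SuperGrading R)

instance : CommRing σ.even :=
  { (inferInstance : Ring σ.even) with
    mul_comm := fun a b => Subtype.ext (σ.even_comm a a.2 b) }

theorem exists_evenPart (a : R) : ∃ b : σ.even, a - b ∈ σ.odd := by
  have h : a ∈ σ.even.toAddSubgroup ⊔ σ.odd := by
    rw [σ.isCompl.sup_eq_top]; trivial
  obtain ⟨b, hb, c, hc, rfl⟩ := AddSubgroup.mem_sup.1 h
  exact ⟨⟨b, hb⟩, by simpa using hc⟩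

/-- The even component of an element. -/
def evenPart (a : R) : σ.even := (σ.exists_evenPart a).choose

/-- The Berezinian `det (A - B D⁻¹ C) · det(D)⁻¹` of a square block matrix
`[[A, B], [C, D]]` of size `m|n`. It is meant for even invertible matrices: `A`, `D` have even
entries and `B`, `C` odd ones, so that `evenPart` only regards an even entry as an element of the
commutative ring `R⁺`. -/
def ber {m n : ℕ} (N : Matrix (Fin m ⊕ Fin n) (Fin m ⊕ Fin n) R) : σ.even :=
  let D : Matrix (Fin n) (Fin n) σ.even :=
    Matrix.of fun k l => σ.evenPart (N (Sum.inr k) (Sum.inr l))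
  let T : Matrix (Fin m) (Fin m) σ.even :=
    Matrix.of fun i j => σ.evenPart (N (Sum.inl i) (Sum.inl j) -
      ∑ k, ∑ l, N (Sum.inl i) (Sum.inr k) * ((D⁻¹ k l : σ.even) : R) * N (Sum.inr l) (Sum.inl j))
  T.det * Ring.inverse D.det

end SuperGrading

/-- A complex superspace: a topological space with a sheaf of supercommutative `ℂ`-superalgebras
whose stalks are local. Complex superschemes and complex analytic superspaces are of this kind. -/
structure Superspace where
  X : TopCat.{u}
  sheaf : TopCat.Sheaf RingCat.{u} X
  grading : ∀ W : Opens X, SuperGrading (sheaf.presheaf.obj (op W))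
  map_even : ∀ (W W' : Opens X) (h : W' ≤ W), ∀ a ∈ (grading W).even,
    (sheaf.presheaf.map (homOfLE h).op).hom a ∈ (grading W').even
  map_odd : ∀ (W W' : Opens X) (h : W' ≤ W), ∀ a ∈ (grading W).odd,
    (sheaf.presheaf.map (homOfLE h).op).hom a ∈ (grading W').odd
  isLocalRing : ∀ x : X, IsLocalRing (sheaf.presheaf.stalk x)
  /-- The structure of `ℂ`-superalgebras. -/
  ofComplex : ℂ →+* (grading ⊤).even

namespace Superspace

variable (S : Superspace.{u})

/-- The ring of functions on an open subset. -/
abbrev fn (W : Opens S.X) : Type u := S.sheaf.presheaf.obj (op W)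

/-- The commutative ring of even functions on an open subset. -/
abbrev evenFn (W : Opens S.X) : Type u := (S.grading W).even

/-- Restriction of functions. -/
def res {W W' : Opens S.X} (h : W' ≤ W) : S.fn W →+* S.fn W' :=
  (S.sheaf.presheaf.map (homOfLE h).op).hom

/-- Restriction of even functions. -/
def evenRes {W W' : Opens S.X} (h : W' ≤ W) : S.evenFn W →+* S.evenFn W' :=
  ((S.res h).comp (S.grading W).even.subtype).codRestrict (S.grading W').even
    (fun a => S.map_even W W' h a a.2)

end Superspace

/-- A presheaf of supermodules over the structure sheaf of a superspace. -/
structure SuperModule (S : Superspace.{u}) where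
  obj : Opens S.X → Type u
  [addCommGroup : ∀ W, AddCommGroup (obj W)]
  [module : ∀ W, Module (S.fn W) (obj W)]
  res : ∀ {W W' : Opens S.X}, W' ≤ W → (obj W →+ obj W')
  res_self : ∀ (W : Opens S.X) (v : obj W), res (le_refl W) v = v
  res_res : ∀ {W W' W'' : Opens S.X} (h : W' ≤ W) (h' : W'' ≤ W') (v : obj W),
    res h' (res h v) = res (h'.trans h) v
  res_smul : ∀ {W W' : Opens S.X} (h : W' ≤ W) (a : S.fn W) (v : obj W),
    res h (a • v) = S.res h a • res h v
  even : ∀ W, AddSubgroup (obj W)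
  odd : ∀ W, AddSubgroup (obj W)
  isCompl : ∀ W, IsCompl (even W) (odd W)
  res_even : ∀ {W W' : Opens S.X} (h : W' ≤ W), ∀ v ∈ even W, res h v ∈ even W'
  res_odd : ∀ {W W' : Opens S.X} (h : W' ≤ W), ∀ v ∈ odd W, res h v ∈ odd W'
  even_smul_even : ∀ W, ∀ a ∈ (S.grading W).even, ∀ v ∈ even W, a • v ∈ even W
  even_smul_odd : ∀ W, ∀ a ∈ (S.grading W).even, ∀ v ∈ odd W, a • v ∈ odd W
  odd_smul_even : ∀ W, ∀ a ∈ (S.grading W).odd, ∀ v ∈ even W, a • v ∈ odd W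
  odd_smul_odd : ∀ W, ∀ a ∈ (S.grading W).odd, ∀ v ∈ odd W, a • v ∈ even W

attribute [instance] SuperModule.addCommGroup SuperModule.module

namespace SuperModule

variable {S : Superspace.{u}}

/-- The sheaf condition: compatible sections over the members of a cover glue uniquely. -/
def IsSheaf (M : SuperModule S) : Prop :=
  ∀ (ι : Type u) (W : ι → Opens S.X) (v : ∀ i, M.obj (W i)),
    (∀ i j, M.res (inf_le_left : W i ⊓ W j ≤ W i) (v i) =
      M.res (inf_le_right : W i ⊓ W j ≤ W j) (v j)) →
    ∃! w : M.obj (iSup W), ∀ i, M.res (le_iSup W i) w = v i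

/-- A homogeneous frame of rank `p|q` over `W`: `p` even and `q` odd sections over `W` that form a
basis of the sections over every smaller open subset. -/
structure Frame (M : SuperModule S) (p q : ℕ) (W : Opens S.X) where
  vec : Fin p ⊕ Fin q → M.obj W
  even : ∀ i, vec (Sum.inl i) ∈ M.even W
  odd : ∀ j, vec (Sum.inr j) ∈ M.odd W
  linearIndependent : ∀ (W' : Opens S.X) (h : W' ≤ W),
    LinearIndependent (S.fn W') (fun i => M.res h (vec i))
  span_eq_top : ∀ (W' : Opens S.X) (h : W' ≤ W),
    Submodule.span (S.fn W') (Set.range fun i => M.res h (vec i)) = ⊤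

namespace Frame

variable {M : SuperModule S} {p q : ℕ} {W : Opens S.X}

/-- The frame as a basis of the module of sections over `W`. -/
def basis (e : M.Frame p q W) : Module.Basis (Fin p ⊕ Fin q) (S.fn W) (M.obj W) :=
  Module.Basis.mk (v := e.vec)
    (by simpa [M.res_self] using e.linearIndependent W le_rfl)
    (by simpa [M.res_self] using (e.span_eq_top W le_rfl).ge)

/-- Restriction of a frame. -/
def restrict (e : M.Frame p q W) {W' : Opens S.X} (h : W' ≤ W) : M.Frame p q W' where
  vec i := M.res h (e.vec i)
  even i := M.res_even h _ (e.even i)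
  odd j := M.res_odd h _ (e.odd j)
  linearIndependent W'' h' := by simpa [M.res_res] using e.linearIndependent W'' (h'.trans h)
  span_eq_top W'' h' := by simpa [M.res_res] using e.span_eq_top W'' (h'.trans h)

/-- The matrix of a family of sections in a frame: `v j = ∑ i, (e.coords v) j i • e i`. With the
coordinates on the left and the vectors indexed by rows, composition of linear maps corresponds to
multiplication of matrices. -/
def coords (e : M.Frame p q W) (v : Fin p ⊕ Fin q → M.obj W) :
    Matrix (Fin p ⊕ Fin q) (Fin p ⊕ Fin q) (S.fn W) :=
  Matrix.of fun j i => e.basis.repr (v j) i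

end Frame

/-- Local freeness of rank `p|q`. -/
def IsLocallyFree (M : SuperModule S) (p q : ℕ) : Prop :=
  ∀ x : S.X, ∃ W : Opens S.X, x ∈ W ∧ Nonempty (M.Frame p q W)

/-- Even morphisms `M|_W → N|_W`. -/
structure HomOver (W : Opens S.X) (M N : SuperModule S) where
  app : ∀ W' : Opens S.X, W' ≤ W → (M.obj W' →ₗ[S.fn W'] N.obj W')
  app_res : ∀ (W' W'' : Opens S.X) (h : W' ≤ W) (h' : W'' ≤ W') (v : M.obj W'),
    app W'' (h'.trans h) (M.res h' v) = N.res h' (app W' h v)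
  app_even : ∀ (W' : Opens S.X) (h : W' ≤ W), ∀ v ∈ M.even W', app W' h v ∈ N.even W'
  app_odd : ∀ (W' : Opens S.X) (h : W' ≤ W), ∀ v ∈ M.odd W', app W' h v ∈ N.odd W'

/-- Sections over `W` of the dual `M^∨`: linear functionals `M|_W → 𝒪|_W`, of any parity. -/
structure Functional (W : Opens S.X) (M : SuperModule S) where
  app : ∀ W' : Opens S.X, W' ≤ W → (M.obj W' →ₗ[S.fn W'] S.fn W')
  app_res : ∀ (W' W'' : Opens S.X) (h : W' ≤ W) (h' : W'' ≤ W') (v : M.obj W'),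
    app W'' (h'.trans h) (M.res h' v) = S.res h' (app W' h v)

open Classical in
/-- The stalk at a point, as an abelian group. -/
abbrev Stalk (M : SuperModule S) (x : S.X) : Type u :=
  AddCommGroup.DirectLimit (ι := {W : Opens S.X // x ∈ W}ᵒᵈ)
    (fun W => M.obj (OrderDual.ofDual W).1) (fun _ _ h => M.res h)

open Classical in
/-- The germ of a section at a point. -/
def germ (M : SuperModule S) {x : S.X} {W : Opens S.X} (hx : x ∈ W) : M.obj W →+ M.Stalk x :=
  AddCommGroup.DirectLimit.of (ι := {W : Opens S.X // x ∈ W}ᵒᵈ)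
    (fun W => M.obj (OrderDual.ofDual W).1) (fun _ _ h => M.res h) (OrderDual.toDual ⟨W, hx⟩)

/-- The subgroup `𝔪_x M_x` of the stalk, where `𝔪_x` is the maximal ideal of `𝒪_x`. -/
def maximalIdealSMul (M : SuperModule S) (x : S.X) : AddSubgroup (M.Stalk x) :=
  AddSubgroup.closure {ξ | ∃ (W : Opens S.X) (hx : x ∈ W) (a : S.fn W) (v : M.obj W),
    S.sheaf.presheaf.germ W x hx a ∈ nonunits (S.sheaf.presheaf.stalk x) ∧
    ξ = M.germ hx (a • v)}

/-- The fibre `M|_x = M_x / 𝔪_x M_x`. -/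
abbrev Fibre (M : SuperModule S) (x : S.X) : Type u := M.Stalk x ⧸ M.maximalIdealSMul x

/-- The value of a section in the fibre at a point. -/
def value (M : SuperModule S) {x : S.X} {W : Opens S.X} (hx : x ∈ W) (v : M.obj W) : M.Fibre x :=
  QuotientAddGroup.mk (M.germ hx v)

/-- A graded subsheaf of `𝒪`-submodules of `V`. -/
structure Subsheaf (V : SuperModule S) where
  carrier : ∀ W : Opens S.X, Submodule (S.fn W) (V.obj W)
  res_mem : ∀ {W W' : Opens S.X} (h : W' ≤ W), ∀ v ∈ carrier W, V.res h v ∈ carrier W'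
  homogeneous : ∀ W, ∀ v ∈ carrier W, ∃ v₀ ∈ carrier W, ∃ v₁ ∈ carrier W,
    v₀ ∈ V.even W ∧ v₁ ∈ V.odd W ∧ v = v₀ + v₁
  mem_of_local : ∀ (W : Opens S.X) (v : V.obj W),
    (∀ x ∈ W, ∃ (W' : Opens S.X) (h : W' ≤ W), x ∈ W' ∧ V.res h v ∈ carrier W') → v ∈ carrier W

namespace Subsheaf

variable {V : SuperModule S}

/-- The whole of `V`. -/
def whole (V : SuperModule S) : V.Subsheaf where
  carrier _ := ⊤
  res_mem _ _ _ := trivial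
  homogeneous W v _ := by
    have h : v ∈ V.even W ⊔ V.odd W := by rw [(V.isCompl W).sup_eq_top]; trivial
    obtain ⟨b, hb, c, hc, rfl⟩ := AddSubgroup.mem_sup.1 h
    exact ⟨b, trivial, c, trivial, hb, hc, rfl⟩
  mem_of_local _ _ _ := trivial

/-- A subsheaf as a supermodule of its own. -/
def toSuperModule (L : V.Subsheaf) : SuperModule S where
  obj W := L.carrier W
  res {W W'} h := ((V.res h).comp (L.carrier W).toAddSubgroup.subtype).codRestrict
    (L.carrier W').toAddSubgroup (fun v => L.res_mem h v v.2)
  res_self W v := Subtype.ext (V.res_self W v)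
  res_res h h' v := Subtype.ext (V.res_res h h' v)
  res_smul h a v := Subtype.ext (V.res_smul h a v)
  even W := (V.even W).comap (L.carrier W).toAddSubgroup.subtype
  odd W := (V.odd W).comap (L.carrier W).toAddSubgroup.subtype
  isCompl W := by
    constructor
    · rw [AddSubgroup.disjoint_def]
      intro v h₀ h₁
      exact Subtype.ext ((AddSubgroup.disjoint_def.1 (V.isCompl W).disjoint) h₀ h₁)
    · rw [codisjoint_iff, eq_top_iff]
      rintro ⟨v, hv⟩ -
      obtain ⟨v₀, h₀, v₁, h₁, e₀, e₁, rfl⟩ := L.homogeneous W v hv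
      exact AddSubgroup.mem_sup.2 ⟨⟨v₀, h₀⟩, e₀, ⟨v₁, h₁⟩, e₁, rfl⟩
  res_even h v hv := V.res_even h _ hv
  res_odd h v hv := V.res_odd h _ hv
  even_smul_even W a ha v hv := V.even_smul_even W a ha _ hv
  even_smul_odd W a ha v hv := V.even_smul_odd W a ha _ hv
  odd_smul_even W a ha v hv := V.odd_smul_even W a ha _ hv
  odd_smul_odd W a ha v hv := V.odd_smul_odd W a ha _ hv

/-- The quotient `V/L`, as the presheaf `W ↦ V(W)/L(W)`. The quotient sheaf is its sheafification.
When `V` is a sheaf, this presheaf is separated, it agrees with the quotient sheaf on every open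
subset over which it has a frame, every local frame of the quotient sheaf comes locally from a
frame of it, and both have the same morphisms to sheaves: so local freeness of `V/L`, its
Berezinian and its morphisms to a bundle may be read off from it. -/
def quotient (L : V.Subsheaf) : SuperModule S where
  obj W := V.obj W ⧸ L.carrier W
  res {W W'} h := QuotientAddGroup.map (L.carrier W).toAddSubgroup (L.carrier W').toAddSubgroup
    (V.res h) (fun v hv => L.res_mem h v hv)
  res_self W v := by
    induction v using Submodule.Quotient.induction_on with
    | H v => exact congrArg Submodule.Quotient.mk (V.res_self W v)
  res_res h h' v := by
    induction v using Submodule.Quotient.induction_on with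
    | H v => exact congrArg Submodule.Quotient.mk (V.res_res h h' v)
  res_smul h a v := by
    induction v using Submodule.Quotient.induction_on with
    | H v => exact congrArg Submodule.Quotient.mk (V.res_smul h a v)
  even W := (V.even W).map (L.carrier W).mkQ.toAddMonoidHom
  odd W := (V.odd W).map (L.carrier W).mkQ.toAddMonoidHom
  isCompl W := by
    constructor
    · rw [AddSubgroup.disjoint_def]
      rintro _ ⟨v, hv, rfl⟩ ⟨w, hw, h⟩
      have h' : w - v ∈ L.carrier W := (Submodule.Quotient.eq _).1 h
      obtain ⟨v₀, h₀, v₁, h₁, e₀, e₁, e⟩ := L.homogeneous W _ h'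
      have key : v + v₀ = w - v₁ := by
        rw [eq_sub_iff_add_eq, add_assoc, ← e]; abel
      have hz : v + v₀ = 0 := (AddSubgroup.disjoint_def.1 (V.isCompl W).disjoint)
        (add_mem hv e₀) (key ▸ sub_mem hw e₁)
      have : v ∈ L.carrier W := by
        rw [eq_neg_of_add_eq_zero_left hz]; exact neg_mem h₀
      exact (Submodule.Quotient.mk_eq_zero _).2 this
    · rw [codisjoint_iff, ← AddSubgroup.map_sup, (V.isCompl W).sup_eq_top]
      exact AddSubgroup.map_top_of_surjective _ (Submodule.mkQ_surjective _)
  res_even h := by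
    rintro _ ⟨v, hv, rfl⟩
    exact ⟨_, V.res_even h v hv, rfl⟩
  res_odd h := by
    rintro _ ⟨v, hv, rfl⟩
    exact ⟨_, V.res_odd h v hv, rfl⟩
  even_smul_even W a ha := by
    rintro _ ⟨v, hv, rfl⟩
    exact ⟨_, V.even_smul_even W a ha v hv, rfl⟩
  even_smul_odd W a ha := by
    rintro _ ⟨v, hv, rfl⟩
    exact ⟨_, V.even_smul_odd W a ha v hv, rfl⟩
  odd_smul_even W a ha := by
    rintro _ ⟨v, hv, rfl⟩
    exact ⟨_, V.odd_smul_even W a ha v hv, rfl⟩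
  odd_smul_odd W a ha := by
    rintro _ ⟨v, hv, rfl⟩
    exact ⟨_, V.odd_smul_odd W a ha v hv, rfl⟩

/-- `L` is a subbundle of `V` of rank `p|q` and corank `p'|q'`. -/
def IsSubbundle (L : V.Subsheaf) (p q p' q' : ℕ) : Prop :=
  L.toSuperModule.IsLocallyFree p q ∧ L.quotient.IsLocallyFree p' q'

/-- The even part `L_x⁺` of the fibre of `L` at `x`, as a subset of the fibre of `V`. -/
def fibreEven (L : V.Subsheaf) (x : S.X) : Set (V.Fibre x) :=
  {ξ | ∃ (W : Opens S.X) (hx : x ∈ W) (v : V.obj W),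
    v ∈ L.carrier W ∧ v ∈ V.even W ∧ ξ = V.value hx v}

/-- `L₁` and `L₂` are transversal over `U`: the map `L₁ ⊕ L₂ → V` is an isomorphism over `U`. -/
def TransversalOver (L₁ L₂ : V.Subsheaf) (U : Opens S.X) : Prop :=
  ∀ W : Opens S.X, W ≤ U → IsCompl (L₁.carrier W) (L₂.carrier W)

/-- The natural map `δ : L₁ → V/L₂`, the differential of the complex `C(V; L₁, L₂)`. -/
def delta (L₁ L₂ : V.Subsheaf) : HomOver ⊤ L₁.toSuperModule L₂.quotient where
  app W _ := (L₂.carrier W).mkQ.comp (L₁.carrier W).subtype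
  app_res _ _ _ _ _ := rfl
  app_even _ _ v hv := ⟨v.1, hv, rfl⟩
  app_odd _ _ v hv := ⟨v.1, hv, rfl⟩

end Subsheaf

/-- An even bilinear form on `V` with values in `𝒪` that is skew-symmetric in the super sense:
skew-symmetric on even sections, symmetric on odd ones. -/
structure SkewForm (V : SuperModule S) where
  form : ∀ W : Opens S.X, V.obj W →+ V.obj W →+ S.fn W
  form_res : ∀ {W W' : Opens S.X} (h : W' ≤ W) (v w : V.obj W),
    form W' (V.res h v) (V.res h w) = S.res h (form W v w)
  smul_left : ∀ (W : Opens S.X) (a : S.fn W) (v w : V.obj W), form W (a • v) w = a * form W v w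
  even_even : ∀ W, ∀ v ∈ V.even W, ∀ w ∈ V.even W, form W v w ∈ (S.grading W).even
  even_odd : ∀ W, ∀ v ∈ V.even W, ∀ w ∈ V.odd W, form W v w ∈ (S.grading W).odd
  odd_odd : ∀ W, ∀ v ∈ V.odd W, ∀ w ∈ V.odd W, form W v w ∈ (S.grading W).even
  skew_even : ∀ W, ∀ v ∈ V.even W, ∀ w, form W v w = -form W w v
  symm_odd : ∀ W, ∀ v ∈ V.odd W, ∀ w ∈ V.odd W, form W v w = form W w v

namespace SkewForm

variable {V : SuperModule S} (B : V.SkewForm)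

/-- The functional `l ↦ (l, v)` on `L` is zero. -/
def Annihilates (L : V.Subsheaf) {W : Opens S.X} (v : V.obj W) : Prop :=
  ∀ (W' : Opens S.X) (h : W' ≤ W), ∀ l ∈ L.carrier W', B.form W' l (V.res h v) = 0

/-- The map `V → L^∨`, `v ↦ (·, v)`, is a surjection of sheaves. -/
def SurjectsOntoDual (L : V.Subsheaf) : Prop :=
  ∀ (W : Opens S.X) (φ : Functional W L.toSuperModule), ∀ x ∈ W,
    ∃ (W' : Opens S.X) (h : W' ≤ W) (v : V.obj W'), x ∈ W' ∧
      ∀ (W'' : Opens S.X) (h' : W'' ≤ W') (l : L.carrier W''),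
        φ.app W'' (h'.trans h) l = B.form W'' l (V.res h' v)

/-- The form is symplectic: the induced map `V → V^∨` is an isomorphism of sheaves. -/
def IsSymplectic : Prop :=
  (∀ (W : Opens S.X) (v : V.obj W), B.Annihilates (Subsheaf.whole V) v → v = 0) ∧
    B.SurjectsOntoDual (Subsheaf.whole V)

/-- `L` is maximal isotropic: it is isotropic, and the induced map `V/L → L^∨` is an isomorphism of
sheaves. -/
def IsMaximalIsotropic (L : V.Subsheaf) : Prop :=
  (∀ W, ∀ l ∈ L.carrier W, ∀ l' ∈ L.carrier W, B.form W l l' = 0) ∧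
    (∀ (W : Opens S.X) (v : V.obj W), B.Annihilates L v → v ∈ L.carrier W) ∧
    B.SurjectsOntoDual L

end SkewForm

/-- An even section over `W` of the line bundle `Ber(E) ⊗ Ber(F)⁻¹`, the Berezinian of a complex
`[E → F]` of bundles of rank `m|n`. Local frames `e` of `E` and `g` of `F` give a
generator `[e] ⊗ [g]⁻¹`, where `[e'] = ber(P) [e]` if `e' = P e`; a section is given by its
coefficients `coeff e g` at these generators. -/
structure BerSection (E F : SuperModule S) (m n : ℕ) (W : Opens S.X) where
  coeff : ∀ {W' : Opens S.X}, W' ≤ W → E.Frame m n W' → F.Frame m n W' → S.evenFn W'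
  coeff_res : ∀ {W' W'' : Opens S.X} (h : W' ≤ W) (h' : W'' ≤ W')
    (e : E.Frame m n W') (g : F.Frame m n W'),
    coeff (h'.trans h) (e.restrict h') (g.restrict h') = S.evenRes h' (coeff h e g)
  coeff_change : ∀ {W' : Opens S.X} (h : W' ≤ W)
    (e e' : E.Frame m n W') (g g' : F.Frame m n W'),
    coeff h e g * (S.grading W').ber (g.coords g'.vec) =
      coeff h e' g' * (S.grading W').ber (e.coords e'.vec)

/-- The section generates the line bundle, i.e. it is a trivialization. -/
def BerSection.IsTrivialization {E F : SuperModule S} {m n : ℕ} {W : Opens S.X}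
    (t : BerSection E F m n W) : Prop :=
  ∀ {W' : Opens S.X} (h : W' ≤ W) (e : E.Frame m n W') (g : F.Frame m n W'),
    IsUnit (t.coeff h e g)

/-- The canonical section `θ = ber(d)` of `Ber(E)⁻¹ ⊗ Ber(F)` for an isomorphism `d : E → F` over
an open subset, through its coefficient at `[e]⁻¹ ⊗ [g]`: the Berezinian of the matrix of `d`. -/
def theta {E F : SuperModule S} (d : HomOver ⊤ E F) {m n : ℕ} {W : Opens S.X}
    (e : E.Frame m n W) (g : F.Frame m n W) : S.evenFn W :=
  (S.grading W).ber (g.coords fun j => d.app W le_top (e.vec j))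

/-- The even function `f` on `W` belongs to the support ideal `ℐ(E → F)`: locally, multiplication by
`f` on the complex `[E → F]` is homotopic to zero. -/
def MemSupportIdeal {E F : SuperModule S} (d : HomOver ⊤ E F) {W : Opens S.X}
    (f : S.evenFn W) : Prop :=
  ∀ x ∈ W, ∃ (W' : Opens S.X) (h : W' ≤ W) (k : HomOver W' F E), x ∈ W' ∧
    ∀ (W'' : Opens S.X) (h' : W'' ≤ W'),
      (∀ v : E.obj W'', k.app W'' h' (d.app W'' le_top v) =
        (S.evenRes (h'.trans h) f : S.fn W'') • v) ∧
      (∀ y : F.obj W'', d.app W'' le_top (k.app W'' h' y) =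
        (S.evenRes (h'.trans h) f : S.fn W'') • y)

end SuperModule

end

/-! Near `s` take frames of `L₁` and `V/L₂`, so that `δ` becomes an even supermatrix. Its even-even
block is invertible at `s`, since a kernel vector of that block would give a nonzero element of `L₁⁺
∩ L₂⁺` in the fibre (`eval_det_ne_zero`). Splitting off this block and the part of the odd-odd block
that is invertible at `s` leaves `δ = 1 ⊕ X₀`, where `X₀` has even entries, acts between odd frame
vectors and vanishes at `s` (`exists_adapted_frames`). As odd-odd blocks enter the Berezinian
through an inverse determinant, `θ⁻¹` is `det X₀` in these frames, and the claim becomes that `det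
X₀` is a square up to a unit.

This is where the form enters. Let `e i` be the remaining odd frame vectors of `L₁`, let `v a` be
odd lifts to `V` of those of `V/L₂`, and put `H = (e i, v a)`, `G = (v a, v b)`; `G` is symmetric.
Since `e i - ∑ X₀ i a • v a` lies in `L₂`, isotropy of `L₁` and `L₂` gives `X₀ G X₀ᵀ = H X₀ᵀ + X₀
Hᵀ`. Hence for `Y = H - ½ X₀ G` the matrix `X₀ Yᵀ` is skew-symmetric. At `s` the matrix `Y` equals
`H`, which is invertible there because `L₁` is maximal isotropic. Let `f` be the Pfaffian of `X₀
Yᵀ`: then `f² = det X₀ · det Y` with `det Y` a unit. The Pfaffian adjugate `Q` satisfies `X₀ (Yᵀ Q)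
= f`, so `f X₀⁻¹` is regular, and it supplies the homotopy (`exists_frames_sqrt_det`,
`exists_homotopy`).

Two algebraic facts support this: Pfaffians over a commutative ring containing `½`
(`exists_pfaffian`), and multiplicativity of the Berezinian (`ber_mul`), which carries the
computation from the adapted frames to all others. -/

namespace Matrix

/-! ### Pfaffians of skew-symmetric matrices. -/

/-- The determinant of a skew-symmetric matrix over a field of characteristic other than two is a
square. -/
theorem isSquare_det_of_skew {K : Type*} [Field K] (h2 : (2 : K) ≠ 0) {ι : Type*} [Fintype ι]
    [DecidableEq ι] (A : Matrix ι ι K) (hA : Aᵀ = -A) : IsSquare A.det := by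
  induction hk : Fintype.card ι using Nat.strong_induction_on generalizing ι with
  | _ k ih =>
  have hskew : ∀ i j, A j i = -A i j := fun i j => congrFun (congrFun hA i) j
  have hdiag : ∀ i, A i i = 0 := fun i => by
    have h : 2 * A i i = 0 := by linear_combination hskew i i
    exact (mul_eq_zero.1 h).resolve_left h2
  by_cases h0 : A = 0
  · subst h0
    rcases isEmpty_or_nonempty ι with h | h
    · simp
    · simp [det_zero]
  obtain ⟨i, j, hij⟩ : ∃ i j, A i j ≠ 0 := by
    by_contra! h
    exact h0 (Matrix.ext h)
  have hne : i ≠ j := by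
    rintro rfl
    exact hij (hdiag i)
  -- Moving a nonzero entry `A i j` into the leading 2×2 block makes that block invertible with
  -- determinant `(A i j)²`. The Schur complement is again skew-symmetric and smaller, so induction
  -- applies.
  let φ : Fin 2 ⊕ {x // x ≠ i ∧ x ≠ j} → ι := Sum.elim ![i, j] Subtype.val
  have hφ : Function.Bijective φ := by
    constructor
    · rintro (a | ⟨a, ha, ha'⟩) (b | ⟨b, hb, hb'⟩) h
      · fin_cases a <;> fin_cases b
        exacts [rfl, absurd h hne, absurd h hne.symm, rfl]
      · fin_cases a
        exacts [absurd h.symm hb, absurd h.symm hb']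
      · fin_cases b
        exacts [absurd h ha, absurd h ha']
      · exact congrArg Sum.inr (Subtype.ext h)
    · intro x
      by_cases hx : x = i
      · exact ⟨Sum.inl 0, by simp [φ, hx]⟩
      by_cases hx' : x = j
      · exact ⟨Sum.inl 1, by simp [φ, hx']⟩
      exact ⟨Sum.inr ⟨x, hx, hx'⟩, rfl⟩
  let e := Equiv.ofBijective φ hφ
  have hcard : Fintype.card {x // x ≠ i ∧ x ≠ j} < k := by
    have h := Fintype.card_congr e
    rw [Fintype.card_sum, Fintype.card_fin] at h
    omega
  rw [← det_submatrix_equiv_self e A, ← fromBlocks_toBlocks (A.submatrix e e)]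
  set P := (A.submatrix e e).toBlocks₁₁
  set Q := (A.submatrix e e).toBlocks₁₂
  set Q' := (A.submatrix e e).toBlocks₂₁
  set D := (A.submatrix e e).toBlocks₂₂
  have hQ : Q'ᵀ = -Q := by
    ext a b
    exact hskew _ _
  have hQ' : Qᵀ = -Q' := by
    ext a b
    exact hskew _ _
  have hP : Pᵀ = -P := by
    ext a b
    exact hskew _ _
  have hD : Dᵀ = -D := by
    ext a b
    exact hskew _ _
  have hdet : P.det = A i j * A i j := by
    rw [det_fin_two]
    have h1 : P 0 0 = 0 := hdiag i
    have h2 : P 0 1 = A i j := rfl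
    have h3 : P 1 0 = -A i j := hskew i j
    rw [h1, h2, h3]
    ring
  have hu : IsUnit P.det := by
    rw [hdet]
    exact (mul_ne_zero hij hij).isUnit
  let _ := P.invertibleOfIsUnitDet hu
  rw [det_fromBlocks₁₁, hdet]
  refine IsSquare.mul ⟨_, rfl⟩ (ih _ hcard _ ?_ rfl)
  rw [invOf_eq_nonsing_inv, transpose_sub, transpose_mul, transpose_mul, hQ, hQ', hD,
    transpose_nonsing_inv, hP, ← Matrix.mul_assoc]
  have : (-P)⁻¹ = -P⁻¹ := by
    apply inv_eq_right_inv
    simp [mul_nonsing_inv _ hu]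
  rw [this]
  simp only [Matrix.neg_mul, Matrix.mul_neg, neg_neg, neg_sub, sub_neg_eq_add]
  abel

theorem _root_.Derivation.leibniz_prod {k R : Type*} [CommRing k] [CommRing R] [Algebra k R]
    (d : Derivation k R R) {ι : Type*} [DecidableEq ι] (s : Finset ι) (a : ι → R) :
    d (∏ i ∈ s, a i) = ∑ i ∈ s, (∏ j ∈ s.erase i, a j) * d (a i) := by
  induction s using Finset.induction_on with
  | empty => simp
  | insert i s hi ih =>
    rw [Finset.prod_insert hi, Derivation.leibniz, ih, Finset.sum_insert hi,
      Finset.erase_insert hi, smul_eq_mul, smul_eq_mul, add_comm, Finset.mul_sum]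
    congr 1
    refine Finset.sum_congr rfl fun j hj => ?_
    have hij : i ≠ j := fun h => hi (h ▸ hj)
    rw [Finset.erase_insert_of_ne hij, Finset.prod_insert (fun h => hi (Finset.mem_of_mem_erase h)),
      mul_assoc]

/-- Jacobi's formula for the derivative of a determinant. -/
theorem derivation_det {k R : Type*} [CommRing k] [CommRing R] [Algebra k R]
    (d : Derivation k R R) {ι : Type*} [Fintype ι] [DecidableEq ι] (A : Matrix ι ι R) :
    d A.det = ∑ i, ∑ j, A.adjugate i j * d (A j i) := by
  -- By Leibniz's rule the derivative falls on one column at a time; each summand is then a Cramer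
  -- determinant.
  have h : d A.det = ∑ i, (A.updateCol i fun j => d (A j i)).det := by
    simp only [det_apply, map_sum]
    rw [Finset.sum_comm]
    refine Finset.sum_congr rfl fun σ _ => ?_
    rw [← Finset.smul_sum, Units.smul_def, Units.smul_def, map_zsmul]
    congr 1
    rw [Derivation.leibniz_prod]
    refine Finset.sum_congr rfl fun i _ => ?_
    rw [← Finset.mul_prod_erase _ _ (Finset.mem_univ i), mul_comm]
    congr 1
    · simp
    · refine Finset.prod_congr rfl fun j hj => ?_
      rw [updateCol_ne (Finset.ne_of_mem_erase hj)]
  rw [h]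
  refine Finset.sum_congr rfl fun i _ => ?_
  rw [← cramer_apply, cramer_eq_adjugate_mulVec]
  rfl

/-- The adjugate is homogeneous of degree one less than the size; this degree is odd here, so the
sign of `-A` survives. -/
theorem transpose_adjugate_of_skew {R : Type*} [CommRing R] {ι : Type*} [Fintype ι] [DecidableEq ι]
    (A : Matrix ι ι R) (hA : Aᵀ = -A) (hι : Even (Fintype.card ι)) :
    A.adjugateᵀ = -A.adjugate := by
  rcases isEmpty_or_nonempty ι with h | h
  · ext i
    exact isEmptyElim i
  rw [adjugate_transpose, hA, ← neg_one_smul R A, adjugate_smul, Odd.neg_one_pow, neg_one_smul]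
  exact Nat.Even.sub_odd Fintype.card_pos hι odd_one

-- The generic matrix lives over a domain, where `2` and a nonzero `f` can be cancelled. Its
-- determinant is a square in the fraction field, and integral closedness puts the root `f` into the
-- polynomial ring. Differentiating `det A = f²` by Jacobi's formula shows that `f` divides the
-- adjugate; cancelling `f` from `A * adj A = f²` leaves the Pfaffian adjugate `Q`.
open MvPolynomial in
theorem exists_pfaffian_generic (ι : Type*) [Fintype ι] [DecidableEq ι]
    (A : Matrix ι ι (MvPolynomial (ι × ι) ℤ))
    (hA : A = of fun i j => X (i, j) - X (j, i)) :
    ∃ (f : MvPolynomial (ι × ι) ℤ) (Q : Matrix ι ι (MvPolynomial (ι × ι) ℤ)),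
      A.det = f ^ 2 ∧ A * Q = f • (1 : Matrix ι ι _) ∧ Q * A = f • (1 : Matrix ι ι _) := by
  have hskew : Aᵀ = -A := by
    ext i j : 2
    simp [hA]
  have h2 : (2 : MvPolynomial (ι × ι) ℤ) ≠ 0 := two_ne_zero
  obtain ⟨f, hf⟩ : ∃ f, A.det = f ^ 2 := by
    let K := FractionRing (MvPolynomial (ι × ι) ℤ)
    have hsq : IsSquare (A.map (algebraMap _ K)).det := by
      refine isSquare_det_of_skew ?_ _ ?_
      · rw [← map_ofNat (algebraMap (MvPolynomial (ι × ι) ℤ) K) 2]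
        exact (map_ne_zero_iff _ (IsFractionRing.injective _ K)).2 h2
      · rw [← transpose_map, hskew]
        ext i j : 2
        simp
    obtain ⟨c, hc⟩ := hsq
    have hdet : (A.map (algebraMap _ K)).det = algebraMap _ K A.det :=
      (RingHom.map_det _ _).symm
    rw [hdet] at hc
    have hint : IsIntegral (MvPolynomial (ι × ι) ℤ) c := by
      refine IsIntegral.of_pow (n := 2) two_pos ?_
      rw [pow_two, ← hc]
      exact isIntegral_algebraMap
    obtain ⟨f, rfl⟩ := IsIntegrallyClosed.isIntegral_iff.1 hint
    refine ⟨f, IsFractionRing.injective _ K ?_⟩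
    rw [hc, map_pow, pow_two]
  refine ⟨f, ?_⟩
  -- All odd sizes fall into the case `f = 0`; afterwards the size is even and the adjugate is
  -- skew-symmetric.
  by_cases hf0 : f = 0
  · exact ⟨0, hf, by simp [hf0], by simp [hf0]⟩
  have heven : Even (Fintype.card ι) := by
    by_contra hodd
    rw [Nat.not_even_iff_odd] at hodd
    have h := congrArg det hskew
    rw [det_transpose, det_neg, hodd.neg_one_pow] at h
    have h' : 2 * A.det = 0 := by linear_combination h
    have : f ^ 2 = 0 := by rw [← hf]; exact (mul_eq_zero.1 h').resolve_left h2
    exact hf0 (pow_eq_zero_iff two_ne_zero |>.1 this)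
  have hadj := transpose_adjugate_of_skew A hskew heven
  have hadj' : ∀ i j, A.adjugate j i = -A.adjugate i j := fun i j => congrFun (congrFun hadj i) j
  -- The variable `X (j, i)` occurs in the entries `A j i` and `A i j` with opposite signs, so
  -- skewness of the adjugate turns Jacobi's formula into `2 f ∂f = 2 adj i j`.
  let Q : Matrix ι ι (MvPolynomial (ι × ι) ℤ) := of fun i j => pderiv (j, i) f
  have hQ : A.adjugate = f • Q := by
    refine Matrix.ext fun i j => ?_
    have h := derivation_det (pderiv (R := ℤ) (j, i)) A
    have hA' : ∀ a b, pderiv (j, i) (A b a) =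
        (if a = i then if b = j then 1 else 0 else 0) -
          (if a = j then if b = i then 1 else 0 else 0) := by
      intro a b
      simp only [hA, of_apply, map_sub, pderiv_X, Pi.single_apply, Prod.mk.injEq]
      congr 1
      · by_cases h1 : a = i <;> by_cases h2 : b = j <;> simp [h1, h2]
      · by_cases h1 : a = j <;> by_cases h2 : b = i <;> simp [h1, h2]
    simp only [hA', mul_sub, Finset.sum_sub_distrib, mul_ite, mul_one, mul_zero] at h
    have hs : ∀ (c d : ι), (∑ a, ∑ b, if a = c then if b = d then A.adjugate a b else 0 else 0) =
        A.adjugate c d := by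
      intro c d
      rw [Finset.sum_eq_single c (by simp +contextual) (by simp)]
      simp
    rw [hs, hs, hf, hadj' i j, pow_two, Derivation.leibniz, smul_eq_mul] at h
    apply mul_left_cancel₀ h2
    simp only [smul_apply, Q, of_apply, smul_eq_mul]
    linear_combination -h
  refine ⟨Q, hf, ?_, ?_⟩
  · have h := A.mul_adjugate
    rw [hQ, hf, Matrix.mul_smul, pow_two, mul_smul] at h
    exact smul_right_injective _ hf0 h
  · have h := A.adjugate_mul
    rw [hQ, hf, Matrix.smul_mul, pow_two, mul_smul] at h
    exact smul_right_injective _ hf0 h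

/-- A skew-symmetric matrix `P` over a commutative ring in which two is invertible has a Pfaffian
`f`, whose square is the determinant and which satisfies `P Q = Q P = f` for some matrix `Q`. -/
theorem exists_pfaffian {R : Type*} [CommRing R] (h2 : IsUnit (2 : R)) {ι : Type*} [Fintype ι]
    [DecidableEq ι] (P : Matrix ι ι R) (hP : Pᵀ = -P) :
    ∃ (f : R) (Q : Matrix ι ι R),
      P.det = f ^ 2 ∧ P * Q = f • (1 : Matrix ι ι R) ∧ Q * P = f • (1 : Matrix ι ι R) := by
  obtain ⟨c, hc⟩ := h2.exists_left_inv
  obtain ⟨f, Q, hdet, h₁, h₂⟩ := exists_pfaffian_generic ι _ rfl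
  -- The factor `c = ½` makes `X (i, j) - X (j, i)` specialize to `½ P i j - ½ P j i = P i j`.
  let φ : MvPolynomial (ι × ι) ℤ →+* R :=
    (MvPolynomial.aeval fun x : ι × ι => c * P x.1 x.2).toRingHom
  have hφ : ∀ x, φ (MvPolynomial.X x) = c * P x.1 x.2 := fun x => by simp [φ]
  set A : Matrix ι ι (MvPolynomial (ι × ι) ℤ) :=
    of fun i j => MvPolynomial.X (i, j) - MvPolynomial.X (j, i) with hA
  have hAP : φ.mapMatrix A = P := by
    ext i j
    have hs : P j i = -P i j := congrFun (congrFun hP i) j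
    simp only [RingHom.mapMatrix_apply, map_apply, hA, of_apply, map_sub, hφ, hs]
    linear_combination P i j * hc
  have hsm : φ.mapMatrix (f • (1 : Matrix ι ι (MvPolynomial (ι × ι) ℤ))) =
      φ f • (1 : Matrix ι ι R) := by
    ext i j
    simp [Matrix.one_apply, apply_ite φ]
  refine ⟨φ f, φ.mapMatrix Q, ?_, ?_, ?_⟩
  · rw [← hAP, ← RingHom.map_det, hdet, map_pow]
  · rw [← hsm, ← h₁, map_mul, hAP]
  · rw [← hsm, ← h₂, map_mul, hAP]

end Matrix

/-! ### Supercommutative rings and multiplicativity of the Berezinian. -/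

noncomputable section

namespace SuperGrading

variable {R : Type u} [Ring R] (σ : SuperGrading R)

/-- The homogeneous component of a parity: `false` is even, `true` is odd. -/
def homog : Bool → AddSubgroup R
  | false => σ.even.toAddSubgroup
  | true => σ.odd

theorem mul_mem_homog {p q : Bool} {a b : R} (ha : a ∈ σ.homog p) (hb : b ∈ σ.homog q) :
    a * b ∈ σ.homog (p ^^ q) := by
  cases p <;> cases q
  · exact σ.even.mul_mem ha hb
  · exact σ.even_mul_odd a ha b hb
  · have h := σ.even_mul_odd b hb a ha
    rwa [σ.even_comm b hb] at h
  · exact σ.odd_mul_odd a ha b hb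

theorem eq_zero_of_mem {a : R} (h₀ : a ∈ σ.even) (h₁ : a ∈ σ.odd) : a = 0 :=
  AddSubgroup.disjoint_def.1 σ.isCompl.disjoint h₀ h₁

theorem sub_evenPart_mem (a : R) : a - σ.evenPart a ∈ σ.odd := (σ.exists_evenPart a).choose_spec

theorem evenPart_eq {a : R} {b : σ.even} (h : a - b ∈ σ.odd) : σ.evenPart a = b := by
  refine Subtype.ext (sub_eq_zero.1 (σ.eq_zero_of_mem (sub_mem (σ.evenPart a).2 b.2) ?_))
  have := sub_mem h (σ.sub_evenPart_mem a)
  rwa [sub_sub_sub_cancel_left] at this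

@[simp] theorem evenPart_coe (a : σ.even) : σ.evenPart (a : R) = a :=
  σ.evenPart_eq (by simp [zero_mem])

theorem evenPart_add (a b : R) : σ.evenPart (a + b) = σ.evenPart a + σ.evenPart b := by
  refine σ.evenPart_eq ?_
  have := add_mem (σ.sub_evenPart_mem a) (σ.sub_evenPart_mem b)
  rwa [sub_add_sub_comm] at this

theorem mul_self_odd (h2 : IsUnit (2 : σ.even)) {a : R} (ha : a ∈ σ.odd) : a * a = 0 := by
  obtain ⟨c, hc⟩ := h2.exists_left_inv
  have hc' : (c : R) * 2 = 1 := congrArg Subtype.val hc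
  have h : a * a + a * a = 0 := by
    nth_rewrite 1 [σ.odd_anticomm a ha a ha]
    exact neg_add_cancel _
  calc a * a = c * 2 * (a * a) := by rw [hc', one_mul]
    _ = c * (a * a + a * a) := by rw [mul_assoc, two_mul]
    _ = 0 := by rw [h, mul_zero]

/-- Anticommutation gives `(a b)² = -a² b²`, and odd elements square to zero when `2` is invertible.
This nilpotency is why invertibility of an even supermatrix can be tested on its diagonal blocks. -/
theorem isNilpotent_odd_mul_odd (h2 : IsUnit (2 : σ.even)) {a b : R} (ha : a ∈ σ.odd)
    (hb : b ∈ σ.odd) (h : a * b ∈ σ.even) : IsNilpotent (⟨a * b, h⟩ : σ.even) := by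
  refine ⟨2, Subtype.ext ?_⟩
  change (a * b) ^ 2 = 0
  have e : (a * b) ^ 2 = a * (b * a) * b := by noncomm_ring
  rw [e, σ.odd_anticomm b hb a ha]
  have e' : a * -(a * b) * b = -((a * a) * (b * b)) := by noncomm_ring
  rw [e', σ.mul_self_odd h2 ha, zero_mul, neg_zero]

open Matrix

section Matrices

set_option linter.unusedSectionVars false

variable {ι κ : Type*} [Fintype ι] [DecidableEq ι] [Fintype κ] [DecidableEq κ]

/-- A matrix of even elements as a matrix over the whole ring. -/
def up : Matrix ι ι σ.even →+* Matrix ι ι R := σ.even.subtype.mapMatrix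

@[simp] theorem up_apply (A : Matrix ι ι σ.even) (i j : ι) : σ.up A i j = A i j := rfl

/-- All entries of the matrix are odd. -/
def IsOddMatrix {α β : Type*} (B : Matrix α β R) : Prop := ∀ i j, B i j ∈ σ.odd

variable {σ} {B : Matrix ι κ R} {C : Matrix κ ι R}

theorem exists_up_eq {M : Matrix ι ι R} (h : ∀ i j, M i j ∈ σ.even) : ∃ T, σ.up T = M :=
  ⟨of fun i j => ⟨M i j, h i j⟩, rfl⟩

theorem IsOddMatrix.neg (hB : σ.IsOddMatrix B) : σ.IsOddMatrix (-B) :=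
  fun i j => neg_mem (hB i j)

theorem IsOddMatrix.add {B' : Matrix ι κ R} (hB : σ.IsOddMatrix B) (hB' : σ.IsOddMatrix B') :
    σ.IsOddMatrix (B + B') := fun i j => add_mem (hB i j) (hB' i j)

theorem isOddMatrix_zero : σ.IsOddMatrix (0 : Matrix ι κ R) := fun _ _ => zero_mem _

theorem IsOddMatrix.up_mul (hB : σ.IsOddMatrix B) (A : Matrix ι ι σ.even) :
    σ.IsOddMatrix (σ.up A * B) := fun i j => by
  rw [mul_apply]
  exact sum_mem fun k _ => σ.even_mul_odd _ (A i k).2 _ (hB k j)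

theorem IsOddMatrix.mul_up (hB : σ.IsOddMatrix B) (D : Matrix κ κ σ.even) :
    σ.IsOddMatrix (B * σ.up D) := fun i j => by
  rw [mul_apply]
  refine sum_mem fun k _ => ?_
  rw [σ.up_apply, ← σ.even_comm _ (D k j).2]
  exact σ.even_mul_odd _ (D k j).2 _ (hB i k)

theorem IsOddMatrix.exists_up_mul (hB : σ.IsOddMatrix B) (hC : σ.IsOddMatrix C) :
    ∃ T, σ.up T = B * C :=
  exists_up_eq fun i j => by
    rw [mul_apply]
    exact sum_mem fun k _ => σ.odd_mul_odd _ (hB i k) _ (hC k j)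

theorem IsOddMatrix.exists_schur (hB : σ.IsOddMatrix B) (hC : σ.IsOddMatrix C)
    (A : Matrix ι ι σ.even) (D : Matrix κ κ σ.even) :
    ∃ T, σ.up T = σ.up A - B * σ.up D * C := by
  obtain ⟨T, hT⟩ := (hB.mul_up D).exists_up_mul hC
  exact ⟨A - T, by rw [map_sub, hT]⟩

/-- Adding a product of odd matrices does not change the invertibility of a determinant. -/
theorem isUnit_det_of_up_eq_add (h2 : IsUnit (2 : σ.even)) (hB : σ.IsOddMatrix B)
    (hC : σ.IsOddMatrix C) {A T : Matrix ι ι σ.even} (h : σ.up T = σ.up A + B * C)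
    (hA : IsUnit A.det) : IsUnit T.det := by
  -- `T` and `A` agree modulo the nilradical, hence so do their determinants, and a unit plus a
  -- nilpotent is a unit.
  have hmem : ∀ i j, Ideal.Quotient.mk (nilradical σ.even) (T i j) =
      Ideal.Quotient.mk (nilradical σ.even) (A i j) := by
    intro i j
    rw [Ideal.Quotient.eq]
    have e : T i j - A i j =
        ∑ k, ⟨B i k * C k j, σ.odd_mul_odd _ (hB i k) _ (hC k j)⟩ := by
      apply Subtype.ext
      have := congrFun (congrFun h i) j
      rw [Matrix.add_apply, mul_apply, σ.up_apply, σ.up_apply] at this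
      push_cast
      rw [this, add_sub_cancel_left]
    rw [e]
    exact sum_mem fun k _ => σ.isNilpotent_odd_mul_odd h2 (hB i k) (hC k j) _
  have hdet : Ideal.Quotient.mk (nilradical σ.even) T.det =
      Ideal.Quotient.mk (nilradical σ.even) A.det := by
    rw [RingHom.map_det, RingHom.map_det]
    congr 1
    ext i j
    exact hmem i j
  rw [Ideal.Quotient.eq, mem_nilradical] at hdet
  simpa using hdet.isUnit_add_right_of_commute hA (Commute.all _ _)

theorem up_inv_mul {D : Matrix ι ι σ.even} (hD : IsUnit D.det) : σ.up D⁻¹ * σ.up D = 1 := by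
  rw [← map_mul, nonsing_inv_mul _ hD, map_one]

theorem up_mul_inv {D : Matrix ι ι σ.even} (hD : IsUnit D.det) : σ.up D * σ.up D⁻¹ = 1 := by
  rw [← map_mul, mul_nonsing_inv _ hD, map_one]

end Matrices

section Berezinian

variable {m n : ℕ}

/-- The supermatrix defines an even map: its entries have the parity prescribed by their
position. -/
def IsEvenMatrix (N : Matrix (Fin m ⊕ Fin n) (Fin m ⊕ Fin n) R) : Prop :=
  ∀ i j, N i j ∈ σ.homog (i.isRight ^^ j.isRight)

/-- The supermatrix defines an even invertible map. -/
def IsEvenUnit (N : Matrix (Fin m ⊕ Fin n) (Fin m ⊕ Fin n) R) : Prop :=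
  σ.IsEvenMatrix N ∧ ∃ N', σ.IsEvenMatrix N' ∧ N * N' = 1 ∧ N' * N = 1

variable {σ} {M N : Matrix (Fin m ⊕ Fin n) (Fin m ⊕ Fin n) R}
  {A : Matrix (Fin m) (Fin m) σ.even} {B : Matrix (Fin m) (Fin n) R}
  {C : Matrix (Fin n) (Fin m) R} {D : Matrix (Fin n) (Fin n) σ.even}

theorem isEvenMatrix_fromBlocks (hB : σ.IsOddMatrix B) (hC : σ.IsOddMatrix C) :
    σ.IsEvenMatrix (fromBlocks (σ.up A) B C (σ.up D)) := by
  rintro (i | i) (j | j)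
  exacts [(A i j).2, hB i j, hC i j, (D i j).2]

theorem IsEvenMatrix.exists_fromBlocks (hN : σ.IsEvenMatrix N) :
    ∃ A B C D, σ.IsOddMatrix B ∧ σ.IsOddMatrix C ∧ N = fromBlocks (σ.up A) B C (σ.up D) := by
  obtain ⟨A, hA⟩ := exists_up_eq (σ := σ) (M := N.toBlocks₁₁) fun i j => hN (Sum.inl i) (Sum.inl j)
  obtain ⟨D, hD⟩ := exists_up_eq (σ := σ) (M := N.toBlocks₂₂) fun i j => hN (Sum.inr i) (Sum.inr j)
  exact ⟨A, N.toBlocks₁₂, N.toBlocks₂₁, D, fun i j => hN (Sum.inl i) (Sum.inr j),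
    fun i j => hN (Sum.inr i) (Sum.inl j), by rw [hA, hD, fromBlocks_toBlocks]⟩

theorem IsEvenMatrix.mul (hM : σ.IsEvenMatrix M) (hN : σ.IsEvenMatrix N) :
    σ.IsEvenMatrix (M * N) := fun i j => by
  rw [mul_apply]
  refine sum_mem fun k _ => ?_
  have := σ.mul_mem_homog (hM i k) (hN k j)
  rwa [Bool.xor_assoc, ← Bool.xor_assoc k.isRight, Bool.xor_self, Bool.false_xor] at this

theorem IsEvenUnit.mul (hM : σ.IsEvenUnit M) (hN : σ.IsEvenUnit N) : σ.IsEvenUnit (M * N) := by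
  obtain ⟨hM, M', hM', e₁, e₂⟩ := hM
  obtain ⟨hN, N', hN', e₃, e₄⟩ := hN
  refine ⟨hM.mul hN, N' * M', hN'.mul hM', ?_, ?_⟩
  · rw [Matrix.mul_assoc, ← Matrix.mul_assoc N, e₃, Matrix.one_mul, e₁]
  · rw [Matrix.mul_assoc, ← Matrix.mul_assoc M', e₂, Matrix.one_mul, e₄]

theorem isEvenUnit_upper (hB : σ.IsOddMatrix B) : σ.IsEvenUnit (fromBlocks 1 B 0 1) := by
  rw [← map_one σ.up, ← map_one σ.up]
  refine ⟨isEvenMatrix_fromBlocks hB isOddMatrix_zero, _,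
    isEvenMatrix_fromBlocks (A := 1) (D := 1) hB.neg isOddMatrix_zero, ?_, ?_⟩ <;>
  simp [fromBlocks_multiply]

theorem isEvenUnit_lower (hC : σ.IsOddMatrix C) : σ.IsEvenUnit (fromBlocks 1 0 C 1) := by
  rw [← map_one σ.up, ← map_one σ.up]
  refine ⟨isEvenMatrix_fromBlocks isOddMatrix_zero hC, _,
    isEvenMatrix_fromBlocks (A := 1) (D := 1) isOddMatrix_zero hC.neg, ?_, ?_⟩ <;>
  simp [fromBlocks_multiply]

theorem isEvenUnit_diag (hA : IsUnit A.det) (hD : IsUnit D.det) :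
    σ.IsEvenUnit (fromBlocks (σ.up A) 0 0 (σ.up D)) := by
  refine ⟨isEvenMatrix_fromBlocks isOddMatrix_zero isOddMatrix_zero, _,
    isEvenMatrix_fromBlocks (A := A⁻¹) (D := D⁻¹) isOddMatrix_zero isOddMatrix_zero, ?_, ?_⟩ <;>
  simp [fromBlocks_multiply, up_inv_mul, up_mul_inv, hA, hD]

/-- The diagonal blocks of `N N' = 1` read `A A' + B C' = 1` and `C B' + D D' = 1`; the products of
odd matrices do not affect invertibility of the determinants. -/
theorem IsEvenUnit.isUnit_det (h2 : IsUnit (2 : σ.even)) (hB : σ.IsOddMatrix B)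
    (hC : σ.IsOddMatrix C) (h : σ.IsEvenUnit (fromBlocks (σ.up A) B C (σ.up D))) :
    IsUnit A.det ∧ IsUnit D.det := by
  obtain ⟨-, N', hN', e, -⟩ := h
  obtain ⟨A', B', C', D', hB', hC', rfl⟩ := hN'.exists_fromBlocks
  rw [fromBlocks_multiply, ← fromBlocks_one, fromBlocks_inj] at e
  obtain ⟨eA, -, -, eD⟩ := e
  constructor
  · have : IsUnit (A * A').det := by
      refine isUnit_det_of_up_eq_add h2 hB hC'.neg (A := 1) ?_ (by simp)
      rw [map_one, ← eA, map_mul]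
      simp
    rw [det_mul] at this
    exact isUnit_of_mul_isUnit_left this
  · have : IsUnit (D * D').det := by
      refine isUnit_det_of_up_eq_add h2 hC hB'.neg (A := 1) ?_ (by simp)
      rw [map_one, ← eD, map_mul]
      simp
    rw [det_mul] at this
    exact isUnit_of_mul_isUnit_left this

/-- Block elimination around the invertible `D`. It reduces statements about the Berezinian to
unipotent and block-diagonal factors. -/
theorem fromBlocks_eq_upper_mul_diag_mul_lower (hD : IsUnit D.det) {T : Matrix (Fin m) (Fin m) σ.even}
    (hT : σ.up T = σ.up A - B * σ.up D⁻¹ * C) :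
    fromBlocks (σ.up A) B C (σ.up D) = fromBlocks 1 (B * σ.up D⁻¹) 0 1 *
      fromBlocks (σ.up T) 0 0 (σ.up D) * fromBlocks 1 0 (σ.up D⁻¹ * C) 1 := by
  simp only [fromBlocks_multiply, Matrix.one_mul, Matrix.mul_one, Matrix.zero_mul, Matrix.mul_zero,
    add_zero, zero_add]
  rw [Matrix.mul_assoc B, up_inv_mul hD, Matrix.mul_one, ← Matrix.mul_assoc (σ.up D),
    up_mul_inv hD, Matrix.one_mul, hT, ← Matrix.mul_assoc B, sub_add_cancel]

theorem isEvenUnit_fromBlocks (h2 : IsUnit (2 : σ.even)) (hB : σ.IsOddMatrix B)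
    (hC : σ.IsOddMatrix C) (hA : IsUnit A.det) (hD : IsUnit D.det) :
    σ.IsEvenUnit (fromBlocks (σ.up A) B C (σ.up D)) := by
  obtain ⟨T, hT⟩ := hB.exists_schur hC A D⁻¹
  rw [fromBlocks_eq_upper_mul_diag_mul_lower hD hT]
  refine ((isEvenUnit_upper (hB.mul_up _)).mul (isEvenUnit_diag ?_ hD)).mul
    (isEvenUnit_lower (hC.up_mul _))
  refine isUnit_det_of_up_eq_add h2 (hB.mul_up D⁻¹) hC.neg ?_ hA
  rw [hT, Matrix.mul_neg, sub_eq_add_neg]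

theorem IsEvenUnit.exists_decomposition (h2 : IsUnit (2 : σ.even)) (hN : σ.IsEvenUnit N) :
    ∃ (A : Matrix (Fin m) (Fin m) σ.even) (B : Matrix (Fin m) (Fin n) R)
      (C : Matrix (Fin n) (Fin m) R) (D : Matrix (Fin n) (Fin n) σ.even),
      IsUnit A.det ∧ σ.IsOddMatrix B ∧ σ.IsOddMatrix C ∧ IsUnit D.det ∧
      N = fromBlocks 1 B 0 1 * fromBlocks (σ.up A) 0 0 (σ.up D) * fromBlocks 1 0 C 1 := by
  obtain ⟨A, B, C, D, hB, hC, rfl⟩ := hN.1.exists_fromBlocks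
  obtain ⟨hA, hD⟩ := hN.isUnit_det h2 hB hC
  obtain ⟨T, hT⟩ := hB.exists_schur hC A D⁻¹
  refine ⟨T, _, _, D, ?_, hB.mul_up D⁻¹, hC.up_mul D⁻¹, hD,
    fromBlocks_eq_upper_mul_diag_mul_lower hD hT⟩
  refine isUnit_det_of_up_eq_add h2 (hB.mul_up D⁻¹) hC.neg ?_ hA
  rw [hT, Matrix.mul_neg, sub_eq_add_neg]

/-- Removes `evenPart` from computations: any even matrix `T` representing the Schur complement may
be used. -/
theorem ber_fromBlocks {T : Matrix (Fin m) (Fin m) σ.even}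
    (hT : σ.up T = σ.up A - B * σ.up D⁻¹ * C) :
    σ.ber (fromBlocks (σ.up A) B C (σ.up D)) = T.det * Ring.inverse D.det := by
  have hD : (of fun k l => σ.evenPart (fromBlocks (σ.up A) B C (σ.up D) (Sum.inr k) (Sum.inr l))) =
      D := by
    ext k l
    simp
  unfold ber
  rw [hD]
  dsimp only
  congr 2
  refine Matrix.ext fun i j => ?_
  rw [of_apply, ← σ.evenPart_coe (T i j)]
  congr 2
  have := congrFun (congrFun hT i) j
  rw [σ.up_apply] at this
  rw [this, Matrix.sub_apply, mul_apply]
  simp only [fromBlocks_apply₁₁, fromBlocks_apply₁₂, fromBlocks_apply₂₁, mul_apply, σ.up_apply,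
    Finset.sum_mul]
  rw [Finset.sum_comm]

theorem ber_diag : σ.ber (fromBlocks (σ.up A) 0 0 (σ.up D)) = A.det * Ring.inverse D.det :=
  ber_fromBlocks (by simp)

/-- The factor changes `A` to `A + B C` and `B'` to `B' + B D`, which leaves `D` and the Schur
complement alone. A lower factor on the right is equally harmless; the hard case of multiplicativity
is an upper factor on the right. -/
theorem ber_upper_mul (hB : σ.IsOddMatrix B) (h2 : IsUnit (2 : σ.even)) (hM : σ.IsEvenUnit M) :
    σ.ber (fromBlocks 1 B 0 1 * M) = σ.ber M := by
  obtain ⟨A, B', C, D, hB', hC, rfl⟩ := hM.1.exists_fromBlocks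
  obtain ⟨-, hD⟩ := hM.isUnit_det h2 hB' hC
  obtain ⟨T, hT⟩ := hB'.exists_schur hC A D⁻¹
  obtain ⟨T', hT'⟩ := hB.exists_up_mul hC
  rw [ber_fromBlocks hT, fromBlocks_multiply]
  simp only [Matrix.one_mul, Matrix.zero_mul, zero_add]
  rw [← hT', ← map_add]
  refine ber_fromBlocks ?_
  rw [hT, map_add, hT', Matrix.add_mul, Matrix.mul_assoc B, up_mul_inv hD, Matrix.add_mul,
    Matrix.mul_one]
  abel

theorem ber_mul_lower (hC : σ.IsOddMatrix C) (h2 : IsUnit (2 : σ.even)) (hM : σ.IsEvenUnit M) :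
    σ.ber (M * fromBlocks 1 0 C 1) = σ.ber M := by
  obtain ⟨A, B, C', D, hB, hC', rfl⟩ := hM.1.exists_fromBlocks
  obtain ⟨-, hD⟩ := hM.isUnit_det h2 hB hC'
  obtain ⟨T, hT⟩ := hB.exists_schur hC' A D⁻¹
  obtain ⟨T', hT'⟩ := hB.exists_up_mul hC
  rw [ber_fromBlocks hT, fromBlocks_multiply]
  simp only [Matrix.mul_one, Matrix.mul_zero, zero_add]
  rw [← hT', ← map_add]
  refine ber_fromBlocks ?_
  rw [hT, map_add, hT', Matrix.mul_add, Matrix.mul_assoc B, Matrix.mul_assoc B,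
    ← Matrix.mul_assoc (σ.up D⁻¹) (σ.up D), up_inv_mul hD, Matrix.one_mul]
  abel

theorem ber_diag_mul (hD : IsUnit D.det) (hM : σ.IsEvenUnit M) : σ.ber (fromBlocks (σ.up A) 0 0 (σ.up D) * M) =
      A.det * Ring.inverse D.det * σ.ber M := by
  obtain ⟨A', B, C, D', hB, hC, rfl⟩ := hM.1.exists_fromBlocks
  obtain ⟨T, hT⟩ := hB.exists_schur hC A' D'⁻¹
  rw [ber_fromBlocks hT, fromBlocks_multiply]
  simp only [Matrix.zero_mul, zero_add, add_zero]
  rw [← map_mul, ← map_mul, ber_fromBlocks (T := A * T), det_mul, det_mul, Ring.mul_inverse_rev]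
  · ring
  · rw [map_mul, hT, map_mul, Matrix.mul_inv_rev, map_mul, Matrix.mul_sub, Matrix.mul_assoc (σ.up A) B,
      Matrix.mul_assoc (σ.up A), ← Matrix.mul_assoc B, Matrix.mul_assoc (B * σ.up D'⁻¹),
      ← Matrix.mul_assoc (σ.up D⁻¹), up_inv_mul hD, Matrix.one_mul]

theorem ber_mul_diag (hD : IsUnit D.det) (hM : σ.IsEvenUnit M) : σ.ber (M * fromBlocks (σ.up A) 0 0 (σ.up D)) =
      σ.ber M * (A.det * Ring.inverse D.det) := by
  obtain ⟨A', B, C, D', hB, hC, rfl⟩ := hM.1.exists_fromBlocks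
  obtain ⟨T, hT⟩ := hB.exists_schur hC A' D'⁻¹
  rw [ber_fromBlocks hT, fromBlocks_multiply]
  simp only [Matrix.mul_zero, zero_add, add_zero]
  rw [← map_mul, ← map_mul, ber_fromBlocks (T := T * A), det_mul, det_mul, Ring.mul_inverse_rev]
  · ring
  · rw [map_mul, hT, map_mul, Matrix.mul_inv_rev, map_mul, Matrix.sub_mul, ← Matrix.mul_assoc (B * σ.up D),
      Matrix.mul_assoc B (σ.up D), up_mul_inv hD, Matrix.mul_one, ← Matrix.mul_assoc]

/-- The main case of the multiplicativity of the Berezinian. -/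
theorem ber_lower_mul_upper_single (h2 : IsUnit (2 : σ.even)) (hC : σ.IsOddMatrix C) (i : Fin m)
    (j : Fin n) {b : R} (hb : b ∈ σ.odd) :
    σ.ber (fromBlocks 1 0 C 1 * fromBlocks 1 (single i j b) 0 1) = 1 := by
  have hE : σ.IsOddMatrix (single i j b) := fun k l => by
    rw [single_apply]
    split_ifs
    exacts [hb, zero_mem _]
  set E := single i j b with hEdef
  obtain ⟨P, hP⟩ := hC.exists_up_mul hE
  obtain ⟨Q, hQ⟩ := hE.exists_up_mul hC
  let c : σ.even := ⟨C j i * b, σ.odd_mul_odd _ (hC j i) _ hb⟩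
  -- `C E` lives in column `j` and `E C` in row `i`, so both determinants below come from rank-one
  -- perturbations of the identity.
  have hPent : ∀ k l, P k l = if l = j then P k j else 0 := by
    intro k l
    apply Subtype.ext
    split_ifs with h
    · rw [h]
    · have := congrFun (congrFun hP k) l
      rw [σ.up_apply] at this
      rw [this, hEdef, mul_single_apply_of_ne _ _ _ _ _ h]
      rfl
  have hQent : ∀ k l, Q k l = if k = i then Q i l else 0 := by
    intro k l
    apply Subtype.ext
    split_ifs with h
    · rw [h]
    · have := congrFun (congrFun hQ k) l
      rw [σ.up_apply] at this
      rw [this, hEdef, single_mul_apply_of_ne _ _ _ _ _ h]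
      rfl
  have hPjj : P j j = c := by
    apply Subtype.ext
    have := congrFun (congrFun hP j) j
    rw [σ.up_apply] at this
    rw [this, hEdef, mul_single_apply_same]
  -- Anticommutation of `b` with `C j i` yields the sign by which the two determinants are `1 + c`
  -- and `1 - c`, mutually inverse because `c² = 0`.
  have hQii : Q i i = -c := by
    apply Subtype.ext
    have := congrFun (congrFun hQ i) i
    rw [σ.up_apply] at this
    rw [this, hEdef, single_mul_apply_same, σ.odd_anticomm b hb _ (hC j i)]
    rfl
  have hdetP : (1 + P).det = 1 + c := by
    have : P = replicateCol Unit (fun k => P k j) *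
        replicateRow Unit (Pi.single j (1 : σ.even)) := by
      refine Matrix.ext fun k l => ?_
      rw [hPent k l, mul_apply]
      simp [Pi.single_apply]
    rw [this, det_one_add_replicateCol_mul_replicateRow, single_one_dotProduct, hPjj]
  have hdetQ : (1 + Q).det = 1 - c := by
    have : Q = replicateCol Unit (Pi.single i (1 : σ.even)) *
        replicateRow Unit (fun l => Q i l) := by
      refine Matrix.ext fun k l => ?_
      rw [hQent k l, mul_apply]
      simp [Pi.single_apply]
    rw [this, det_one_add_replicateCol_mul_replicateRow, dotProduct_single_one, hQii,
      sub_eq_add_neg]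
  have hprod : (1 + Q).det * (1 + P).det = 1 := by
    have hc : c * c = 0 := by
      apply Subtype.ext
      change C j i * b * (C j i * b) = 0
      have e : C j i * b * (C j i * b) = C j i * (b * C j i) * b := by noncomm_ring
      rw [e, σ.odd_anticomm b hb _ (hC j i)]
      have e' : C j i * -(C j i * b) * b = -((C j i * C j i) * (b * b)) := by noncomm_ring
      rw [e', σ.mul_self_odd h2 hb, mul_zero, neg_zero]
    rw [hdetP, hdetQ]
    linear_combination -hc
  have hPu : IsUnit (1 + P).det := IsUnit.of_mul_eq_one_right _ hprod
  have hQu : IsUnit (1 + Q).det := IsUnit.of_mul_eq_one _ hprod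
  have hup : σ.up (1 + P) = 1 + C * E := by rw [map_add, map_one, hP]
  have huq : σ.up (1 + Q) = 1 + E * C := by rw [map_add, map_one, hQ]
  rw [fromBlocks_multiply]
  simp only [Matrix.mul_one, Matrix.one_mul, Matrix.mul_zero, add_zero]
  rw [add_comm (C * E), ← hup, ← map_one σ.up, ber_fromBlocks (T := (1 + Q)⁻¹), det_nonsing_inv,
    ← Ring.mul_inverse_rev, mul_comm, hprod, Ring.inverse_one]
  -- The Schur complement `1 - E (1 + C E)⁻¹ C` is `(1 + E C)⁻¹`, since `C (1 + E C) = (1 + C E) C`.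
  have key : (1 - E * σ.up (1 + P)⁻¹ * C) * σ.up (1 + Q) = 1 := by
    have e : C * σ.up (1 + Q) = σ.up (1 + P) * C := by
      rw [hup, huq, Matrix.mul_add, Matrix.add_mul, Matrix.mul_one, Matrix.one_mul,
        Matrix.mul_assoc]
    rw [Matrix.sub_mul, Matrix.mul_assoc (E * _), e, Matrix.mul_assoc E,
      ← Matrix.mul_assoc (σ.up (1 + P)⁻¹), up_inv_mul hPu, Matrix.one_mul, Matrix.one_mul, huq,
      add_sub_cancel_right]
  rw [map_one]
  calc σ.up (1 + Q)⁻¹ = (1 - E * σ.up (1 + P)⁻¹ * C) * σ.up (1 + Q) * σ.up (1 + Q)⁻¹ := by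
        rw [key, Matrix.one_mul]
    _ = _ := by rw [Matrix.mul_assoc _ (σ.up (1 + Q)), up_mul_inv hQu, Matrix.mul_one]

/-- `B ↦ fromBlocks 1 B 0 1` turns sums into products, so a single nonzero entry suffices. Factoring
`M` as upper times diagonal times lower then strips off everything except the product computed in
`ber_lower_mul_upper_single`. -/
theorem ber_mul_upper (h2 : IsUnit (2 : σ.even)) (hB : σ.IsOddMatrix B) (hM : σ.IsEvenUnit M) :
    σ.ber (M * fromBlocks 1 B 0 1) = σ.ber M := by
  let p : Matrix (Fin m) (Fin n) R → Prop := fun B => σ.IsOddMatrix B ∧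
    ∀ M : Matrix (Fin m ⊕ Fin n) (Fin m ⊕ Fin n) R, σ.IsEvenUnit M →
      σ.ber (M * fromBlocks 1 B 0 1) = σ.ber M
  have hadd : ∀ B B', p B → p B' → p (B + B') := by
    rintro B B' ⟨hB, h⟩ ⟨hB', h'⟩
    refine ⟨hB.add hB', fun M hM => ?_⟩
    have e : fromBlocks 1 (B + B') 0 1 =
        (fromBlocks 1 B 0 1 * fromBlocks 1 B' 0 1 : Matrix (Fin m ⊕ Fin n) (Fin m ⊕ Fin n) R) := by
      simp [fromBlocks_multiply, add_comm]
    rw [e, ← Matrix.mul_assoc, h' _ (hM.mul (isEvenUnit_upper hB)), h M hM]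
  have hzero : p 0 := ⟨isOddMatrix_zero, fun M _ => by rw [fromBlocks_one, Matrix.mul_one]⟩
  suffices h : p B from h.2 M hM
  rw [matrix_eq_sum_single B]
  refine Finset.sum_induction _ p hadd hzero fun i _ =>
    Finset.sum_induction _ p hadd hzero fun j _ => ?_
  have hE : σ.IsOddMatrix (single i j (B i j)) := fun k l => by
    rw [single_apply]
    split_ifs
    exacts [hB i j, zero_mem _]
  refine ⟨hE, fun M hM => ?_⟩
  obtain ⟨A, B', C, D, hA, hB', hC, hD, rfl⟩ := hM.exists_decomposition h2
  have hLU := (isEvenUnit_lower hC).mul (isEvenUnit_upper hE)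
  have hL := isEvenUnit_lower (σ := σ) hC
  have hΔ := isEvenUnit_diag (σ := σ) hA hD
  rw [Matrix.mul_assoc, Matrix.mul_assoc, ber_upper_mul hB' h2 (hΔ.mul hLU),
    ber_diag_mul hD hLU, ber_lower_mul_upper_single h2 hC i j (hB i j), Matrix.mul_assoc,
    ber_upper_mul hB' h2 (hΔ.mul hL), ber_mul_lower hC h2 hΔ, ber_diag, mul_one]

/-- The Berezinian is multiplicative. -/
theorem ber_mul (h2 : IsUnit (2 : σ.even)) (hM : σ.IsEvenUnit M) (hN : σ.IsEvenUnit N) :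
    σ.ber (M * N) = σ.ber M * σ.ber N := by
  obtain ⟨A, B, C, D, hA, hB, hC, hD, rfl⟩ := hN.exists_decomposition h2
  have hU := isEvenUnit_upper (σ := σ) hB
  have hΔ := isEvenUnit_diag (σ := σ) hA hD
  rw [← Matrix.mul_assoc, ← Matrix.mul_assoc, ber_mul_lower hC h2 ((hM.mul hU).mul hΔ),
    ber_mul_diag hD (hM.mul hU), ber_mul_upper h2 hB hM, ber_mul_lower hC h2 (hU.mul hΔ),
    ber_upper_mul hB h2 hΔ, ber_diag]

theorem ber_one : σ.ber (1 : Matrix (Fin m ⊕ Fin n) (Fin m ⊕ Fin n) R) = 1 := by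
  rw [← fromBlocks_one, ← map_one σ.up, ← map_one σ.up, ber_diag]
  simp

/-- The Berezinian is compatible with base change. -/
theorem ber_map (h2 : IsUnit (2 : σ.even)) {R' : Type u} [Ring R'] {σ' : SuperGrading R'}
    (φ : R →+* R') (ψ : σ.even →+* σ'.even) (hψ : ∀ a, (ψ a : R') = φ a)
    (hM : σ.IsEvenUnit M) : σ'.ber (M.map φ) = ψ (σ.ber M) := by
  obtain ⟨A, B, C, D, hB, hC, rfl⟩ := hM.1.exists_fromBlocks
  obtain ⟨-, hD⟩ := hM.isUnit_det h2 hB hC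
  obtain ⟨T, hT⟩ := hB.exists_schur hC A D⁻¹
  have hup : ∀ {k : ℕ} (P : Matrix (Fin k) (Fin k) σ.even),
      (σ.up P).map φ = σ'.up (ψ.mapMatrix P) := by
    intro k P
    ext i j
    exact (hψ _).symm
  have hinv : (ψ.mapMatrix D)⁻¹ = ψ.mapMatrix D⁻¹ := by
    apply inv_eq_right_inv
    rw [← map_mul, mul_nonsing_inv _ hD, map_one]
  rw [ber_fromBlocks hT, fromBlocks_map, hup, hup, ber_fromBlocks (T := ψ.mapMatrix T), map_mul,
    RingHom.map_det, ← RingHom.map_det _ D]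
  · congr 1
    obtain ⟨u, hu⟩ := hD
    rw [← hu, Ring.inverse_unit]
    exact Ring.inverse_unit (Units.map (ψ : σ.even →* σ'.even) u)
  · rw [← hup, hT, hinv, ← hup, ← hup, ← Matrix.map_mul, ← Matrix.map_mul, Matrix.map_sub _ (map_sub φ)]

end Berezinian

end SuperGrading


/-! ### Bases, homogeneous frames and their matrices. -/

/-- Applying an invertible matrix to a basis gives a basis. -/
theorem linearIndependent_and_span_of_matrix {R M ι : Type*} [Ring R] [AddCommGroup M] [Module R M]
    [Fintype ι] [DecidableEq ι] {v w : ι → M} {P P' : Matrix ι ι R}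
    (h : P * P' = 1) (h' : P' * P = 1) (hw : ∀ j, w j = ∑ i, P j i • v i)
    (hv : LinearIndependent R v) (hs : Submodule.span R (Set.range v) = ⊤) :
    LinearIndependent R w ∧ Submodule.span R (Set.range w) = ⊤ := by
  constructor
  · rw [Fintype.linearIndependent_iff] at hv ⊢
    intro c hc
    have hcP : Matrix.vecMul c P = 0 := by
      funext i
      refine hv (Matrix.vecMul c P) ?_ i
      rw [← hc]
      simp only [hw, Matrix.vecMul, dotProduct, Finset.sum_smul, Finset.smul_sum, mul_smul]
      rw [Finset.sum_comm]
    have : c = Matrix.vecMul (Matrix.vecMul c P) P' := by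
      rw [Matrix.vecMul_vecMul, h, Matrix.vecMul_one]
    rw [this, hcP, Matrix.zero_vecMul]
    exact fun _ => rfl
  · rw [eq_top_iff, ← hs, Submodule.span_le]
    rintro _ ⟨i, rfl⟩
    have : v i = ∑ j, P' i j • w j := by
      have e : ∀ k, (∑ j, P' i j * P j k) = (1 : Matrix ι ι R) i k := fun k => by
        rw [← h', Matrix.mul_apply]
      simp only [hw, Finset.smul_sum, smul_smul]
      rw [Finset.sum_comm]
      simp only [← Finset.sum_smul, e, Matrix.one_apply, ite_smul, one_smul, zero_smul]
      simp
    rw [this]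
    exact sum_mem fun j _ => Submodule.smul_mem _ _ (Submodule.subset_span ⟨j, rfl⟩)

theorem SuperGrading.exists_homog_add {R : Type u} [Ring R] (σ : SuperGrading R) (p : Bool)
    (a : R) : ∃ b ∈ σ.homog p, ∃ c ∈ σ.homog (!p), a = b + c := by
  cases p
  · exact ⟨_, (σ.evenPart a).2, _, σ.sub_evenPart_mem a, by simp⟩
  · exact ⟨_, σ.sub_evenPart_mem a, _, (σ.evenPart a).2, by simp⟩

namespace Superspace

variable (S : Superspace.{u})

theorem isUnit_two (W : Opens S.X) : IsUnit (2 : S.evenFn W) := by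
  have h : IsUnit (2 : ℂ) := two_ne_zero.isUnit
  have := (h.map S.ofComplex).map (S.evenRes (le_top : W ≤ ⊤))
  rw [← one_add_one_eq_two, map_add, map_one, map_add, map_one, one_add_one_eq_two] at this
  exact this

theorem res_self {W : Opens S.X} (a : S.fn W) : S.res le_rfl a = a := by
  change (S.sheaf.presheaf.map (𝟙 (op W))).hom a = a
  rw [S.sheaf.presheaf.map_id]
  rfl

theorem res_res {W W' W'' : Opens S.X} (h : W' ≤ W) (h' : W'' ≤ W') (a : S.fn W) :
    S.res h' (S.res h a) = S.res (h'.trans h) a := by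
  change ((S.sheaf.presheaf.map (homOfLE h).op) ≫ (S.sheaf.presheaf.map (homOfLE h').op)).hom a = _
  rw [← S.sheaf.presheaf.map_comp]
  rfl

theorem coe_evenRes {W W' : Opens S.X} (h : W' ≤ W) (a : S.evenFn W) :
    (S.evenRes h a : S.fn W') = S.res h a := rfl

theorem evenRes_evenRes {W W' W'' : Opens S.X} (h : W' ≤ W) (h' : W'' ≤ W') (a : S.evenFn W) :
    S.evenRes h' (S.evenRes h a) = S.evenRes (h'.trans h) a := Subtype.ext (S.res_res h h' a)

theorem res_mem_homog {W W' : Opens S.X} (h : W' ≤ W) {p : Bool} {a : S.fn W}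
    (ha : a ∈ (S.grading W).homog p) : S.res h a ∈ (S.grading W').homog p := by
  cases p
  exacts [S.map_even W W' h a ha, S.map_odd W W' h a ha]

variable {S} {m n : ℕ}

theorem ber_map_res {W W' : Opens S.X} (h : W' ≤ W)
    {P : Matrix (Fin m ⊕ Fin n) (Fin m ⊕ Fin n) (S.fn W)} (hP : (S.grading W).IsEvenUnit P) :
    (S.grading W').ber (P.map (S.res h)) = S.evenRes h ((S.grading W).ber P) :=
  SuperGrading.ber_map (S.isUnit_two W) (S.res h) (S.evenRes h) (fun _ => rfl) hP

end Superspace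

namespace SuperModule

variable {S : Superspace.{u}}

/-- The homogeneous component of a parity: `false` is even, `true` is odd. -/
def homog (M : SuperModule S) (W : Opens S.X) : Bool → AddSubgroup (M.obj W)
  | false => M.even W
  | true => M.odd W

variable {M N E F : SuperModule S}

theorem smul_mem_homog {W : Opens S.X} {p q : Bool} {a : S.fn W} {v : M.obj W}
    (ha : a ∈ (S.grading W).homog p) (hv : v ∈ M.homog W q) : a • v ∈ M.homog W (p ^^ q) := by
  cases p <;> cases q
  exacts [M.even_smul_even W a ha v hv, M.even_smul_odd W a ha v hv, M.odd_smul_even W a ha v hv,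
    M.odd_smul_odd W a ha v hv]

theorem res_mem_homog {W W' : Opens S.X} (h : W' ≤ W) {p : Bool} {v : M.obj W}
    (hv : v ∈ M.homog W p) : M.res h v ∈ M.homog W' p := by
  cases p
  exacts [M.res_even h v hv, M.res_odd h v hv]

theorem eq_zero_of_mem_homog {W : Opens S.X} {p : Bool} {v : M.obj W} (h : v ∈ M.homog W p)
    (h' : v ∈ M.homog W (!p)) : v = 0 := by
  cases p
  · exact AddSubgroup.disjoint_def.1 (M.isCompl W).disjoint h h'
  · exact AddSubgroup.disjoint_def.1 (M.isCompl W).disjoint h' h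

theorem exists_even_add_odd {W : Opens S.X} (v : M.obj W) :
    ∃ v₀ ∈ M.even W, ∃ v₁ ∈ M.odd W, v = v₀ + v₁ := by
  have h : v ∈ M.even W ⊔ M.odd W := by rw [(M.isCompl W).sup_eq_top]; trivial
  obtain ⟨b, hb, c, hc, rfl⟩ := AddSubgroup.mem_sup.1 h
  exact ⟨b, hb, c, hc, rfl⟩

theorem HomOver.app_mem_homog {W W' : Opens S.X} (d : HomOver W M N) (h : W' ≤ W) {p : Bool}
    {v : M.obj W'} (hv : v ∈ M.homog W' p) : d.app W' h v ∈ N.homog W' p := by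
  cases p
  exacts [d.app_even W' h v hv, d.app_odd W' h v hv]

namespace Frame

variable {p q : ℕ} {W : Opens S.X}

theorem basis_apply (e : M.Frame p q W) (i : Fin p ⊕ Fin q) : e.basis i = e.vec i :=
  Module.Basis.mk_apply _ _ i

theorem vec_mem_homog (e : M.Frame p q W) (i : Fin p ⊕ Fin q) : e.vec i ∈ M.homog W i.isRight := by
  rcases i with i | i
  exacts [e.even i, e.odd i]

theorem sum_repr (e : M.Frame p q W) (v : M.obj W) : ∑ i, e.basis.repr v i • e.vec i = v := by
  simp only [← e.basis_apply]
  exact e.basis.sum_repr v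

theorem repr_sum (e : M.Frame p q W) (c : Fin p ⊕ Fin q → S.fn W) (i : Fin p ⊕ Fin q) :
    e.basis.repr (∑ i, c i • e.vec i) i = c i := by
  simp only [← e.basis_apply]
  exact congrFun (e.basis.repr_sum_self c) i

/-- Split each coordinate by parity. The wrong-parity components sum to a vector whose parity is
opposite to that of `v`, but this sum is also a difference of vectors with the parity of `v`; so it
vanishes. -/
theorem repr_mem_homog (e : M.Frame p q W) {b : Bool} {v : M.obj W} (hv : v ∈ M.homog W b)
    (i : Fin p ⊕ Fin q) : e.basis.repr v i ∈ (S.grading W).homog (b ^^ i.isRight) := by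
  choose c₀ h₀ c₁ h₁ hc using fun i =>
    (S.grading W).exists_homog_add (b ^^ i.isRight) (e.basis.repr v i)
  have hsum : v = ∑ i, c₀ i • e.vec i + ∑ i, c₁ i • e.vec i := by
    rw [← Finset.sum_add_distrib]
    simp only [← add_smul, ← hc, e.sum_repr]
  have hv₀ : ∑ i, c₀ i • e.vec i ∈ M.homog W b := sum_mem fun i _ => by
    have := smul_mem_homog (h₀ i) (e.vec_mem_homog i)
    rwa [Bool.xor_assoc, Bool.xor_self, Bool.xor_false] at this
  have hv₁ : ∑ i, c₁ i • e.vec i ∈ M.homog W (!b) := sum_mem fun i _ => by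
    have := smul_mem_homog (h₁ i) (e.vec_mem_homog i)
    rwa [← Bool.not_xor, Bool.xor_assoc, Bool.xor_self, Bool.xor_false] at this
  have hz : ∑ i, c₁ i • e.vec i = 0 := by
    refine eq_zero_of_mem_homog ?_ hv₁
    rw [← sub_eq_of_eq_add' hsum]
    exact sub_mem hv hv₀
  rw [hz, add_zero] at hsum
  rw [hsum, e.repr_sum]
  exact h₀ i

theorem coords_apply (e : M.Frame p q W) (v : Fin p ⊕ Fin q → M.obj W) (i j : Fin p ⊕ Fin q) :
    e.coords v j i = e.basis.repr (v j) i := rfl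

theorem coords_eq (e : M.Frame p q W) {v : Fin p ⊕ Fin q → M.obj W}
    {P : Matrix (Fin p ⊕ Fin q) (Fin p ⊕ Fin q) (S.fn W)} (h : ∀ j, v j = ∑ i, P j i • e.vec i) :
    e.coords v = P := by
  refine Matrix.ext fun j i => ?_
  rw [coords_apply, h, e.repr_sum]

theorem sum_coords (e : M.Frame p q W) (v : Fin p ⊕ Fin q → M.obj W) (j : Fin p ⊕ Fin q) :
    ∑ i, e.coords v j i • e.vec i = v j := e.sum_repr _

theorem coords_mul (e e' : M.Frame p q W) (v : Fin p ⊕ Fin q → M.obj W) :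
    e'.coords v * e.coords e'.vec = e.coords v := by
  symm
  refine e.coords_eq fun j => ?_
  conv_lhs => rw [← e'.sum_coords v j]
  simp only [Matrix.mul_apply, Finset.sum_smul, mul_smul]
  rw [Finset.sum_comm]
  simp only [← Finset.smul_sum, e.sum_coords]

theorem coords_self (e : M.Frame p q W) : e.coords e.vec = 1 :=
  e.coords_eq fun j => by simp [Matrix.one_apply]

theorem isEvenMatrix_coords (e : M.Frame p q W) {v : Fin p ⊕ Fin q → M.obj W}
    (hv : ∀ j, v j ∈ M.homog W j.isRight) : (S.grading W).IsEvenMatrix (e.coords v) :=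
  fun j i => e.repr_mem_homog (hv j) i

theorem isEvenUnit_coords (e e' : M.Frame p q W) : (S.grading W).IsEvenUnit (e.coords e'.vec) :=
  ⟨e.isEvenMatrix_coords e'.vec_mem_homog, e'.coords e.vec, e'.isEvenMatrix_coords e.vec_mem_homog,
    by rw [coords_mul, coords_self], by rw [coords_mul, coords_self]⟩

theorem restrict_vec (e : M.Frame p q W) {W' : Opens S.X} (h : W' ≤ W) (i : Fin p ⊕ Fin q) :
    (e.restrict h).vec i = M.res h (e.vec i) := rfl

theorem restrict_restrict (e : M.Frame p q W) {W' W'' : Opens S.X} (h : W' ≤ W) (h' : W'' ≤ W') :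
    (e.restrict h).restrict h' = e.restrict (h'.trans h) := by
  simp only [restrict, M.res_res]

theorem repr_restrict (e : M.Frame p q W) {W' : Opens S.X} (h : W' ≤ W) (v : M.obj W)
    (i : Fin p ⊕ Fin q) : (e.restrict h).basis.repr (M.res h v) i = S.res h (e.basis.repr v i) := by
  conv_lhs => rw [← e.sum_repr v, map_sum]
  simp only [M.res_smul, ← restrict_vec]
  exact (e.restrict h).repr_sum _ i

theorem coords_restrict (e : M.Frame p q W) {W' : Opens S.X} (h : W' ≤ W)
    (v : Fin p ⊕ Fin q → M.obj W) :
    (e.restrict h).coords (fun j => M.res h (v j)) = (e.coords v).map (S.res h) :=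
  Matrix.ext fun j i => e.repr_restrict h (v j) i

/-- The frame obtained from another by an even invertible matrix. -/
def change (e : M.Frame p q W) (P : Matrix (Fin p ⊕ Fin q) (Fin p ⊕ Fin q) (S.fn W))
    (hP : (S.grading W).IsEvenUnit P) : M.Frame p q W :=
  have key : ∀ (W' : Opens S.X) (h : W' ≤ W),
      LinearIndependent (S.fn W') (fun j => M.res h (∑ i, P j i • e.vec i)) ∧
      Submodule.span (S.fn W') (Set.range fun j => M.res h (∑ i, P j i • e.vec i)) = ⊤ := by
    intro W' h
    obtain ⟨-, P', -, h₁, h₂⟩ := hP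
    refine linearIndependent_and_span_of_matrix (P := P.map (S.res h)) (P' := P'.map (S.res h))
      ?_ ?_ (fun j => ?_) (e.linearIndependent W' h) (e.span_eq_top W' h)
    · rw [← Matrix.map_mul, h₁, Matrix.map_one _ (map_zero _) (map_one _)]
    · rw [← Matrix.map_mul, h₂, Matrix.map_one _ (map_zero _) (map_one _)]
    · rw [map_sum]
      simp only [M.res_smul, Matrix.map_apply]
  have hmem : ∀ j, ∑ i, P j i • e.vec i ∈ M.homog W j.isRight := fun j => sum_mem fun i _ => by
    have := smul_mem_homog (hP.1 j i) (e.vec_mem_homog i)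
    rwa [Bool.xor_assoc, Bool.xor_self, Bool.xor_false] at this
  { vec := fun j => ∑ i, P j i • e.vec i
    even := fun i => hmem (Sum.inl i)
    odd := fun i => hmem (Sum.inr i)
    linearIndependent := fun W' h => (key W' h).1
    span_eq_top := fun W' h => (key W' h).2 }

theorem change_vec (e : M.Frame p q W) (P : Matrix (Fin p ⊕ Fin q) (Fin p ⊕ Fin q) (S.fn W))
    (hP : (S.grading W).IsEvenUnit P) (j : Fin p ⊕ Fin q) :
    (e.change P hP).vec j = ∑ i, P j i • e.vec i := rfl

/-- The morphism with prescribed values on a frame. -/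
def hom (e : M.Frame p q W) (w : Fin p ⊕ Fin q → N.obj W) (hw : ∀ i, w i ∈ N.homog W i.isRight) :
    HomOver W M N :=
  have hmem : ∀ (W' : Opens S.X) (h : W' ≤ W) {b : Bool}, ∀ v ∈ M.homog W' b,
      ∑ i, (e.restrict h).basis.repr v i • N.res h (w i) ∈ N.homog W' b := by
    intro W' h b v hv
    refine sum_mem fun i _ => ?_
    have := smul_mem_homog ((e.restrict h).repr_mem_homog hv i) (res_mem_homog h (hw i))
    rwa [Bool.xor_assoc, Bool.xor_self, Bool.xor_false] at this
  { app := fun W' h =>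
      { toFun := fun v => ∑ i, (e.restrict h).basis.repr v i • N.res h (w i)
        map_add' := fun v v' => by
          simp only [map_add, Finsupp.add_apply, add_smul, Finset.sum_add_distrib]
        map_smul' := fun a v => by
          simp only [map_smul, Finsupp.smul_apply, smul_eq_mul, mul_smul, Finset.smul_sum,
            RingHom.id_apply] }
    app_res := fun W' W'' h h' v => by
      simp only [LinearMap.coe_mk, AddHom.coe_mk, map_sum, N.res_smul, N.res_res,
        ← e.restrict_restrict h h', repr_restrict]
    app_even := fun W' h => hmem W' h (b := false)
    app_odd := fun W' h => hmem W' h (b := true) }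

theorem hom_app (e : M.Frame p q W) (w : Fin p ⊕ Fin q → N.obj W)
    (hw : ∀ i, w i ∈ N.homog W i.isRight) {W' : Opens S.X} (h : W' ≤ W) (v : M.obj W') :
    (e.hom w hw).app W' h v = ∑ i, (e.restrict h).basis.repr v i • N.res h (w i) := rfl

theorem hom_app_vec (e : M.Frame p q W) (w : Fin p ⊕ Fin q → N.obj W)
    (hw : ∀ i, w i ∈ N.homog W i.isRight) {W' : Opens S.X} (h : W' ≤ W) (i : Fin p ⊕ Fin q) :
    (e.hom w hw).app W' h (M.res h (e.vec i)) = N.res h (w i) := by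
  rw [hom_app, ← restrict_vec, ← basis_apply]
  simp only [Module.Basis.repr_self, Finsupp.single_apply, ite_smul, one_smul, zero_smul]
  simp

end Frame

end SuperModule


/-! ### Consequences of the normal form `1 ⊕ X`: the Berezinian section, `θ` and the homotopy. -/

namespace SuperGrading

/-- `C` may have odd components, as it will come from arbitrary preimages of a frame. Taking even
parts is linear over the even ring, so it turns `C` into a left inverse over a commutative ring. -/
theorem isUnit_det_of_mul_up_eq_one {R : Type u} [Ring R] {σ : SuperGrading R} {ι : Type*}
    [Fintype ι] [DecidableEq ι] {X : Matrix ι ι σ.even} {C : Matrix ι ι R} (h : C * σ.up X = 1) :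
    IsUnit X.det := by
  have hmul : ∀ (c : R) (x : σ.even), σ.evenPart (c * x) = σ.evenPart c * x := by
    intro c x
    refine σ.evenPart_eq ?_
    have := σ.even_mul_odd x x.2 _ (σ.sub_evenPart_mem c)
    rw [σ.even_comm x x.2, sub_mul] at this
    exact this
  let ε : R →+ σ.even := AddMonoidHom.mk' σ.evenPart σ.evenPart_add
  have : (Matrix.of fun i j => ε (C i j)) * X = 1 := by
    refine Matrix.ext fun i j => ?_
    have hij := congrArg ε (congrFun (congrFun h i) j)
    rw [Matrix.mul_apply, map_sum] at hij
    rw [Matrix.mul_apply]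
    simp only [Matrix.of_apply]
    refine Eq.trans (Finset.sum_congr rfl fun k _ => (hmul _ _).symm) (hij.trans ?_)
    rw [Matrix.one_apply, Matrix.one_apply]
    split_ifs
    · exact σ.evenPart_coe 1
    · exact map_zero ε
  exact Matrix.isUnit_det_of_left_inverse this

end SuperGrading

namespace SuperModule

variable {S : Superspace.{u}} {M E F : SuperModule S} {m n : ℕ} {W : Opens S.X}

open Matrix

theorem HomOver.sum_coords_smul (d : HomOver ⊤ E F) (e : E.Frame m n W) (v : E.obj W) :
    ∑ i, e.basis.repr v i • d.app W le_top (e.vec i) = d.app W le_top v := by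
  conv_rhs => rw [← e.sum_repr v, map_sum]
  simp only [map_smul]

theorem coords_app (d : HomOver ⊤ E F) (e : E.Frame m n W) (g : F.Frame m n W)
    (v : Fin m ⊕ Fin n → E.obj W) : g.coords (fun j => d.app W le_top (v j)) =
      e.coords v * g.coords (fun j => d.app W le_top (e.vec j)) := by
  refine g.coords_eq fun j => ?_
  rw [← d.sum_coords_smul e]
  simp only [Matrix.mul_apply, Finset.sum_smul, mul_smul]
  rw [Finset.sum_comm]
  simp only [← Finset.smul_sum, Frame.coords_apply, Frame.sum_repr]

theorem coords_app_change (d : HomOver ⊤ E F) (e e' : E.Frame m n W) (g g' : F.Frame m n W) :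
    g'.coords (fun j => d.app W le_top (e'.vec j)) =
      e.coords e'.vec * g.coords (fun j => d.app W le_top (e.vec j)) * g'.coords g.vec := by
  rw [Matrix.mul_assoc, Frame.coords_mul, ← coords_app]

theorem coords_app_restrict (d : HomOver ⊤ E F) (e : E.Frame m n W) (g : F.Frame m n W)
    {W' : Opens S.X} (h : W' ≤ W) :
    (g.restrict h).coords (fun j => d.app W' le_top ((e.restrict h).vec j)) =
      (g.coords fun j => d.app W le_top (e.vec j)).map (S.res h) := by
  rw [← Frame.coords_restrict]
  congr 1
  funext j
  exact d.app_res W W' le_top h _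

/-- The section of the Berezinian line bundle with coefficient `c` at a pair of frames. -/
def BerSection.ofFrames (e : E.Frame m n W) (g : F.Frame m n W) (c : S.evenFn W) :
    BerSection E F m n W where
  -- With `[e] = ber(e'.coords e) [e']` and `[g'] = ber(g.coords g') [g]`, these two factors express
  -- `[e] ⊗ [g]⁻¹` through `[e'] ⊗ [g']⁻¹`.
  coeff {W'} h e' g' := S.evenRes h c * (S.grading W').ber ((g.restrict h).coords g'.vec) *
    (S.grading W').ber (e'.coords (e.restrict h).vec)
  coeff_res {W' W''} h h' e' g' := by
    rw [map_mul, map_mul, S.evenRes_evenRes, ← Superspace.ber_map_res h' (Frame.isEvenUnit_coords _ _),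
      ← Superspace.ber_map_res h' (Frame.isEvenUnit_coords _ _), ← Frame.coords_restrict,
      ← Frame.coords_restrict, ← Frame.restrict_restrict g h h', ← Frame.restrict_restrict e h h']
    rfl
  coeff_change {W'} h e₁ e₂ g₁ g₂ := by
    have h2 := S.isUnit_two W'
    have hg : (S.grading W').ber ((g.restrict h).coords g₂.vec) =
        (S.grading W').ber (g₁.coords g₂.vec) * (S.grading W').ber ((g.restrict h).coords g₁.vec) := by
      rw [← SuperGrading.ber_mul h2 (Frame.isEvenUnit_coords _ _) (Frame.isEvenUnit_coords _ _),
        Frame.coords_mul]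
    have he : (S.grading W').ber (e₁.coords (e.restrict h).vec) =
        (S.grading W').ber (e₂.coords (e.restrict h).vec) * (S.grading W').ber (e₁.coords e₂.vec) := by
      rw [← SuperGrading.ber_mul h2 (Frame.isEvenUnit_coords _ _) (Frame.isEvenUnit_coords _ _),
        Frame.coords_mul]
    rw [hg, he]
    ring

theorem ber_coords_mul_ber_coords (e e' : M.Frame m n W) :
    (S.grading W).ber (e.coords e'.vec) * (S.grading W).ber (e'.coords e.vec) = 1 := by
  rw [← SuperGrading.ber_mul (S.isUnit_two W) (Frame.isEvenUnit_coords _ _)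
    (Frame.isEvenUnit_coords _ _), Frame.coords_mul, Frame.coords_self, SuperGrading.ber_one]

theorem BerSection.isTrivialization_ofFrames (e : E.Frame m n W) (g : F.Frame m n W)
    {c : S.evenFn W} (hc : IsUnit c) : (BerSection.ofFrames e g c).IsTrivialization :=
  fun h _ _ => ((hc.map (S.evenRes h)).mul
    (.of_mul_eq_one _ (ber_coords_mul_ber_coords _ _))).mul
      (.of_mul_eq_one _ (ber_coords_mul_ber_coords _ _))

variable {d : HomOver ⊤ E F} {e : E.Frame m n W} {g : F.Frame m n W}
  {X K : Matrix (Fin n) (Fin n) (S.evenFn W)} {f : S.evenFn W}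

/-- Surjectivity of `d` over `W'` makes `det X` a unit there, so `θ` is `ber (1 ⊕ X) = (det X)⁻¹` in
the restricted frames. The change-of-frame Berezinians in `θ` and in the section are inverse to each
other. -/
theorem theta_mul_coeff (hX : g.coords (fun j => d.app W le_top (e.vec j)) =
      fromBlocks 1 0 0 ((S.grading W).up X))
    {c : S.evenFn W} (hf : f ^ 2 * c = X.det) {W' : Opens S.X} (h : W' ≤ W)
    (hd : Function.Surjective (d.app W' le_top)) (e' : E.Frame m n W') (g' : F.Frame m n W') :
    theta d e' g' * (S.evenRes h f ^ 2 * (BerSection.ofFrames e g c).coeff h e' g') = 1 := by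
  have h2 := S.isUnit_two W'
  let X' : Matrix (Fin n) (Fin n) (S.evenFn W') := (S.evenRes h).mapMatrix X
  have hX' : (g.restrict h).coords (fun j => d.app W' le_top ((e.restrict h).vec j)) =
      fromBlocks ((S.grading W').up 1) 0 0 ((S.grading W').up X') := by
    rw [coords_app_restrict, hX, fromBlocks_map, Matrix.map_one _ (map_zero _) (map_one _), map_one]
    congr 1 <;> ext i j <;> exact map_zero (S.res h)
  have hdet : IsUnit X'.det := by
    choose w hw using fun j => hd ((g.restrict h).vec j)
    have hC : (e.restrict h).coords w *
        (g.restrict h).coords (fun j => d.app W' le_top ((e.restrict h).vec j)) = 1 := by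
      rw [← coords_app, ← Frame.coords_self (g.restrict h)]
      simp only [hw]
    rw [hX', ← fromBlocks_toBlocks ((e.restrict h).coords w), fromBlocks_multiply,
      ← fromBlocks_one, fromBlocks_inj] at hC
    refine SuperGrading.isUnit_det_of_mul_up_eq_one (C := ((e.restrict h).coords w).toBlocks₂₂) ?_
    simpa using hC.2.2.2
  have hu : (S.grading W').IsEvenUnit
      (fromBlocks ((S.grading W').up (1 : Matrix (Fin m) (Fin m) _)) 0 0 ((S.grading W').up X')) :=
    SuperGrading.isEvenUnit_diag (by simp) hdet
  have hdetX : X'.det = S.evenRes h f ^ 2 * S.evenRes h c := by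
    rw [← map_pow, ← map_mul, hf]
    exact (RingHom.map_det _ _).symm
  have hinv : Ring.inverse X'.det * X'.det = 1 := Ring.inverse_mul_cancel _ hdet
  have hθ : theta d e' g' = (S.grading W').ber ((e.restrict h).coords e'.vec) *
      Ring.inverse X'.det * (S.grading W').ber (g'.coords (g.restrict h).vec) := by
    unfold theta
    rw [coords_app_change d (e.restrict h) e' (g.restrict h) g', hX',
      SuperGrading.ber_mul h2 ((Frame.isEvenUnit_coords _ _).mul hu) (Frame.isEvenUnit_coords _ _),
      SuperGrading.ber_mul h2 (Frame.isEvenUnit_coords _ _) hu, SuperGrading.ber_diag, det_one,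
      one_mul]
  have he := ber_coords_mul_ber_coords (e.restrict h) e'
  have hg := ber_coords_mul_ber_coords g' (g.restrict h)
  rw [hθ]
  change _ * (_ * (S.evenRes h c * (S.grading W').ber ((g.restrict h).coords g'.vec) *
    (S.grading W').ber (e'.coords (e.restrict h).vec))) = 1
  rw [hdetX] at hinv ⊢
  calc _ = ((S.grading W').ber ((e.restrict h).coords e'.vec) *
        (S.grading W').ber (e'.coords (e.restrict h).vec)) *
      ((S.grading W').ber (g'.coords (g.restrict h).vec) *
        (S.grading W').ber ((g.restrict h).coords g'.vec)) *
      (Ring.inverse (S.evenRes h f ^ 2 * S.evenRes h c) * (S.evenRes h f ^ 2 * S.evenRes h c)) := by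
        ring
    _ = 1 := by rw [he, hg, hinv]; ring

/-- Being even, `f` is central, so both sides are linear in `v` and the frame vectors decide. -/
theorem app_eq_smul_of_vec {N : SuperModule S} {e : M.Frame m n W} {φ : HomOver ⊤ M N}
    {ψ : HomOver W N M}
    (h : ∀ i, ψ.app W le_rfl (φ.app W le_top (e.vec i)) = (f : S.fn W) • e.vec i)
    {W' : Opens S.X} (hW : W' ≤ W) (v : M.obj W') :
    ψ.app W' hW (φ.app W' le_top v) = (S.evenRes hW f : S.fn W') • v := by
  have hi : ∀ i, ψ.app W' hW (φ.app W' le_top ((e.restrict hW).vec i)) =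
      (S.evenRes hW f : S.fn W') • (e.restrict hW).vec i := by
    intro i
    rw [Frame.restrict_vec, φ.app_res W W' le_top hW, ψ.app_res W W' le_rfl hW, h, M.res_smul]
    rfl
  conv_lhs => rw [← (e.restrict hW).sum_repr v]
  conv_rhs => rw [← (e.restrict hW).sum_repr v]
  simp only [map_sum, map_smul, hi, Finset.smul_sum, smul_smul]
  refine Finset.sum_congr rfl fun i _ => ?_
  rw [(S.grading W').even_comm _ (S.evenRes hW f).2]

theorem app_eq_smul_of_vec' {N : SuperModule S} {e : N.Frame m n W} {φ : HomOver ⊤ M N}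
    {ψ : HomOver W N M}
    (h : ∀ i, φ.app W le_top (ψ.app W le_rfl (e.vec i)) = (f : S.fn W) • e.vec i)
    {W' : Opens S.X} (hW : W' ≤ W) (v : N.obj W') :
    φ.app W' le_top (ψ.app W' hW v) = (S.evenRes hW f : S.fn W') • v := by
  have hi : ∀ i, φ.app W' le_top (ψ.app W' hW ((e.restrict hW).vec i)) =
      (S.evenRes hW f : S.fn W') • (e.restrict hW).vec i := by
    intro i
    rw [Frame.restrict_vec, ψ.app_res W W' le_rfl hW, φ.app_res W W' le_top hW, h, N.res_smul]
    rfl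
  conv_lhs => rw [← (e.restrict hW).sum_repr v]
  conv_rhs => rw [← (e.restrict hW).sum_repr v]
  simp only [map_sum, map_smul, hi, Finset.smul_sum, smul_smul]
  refine Finset.sum_congr rfl fun i _ => ?_
  rw [(S.grading W').even_comm _ (S.evenRes hW f).2]

/-- The homotopy has matrix `f ⊕ K`, which is `f` times the inverse of `1 ⊕ X` wherever that inverse
exists. -/
theorem exists_homotopy (hX : g.coords (fun j => d.app W le_top (e.vec j)) =
      fromBlocks 1 0 0 ((S.grading W).up X))
    (hXK : X * K = f • (1 : Matrix _ _ _)) (hKX : K * X = f • (1 : Matrix _ _ _)) :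
    ∃ k : HomOver W F E, ∀ (W' : Opens S.X) (h : W' ≤ W),
      (∀ v, k.app W' h (d.app W' le_top v) = (S.evenRes h f : S.fn W') • v) ∧
      (∀ y, d.app W' le_top (k.app W' h y) = (S.evenRes h f : S.fn W') • y) := by
  let σ := S.grading W
  let P : Matrix (Fin m ⊕ Fin n) (Fin m ⊕ Fin n) (S.fn W) :=
    fromBlocks (σ.up (f • (1 : Matrix (Fin m) (Fin m) σ.even))) 0 0 (σ.up K)
  have hP : σ.IsEvenMatrix P := SuperGrading.isEvenMatrix_fromBlocks
    SuperGrading.isOddMatrix_zero SuperGrading.isOddMatrix_zero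
  set Q : Matrix (Fin m ⊕ Fin n) (Fin m ⊕ Fin n) (S.fn W) := fromBlocks 1 0 0 (σ.up X) with hQ
  have hsc : fromBlocks (σ.up (f • (1 : Matrix (Fin m) (Fin m) σ.even))) 0 0
      (σ.up (f • (1 : Matrix (Fin n) (Fin n) σ.even))) =
        Matrix.of fun i j => if i = j then (f : S.fn W) else 0 := by
    ext (i | i) (j | j)
    · by_cases hij : i = j <;> simp [hij]
    · simp
    · simp
    · by_cases hij : i = j <;> simp [hij]
  have hQP : Q * P = Matrix.of fun i j => if i = j then (f : S.fn W) else 0 := by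
    rw [← hsc, hQ]
    simp only [P, fromBlocks_multiply, Matrix.one_mul, Matrix.zero_mul, Matrix.mul_zero, add_zero,
      zero_add, ← map_mul, hXK]
  have hPQ : P * Q = Matrix.of fun i j => if i = j then (f : S.fn W) else 0 := by
    rw [← hsc, hQ]
    simp only [P, fromBlocks_multiply, Matrix.mul_one, Matrix.zero_mul, Matrix.mul_zero, add_zero,
      zero_add, ← map_mul, hKX]
  have hw : ∀ i, ∑ j, P i j • e.vec j ∈ E.homog W i.isRight := fun i => sum_mem fun j _ => by
    have := smul_mem_homog (hP i j) (e.vec_mem_homog j)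
    rwa [Bool.xor_assoc, Bool.xor_self, Bool.xor_false] at this
  have hk : ∀ i, (g.hom (fun i => ∑ j, P i j • e.vec j) hw).app W le_rfl (g.vec i) =
      ∑ j, P i j • e.vec j := fun i => by
    have := g.hom_app_vec (fun i => ∑ j, P i j • e.vec j) hw le_rfl i
    rwa [F.res_self, E.res_self] at this
  have hde : ∀ i, d.app W le_top (e.vec i) = ∑ j, Q i j • g.vec j := fun i => by
    rw [← hX, g.sum_coords]
  refine ⟨g.hom (fun i => ∑ j, P i j • e.vec j) hw, fun W' h => ⟨fun v => ?_, fun y => ?_⟩⟩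
  · refine app_eq_smul_of_vec (e := e) (fun i => ?_) h v
    rw [hde, map_sum]
    simp only [map_smul, hk, Finset.smul_sum, smul_smul]
    rw [Finset.sum_comm]
    simp only [← Finset.sum_smul, ← Matrix.mul_apply, hQP]
    simp
  · refine app_eq_smul_of_vec' (e := g) (fun i => ?_) h y
    rw [hk, map_sum]
    simp only [map_smul, hde, Finset.smul_sum, smul_smul]
    rw [Finset.sum_comm]
    simp only [← Finset.sum_smul, ← Matrix.mul_apply, hPQ]
    simp

end SuperModule


/-! ### Even stalks, residue fields and lifting of matrices. -/

namespace Superspace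

variable (S : Superspace.{u}) {x : S.X} {W : Opens S.X}

/-- The stalk of the structure sheaf. -/
abbrev stalk (x : S.X) : Type u := S.sheaf.presheaf.stalk x

/-- The germ of a function at a point. -/
def germ (hx : x ∈ W) : S.fn W →+* S.stalk x := (S.sheaf.presheaf.germ W x hx).hom

instance (x : S.X) : IsLocalRing (S.stalk x) := S.isLocalRing x

theorem germ_res {W' : Opens S.X} (h : W' ≤ W) (hx : x ∈ W') (a : S.fn W) :
    S.germ hx (S.res h a) = S.germ (h hx) a :=
  TopCat.Presheaf.germ_res_apply S.sheaf.presheaf (homOfLE h) x hx a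

theorem exists_germ_eq (z : S.stalk x) : ∃ (W : Opens S.X) (hx : x ∈ W) (a : S.fn W),
    S.germ hx a = z :=
  TopCat.Presheaf.exists_germ_eq S.sheaf.presheaf z

theorem exists_res_eq_of_germ_eq {hx : x ∈ W} {a b : S.fn W} (h : S.germ hx a = S.germ hx b) :
    ∃ (W' : Opens S.X) (hW : W' ≤ W), x ∈ W' ∧ S.res hW a = S.res hW b := by
  obtain ⟨W', hx', i, j, e⟩ := TopCat.Presheaf.germ_eq S.sheaf.presheaf x hx hx a b h
  exact ⟨W', i.le, hx', e⟩

/-- An even function whose germ is invertible has an even inverse near the point. -/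
theorem exists_isUnit_evenRes {hx : x ∈ W} {a : S.evenFn W} (h : IsUnit (S.germ hx a)) :
    ∃ (W' : Opens S.X) (hW : W' ≤ W), x ∈ W' ∧ IsUnit (S.evenRes hW a) := by
  obtain ⟨z, hz⟩ := h.exists_right_inv
  obtain ⟨W₁, hx₁, b, rfl⟩ := S.exists_germ_eq z
  have hx₂ : x ∈ W ⊓ W₁ := Opens.mem_inf.2 ⟨hx, hx₁⟩
  have e : S.germ hx₂ (S.res inf_le_left (a : S.fn W) * S.res inf_le_right b) = S.germ hx₂ 1 := by
    rw [map_mul, S.germ_res, S.germ_res, hz, map_one]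
  obtain ⟨W', hW, hx', e⟩ := S.exists_res_eq_of_germ_eq e
  rw [map_mul, S.res_res, S.res_res, map_one] at e
  refine ⟨W', hW.trans inf_le_left, hx', ?_⟩
  set c := S.res (hW.trans inf_le_right) b
  -- The inverse `c` may have an odd component; its product with `a` is odd whereas `a c = 1` is
  -- even, so the even part of `c` already inverts `a`.
  refine .of_mul_eq_one ((S.grading W').evenPart c) ?_
  have hodd := (S.grading W').even_mul_odd _ (S.evenRes (hW.trans inf_le_left) a).2 _
    ((S.grading W').sub_evenPart_mem c)
  rw [mul_sub, S.coe_evenRes, e] at hodd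
  have := (S.grading W').evenPart_eq
    (b := S.evenRes (hW.trans inf_le_left) a * (S.grading W').evenPart c) hodd
  rw [← this]
  exact (S.grading W').evenPart_coe 1

/-- The even part of the stalk. -/
def evenStalk (x : S.X) : Subring (S.stalk x) where
  carrier := {z | ∃ (W : Opens S.X) (hx : x ∈ W) (a : S.evenFn W), S.germ hx a = z}
  mul_mem' := by
    rintro _ _ ⟨W, hx, a, rfl⟩ ⟨W', hx', a', rfl⟩
    refine ⟨W ⊓ W', Opens.mem_inf.2 ⟨hx, hx'⟩, S.evenRes inf_le_left a * S.evenRes inf_le_right a', ?_⟩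
    rw [Subring.coe_mul, map_mul, S.coe_evenRes, S.coe_evenRes, S.germ_res, S.germ_res]
  add_mem' := by
    rintro _ _ ⟨W, hx, a, rfl⟩ ⟨W', hx', a', rfl⟩
    refine ⟨W ⊓ W', Opens.mem_inf.2 ⟨hx, hx'⟩, S.evenRes inf_le_left a + S.evenRes inf_le_right a', ?_⟩
    rw [Subring.coe_add, map_add, S.coe_evenRes, S.coe_evenRes, S.germ_res, S.germ_res]
  one_mem' := ⟨⊤, trivial, 1, map_one _⟩
  zero_mem' := ⟨⊤, trivial, 0, map_zero _⟩
  neg_mem' := by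
    rintro _ ⟨W, hx, a, rfl⟩
    exact ⟨W, hx, -a, map_neg _ _⟩

instance (x : S.X) : CommRing (S.evenStalk x) :=
  { (inferInstance : Ring (S.evenStalk x)) with
    mul_comm := by
      rintro ⟨_, W, hx, a, rfl⟩ ⟨z, hz⟩
      obtain ⟨W', hx', b, rfl⟩ := hz
      apply Subtype.ext
      change S.germ hx a * S.germ hx' b = S.germ hx' b * S.germ hx a
      have hx₂ : x ∈ W ⊓ W' := Opens.mem_inf.2 ⟨hx, hx'⟩
      rw [← S.germ_res inf_le_left hx₂, ← S.germ_res inf_le_right hx₂, ← map_mul, ← map_mul]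
      exact congrArg (S.germ hx₂) ((S.grading _).even_comm _ (S.evenRes inf_le_left a).2 _) }

/-- The germ of an even function. -/
def evenGerm (hx : x ∈ W) : S.evenFn W →+* S.evenStalk x :=
  ((S.germ hx).comp (S.grading W).even.subtype).codRestrict (S.evenStalk x)
    (fun a => ⟨W, hx, a, rfl⟩)

theorem evenGerm_res {W' : Opens S.X} (h : W' ≤ W) (hx : x ∈ W') (a : S.evenFn W) :
    S.evenGerm hx (S.evenRes h a) = S.evenGerm (h hx) a := Subtype.ext (S.germ_res h hx _)

/-- Transfers locality from the noncommutative stalk to its commutative even part, so that linear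
algebra at a point takes place over a field. -/
theorem isUnit_evenStalk_iff {z : S.evenStalk x} : IsUnit z ↔ IsUnit (z : S.stalk x) := by
  refine ⟨fun h => h.map (S.evenStalk x).subtype, fun h => ?_⟩
  obtain ⟨_, W, hx, a, rfl⟩ := z
  obtain ⟨W', hW, hx', ha⟩ := S.exists_isUnit_evenRes h
  have := ha.map (S.evenGerm hx')
  rwa [S.evenGerm_res] at this

instance (x : S.X) : IsLocalRing (S.evenStalk x) :=
  .of_isUnit_or_isUnit_of_isUnit_add fun a b h => by
    rw [S.isUnit_evenStalk_iff] at h ⊢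
    rw [S.isUnit_evenStalk_iff]
    exact IsLocalRing.isUnit_or_isUnit_of_isUnit_add h

/-- The residue field of a point. -/
abbrev residueField (x : S.X) : Type u := IsLocalRing.ResidueField (S.evenStalk x)

/-- The value of an even function at a point. -/
def eval (hx : x ∈ W) : S.evenFn W →+* S.residueField x :=
  (IsLocalRing.residue (S.evenStalk x)).comp (S.evenGerm hx)

theorem eval_res {W' : Opens S.X} (h : W' ≤ W) (hx : x ∈ W') (a : S.evenFn W) :
    S.eval hx (S.evenRes h a) = S.eval (h hx) a :=
  congrArg (IsLocalRing.residue (S.evenStalk x)) (S.evenGerm_res h hx a)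

theorem eval_ne_zero_iff {hx : x ∈ W} {a : S.evenFn W} :
    S.eval hx a ≠ 0 ↔ IsUnit (S.germ hx a) := by
  change IsLocalRing.residue (S.evenStalk x) (S.evenGerm hx a) ≠ 0 ↔ _
  rw [IsLocalRing.residue_ne_zero_iff_isUnit, S.isUnit_evenStalk_iff]
  rfl

theorem exists_isUnit_of_eval_ne_zero {hx : x ∈ W} {a : S.evenFn W} (h : S.eval hx a ≠ 0) :
    ∃ (W' : Opens S.X) (hW : W' ≤ W), x ∈ W' ∧ IsUnit (S.evenRes hW a) :=
  S.exists_isUnit_evenRes (S.eval_ne_zero_iff.1 h)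

theorem exists_eval_eq (c : S.residueField x) :
    ∃ (W : Opens S.X) (hx : x ∈ W) (a : S.evenFn W), S.eval hx a = c := by
  obtain ⟨⟨_, W, hx, a, rfl⟩, rfl⟩ := IsLocalRing.residue_surjective c
  exact ⟨W, hx, a, rfl⟩

theorem eval_odd_mul_odd (hx : x ∈ W) {a b : S.fn W} (ha : a ∈ (S.grading W).odd)
    (hb : b ∈ (S.grading W).odd) {c : S.evenFn W} (hc : (c : S.fn W) = a * b) :
    S.eval hx c = 0 := by
  have h : a * b ∈ (S.grading W).even := (S.grading W).odd_mul_odd a ha b hb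
  obtain rfl : c = ⟨a * b, h⟩ := Subtype.ext hc
  exact (((S.grading W).isNilpotent_odd_mul_odd (S.isUnit_two W) ha hb h).map (S.eval hx)).eq_zero

theorem germ_mem_nonunits_of_odd (hx : x ∈ W) {a : S.fn W} (ha : a ∈ (S.grading W).odd) :
    S.germ hx a ∈ nonunits (S.stalk x) := by
  intro h
  have e : S.germ hx a * S.germ hx a = 0 := by
    rw [← map_mul, (S.grading W).mul_self_odd (S.isUnit_two W) ha, map_zero]
  have := h.mul h
  rw [e, isUnit_zero_iff] at this
  exact zero_ne_one this

theorem exists_le_of_finite {ι : Type*} [Finite ι] (W : ι → Opens S.X) (h : ∀ i, x ∈ W i) :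
    ∃ W' : Opens S.X, x ∈ W' ∧ ∀ i, W' ≤ W i := by
  cases nonempty_fintype ι
  refine ⟨Finset.univ.inf W, ?_, fun i => Finset.inf_le (Finset.mem_univ i)⟩
  rw [← SetLike.mem_coe, Opens.coe_finset_inf, Finset.inf_set_eq_iInter]
  simpa using h

/-- Matrices over the residue field lift to functions near the point. -/
theorem exists_matrix_lift {ι κ : Type*} [Finite ι] [Finite κ] (hx : x ∈ W)
    (P : Matrix ι κ (S.residueField x)) :
    ∃ (W' : Opens S.X) (_ : W' ≤ W) (hx' : x ∈ W') (Q : Matrix ι κ (S.evenFn W')),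
      Q.map (S.eval hx') = P := by
  choose V hV a ha using fun ij : ι × κ => S.exists_eval_eq (P ij.1 ij.2)
  obtain ⟨W', hx', hle⟩ := S.exists_le_of_finite V hV
  refine ⟨W ⊓ W', inf_le_left, Opens.mem_inf.2 ⟨hx, hx'⟩,
    Matrix.of fun i j => S.evenRes (inf_le_right.trans (hle (i, j))) (a (i, j)), ?_⟩
  refine Matrix.ext fun i j => ?_
  rw [Matrix.map_apply, Matrix.of_apply, S.eval_res, ha]

/-- Invertible matrices over the residue field lift to invertible matrices near the point. -/
theorem exists_matrix_lift_isUnit {ι : Type*} [Fintype ι] [DecidableEq ι] (hx : x ∈ W)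
    (P : Matrix ι ι (S.residueField x)) (hP : P.det ≠ 0) :
    ∃ (W' : Opens S.X) (_ : W' ≤ W) (hx' : x ∈ W') (Q : Matrix ι ι (S.evenFn W')),
      Q.map (S.eval hx') = P ∧ IsUnit Q.det := by
  obtain ⟨W₁, h₁, hx₁, Q, rfl⟩ := S.exists_matrix_lift hx P
  have hQ : S.eval hx₁ Q.det ≠ 0 := by rwa [RingHom.map_det]
  obtain ⟨W', hW, hx', hu⟩ := S.exists_isUnit_of_eval_ne_zero hQ
  refine ⟨W', hW.trans h₁, hx', Q.map (S.evenRes hW), ?_, ?_⟩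
  · refine Matrix.ext fun i j => ?_
    rw [Matrix.map_apply, Matrix.map_apply, S.eval_res, Matrix.map_apply]
  · rwa [RingHom.map_det] at hu

end Superspace


/-! ### The square root of the determinant from a skew-symmetric product. -/

namespace Matrix

/-- A factorization of a skew-symmetric matrix with one invertible factor: the other factor `X` has
a divisor `f` of its determinant whose square is the determinant up to a unit and such that
`f X⁻¹` is defined. -/
theorem exists_sqrt_det_of_mul_transpose_skew {R : Type*} [CommRing R] (h2 : IsUnit (2 : R))
    {ι : Type*} [Fintype ι] [DecidableEq ι] {X Y : Matrix ι ι R} (hY : IsUnit Y.det)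
    (h : X * Yᵀ + Y * Xᵀ = 0) :
    ∃ (f : R) (K : Matrix ι ι R), f ^ 2 = X.det * Y.det ∧ X * K = f • (1 : Matrix ι ι R) ∧
      K * X = f • (1 : Matrix ι ι R) := by
  have hskew : (X * Yᵀ)ᵀ = -(X * Yᵀ) := by
    rw [transpose_mul, transpose_transpose]
    exact eq_neg_of_add_eq_zero_right h
  obtain ⟨f, Q, hdet, h₁, h₂⟩ := exists_pfaffian h2 _ hskew
  have hY' : IsUnit (Yᵀ).det := by rwa [det_transpose]
  -- From `(X Yᵀ) Q = f` the matrix `Yᵀ Q` serves as `f X⁻¹`; the product in the other order follows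
  -- by conjugating with the invertible `Yᵀ`.
  refine ⟨f, Yᵀ * Q, ?_, ?_, ?_⟩
  · rw [← hdet, det_mul, det_transpose]
  · rw [← Matrix.mul_assoc, h₁]
  · calc Yᵀ * Q * X = Yᵀ * Q * X * (Yᵀ * (Yᵀ)⁻¹) := by rw [mul_nonsing_inv _ hY', Matrix.mul_one]
      _ = Yᵀ * (Q * (X * Yᵀ)) * (Yᵀ)⁻¹ := by simp only [Matrix.mul_assoc]
      _ = f • (1 : Matrix ι ι R) := by
        rw [h₂, Matrix.mul_smul, Matrix.mul_one, Matrix.smul_mul, mul_nonsing_inv _ hY']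

/-- After reordering the indices `X` is `X₀ ⊕ 1`, and `K₀ ⊕ f` is the required `K`. -/
theorem exists_extension_by_one {R : Type*} [CommRing R] {ι : Type*} [Fintype ι] [DecidableEq ι]
    (p : ι → Prop) [DecidablePred p] {X : Matrix ι ι R}
    (hX : ∀ i j, ¬(p i ∧ p j) → X i j = (1 : Matrix ι ι R) i j) {X₀ K₀ : Matrix {i // p i} {i // p i} R}
    (hX₀ : X₀ = X.submatrix Subtype.val Subtype.val) {f : R}
    (h₁ : X₀ * K₀ = f • (1 : Matrix _ _ R)) (h₂ : K₀ * X₀ = f • (1 : Matrix _ _ R)) :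
    X.det = X₀.det ∧
      ∃ K : Matrix ι ι R, X * K = f • (1 : Matrix ι ι R) ∧ K * X = f • (1 : Matrix ι ι R) := by
  let e := (Equiv.sumCompl p).symm
  have hXe : X = (fromBlocks X₀ 0 0 1).submatrix e e := by
    rw [← Equiv.symm_symm e]
    refine (Matrix.reindex e e).injective ?_
    simp only [reindex_apply, submatrix_submatrix, Equiv.symm_symm, Equiv.self_comp_symm,
      submatrix_id_id]
    ext (i | i) (j | j)
    · simp [e, hX₀]
    · simp only [e, submatrix_apply, Equiv.symm_symm, Equiv.sumCompl_apply_inl,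
        Equiv.sumCompl_apply_inr, fromBlocks_apply₁₂, zero_apply]
      rw [hX _ _ fun h => j.2 h.2, one_apply_ne]
      exact fun h => j.2 (h ▸ i.2)
    · simp only [e, submatrix_apply, Equiv.symm_symm, Equiv.sumCompl_apply_inl,
        Equiv.sumCompl_apply_inr, fromBlocks_apply₂₁, zero_apply]
      rw [hX _ _ fun h => i.2 h.1, one_apply_ne]
      exact fun h => i.2 (h ▸ j.2)
    · simp only [e, submatrix_apply, Equiv.symm_symm, Equiv.sumCompl_apply_inr, fromBlocks_apply₂₂]
      rw [hX _ _ fun h => i.2 h.1]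
      simp [one_apply, Subtype.ext_iff]
  have hone : fromBlocks (f • (1 : Matrix {i // p i} {i // p i} R)) 0 0
      (f • (1 : Matrix {i // ¬p i} {i // ¬p i} R)) = f • 1 := by
    rw [← fromBlocks_one, fromBlocks_smul, smul_zero, smul_zero]
  have hsub : (f • (1 : Matrix ({i // p i} ⊕ {i // ¬p i}) ({i // p i} ⊕ {i // ¬p i}) R)).submatrix
      e e = f • 1 := by
    rw [submatrix_smul, Pi.smul_apply, Pi.smul_apply, submatrix_one_equiv]
  refine ⟨?_, (fromBlocks K₀ 0 0 (f • 1)).submatrix e e, ?_, ?_⟩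
  · rw [hXe, det_submatrix_equiv_self, det_fromBlocks_zero₂₁, det_one, mul_one]
  · rw [hXe, submatrix_mul_equiv, fromBlocks_multiply]
    simp only [Matrix.mul_zero, Matrix.zero_mul, Matrix.one_mul, add_zero, zero_add]
    rw [h₁, hone, hsub]
  · rw [hXe, submatrix_mul_equiv, fromBlocks_multiply]
    simp only [Matrix.mul_zero, Matrix.zero_mul, Matrix.mul_one, add_zero, zero_add]
    rw [h₂, hone, hsub]

end Matrix

/-! ### Fibres, the pairing on stalks and dual sections. -/

namespace SuperModule

variable {S : Superspace.{u}} {V : SuperModule S} {m n : ℕ} {W : Opens S.X}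

namespace Subsheaf

/-- The inclusion of a subsheaf. -/
def incl (L : V.Subsheaf) (W : Opens S.X) : L.toSuperModule.obj W →ₗ[S.fn W] V.obj W :=
  (L.carrier W).subtype

/-- The projection to the quotient by a subsheaf. -/
def proj (L : V.Subsheaf) (W : Opens S.X) : V.obj W →ₗ[S.fn W] L.quotient.obj W :=
  (L.carrier W).mkQ

variable (L L₁ L₂ : V.Subsheaf)

theorem incl_mem (v : L.toSuperModule.obj W) : L.incl W v ∈ L.carrier W := Subtype.prop _

theorem incl_res {W' : Opens S.X} (h : W' ≤ W) (v : L.toSuperModule.obj W) :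
    L.incl W' (L.toSuperModule.res h v) = V.res h (L.incl W v) := rfl

theorem proj_eq_zero_iff {v : V.obj W} : L.proj W v = 0 ↔ v ∈ L.carrier W :=
  Submodule.Quotient.mk_eq_zero _

theorem delta_app (v : L₁.toSuperModule.obj W) :
    (L₁.delta L₂).app W le_top v = L₂.proj W (L₁.incl W v) := rfl

theorem incl_mem_homog {b : Bool} {v : L.toSuperModule.obj W}
    (h : v ∈ L.toSuperModule.homog W b) : L.incl W v ∈ V.homog W b := by
  cases b <;> exact h

theorem exists_proj_eq {b : Bool} {y : L.quotient.obj W} (h : y ∈ L.quotient.homog W b) :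
    ∃ v ∈ V.homog W b, L.proj W v = y := by
  cases b <;> exact h

end Subsheaf

/-- Without commutativity a one-sided inverse has to be excluded. If `a b' = 1`, then `b' a` or `1 -
b' a` is a unit: the former makes `a` a unit, the latter forces `b' = 0` because `(1 - b' a) b' =
0`. -/
theorem _root_.IsLocalRing.mul_mem_nonunits {R : Type*} [Ring R] [IsLocalRing R] {a : R}
    (ha : a ∈ nonunits R) (b : R) : a * b ∈ nonunits R := by
  intro h
  obtain ⟨c, hc⟩ := h.exists_right_inv
  rw [mul_assoc] at hc
  set b' := b * c
  rcases IsLocalRing.isUnit_or_isUnit_of_add_one (add_sub_cancel (b' * a) 1) with h | h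
  · obtain ⟨d, hd⟩ := h.exists_left_inv
    rw [← mul_assoc] at hd
    exact ha ⟨⟨a, b', hc, by rwa [left_inv_eq_right_inv hd hc] at hd⟩, rfl⟩
  · have hz : (1 - b' * a) * b' = 0 := by rw [sub_mul, mul_assoc, hc, one_mul, mul_one, sub_self]
    rw [h.mul_right_eq_zero.1 hz, mul_zero] at hc
    exact zero_ne_one hc

variable {x : S.X}

theorem germ_res {M : SuperModule S} {W' : Opens S.X} (h : W' ≤ W) (hx : x ∈ W') (v : M.obj W) :
    M.germ hx (M.res h v) = M.germ (h hx) v := by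
  classical
  exact AddCommGroup.DirectLimit.of_f (ι := {W : Opens S.X // x ∈ W}ᵒᵈ)
    (G := fun W => M.obj (OrderDual.ofDual W).1) (f := fun _ _ h => M.res h)
    (i := OrderDual.toDual ⟨W, h hx⟩) (j := OrderDual.toDual ⟨W', hx⟩) (hij := h) v

open Classical in
/-- Pairing with a section, on the stalk. -/
def SkewForm.stalkPairing (B : V.SkewForm) (hx : x ∈ W) (w : V.obj W) : V.Stalk x →+ S.stalk x :=
  AddCommGroup.DirectLimit.lift (ι := {W : Opens S.X // x ∈ W}ᵒᵈ)
    (fun W => V.obj (OrderDual.ofDual W).1) (fun _ _ h => V.res h) (S.stalk x)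
    (fun W' => (S.germ (Opens.mem_inf.2 ⟨(OrderDual.ofDual W').2, hx⟩ :
        x ∈ (OrderDual.ofDual W').1 ⊓ W)).toAddMonoidHom.comp
      (((B.form _).flip (V.res inf_le_right w)).comp (V.res inf_le_left)))
    (fun W' W'' h v => by
      have hle : (OrderDual.ofDual W'').1 ≤ (OrderDual.ofDual W').1 := h
      have h' : (OrderDual.ofDual W'').1 ⊓ W ≤ (OrderDual.ofDual W').1 ⊓ W :=
        inf_le_inf_right W hle
      change S.germ _ (B.form _ (V.res _ (V.res hle v)) (V.res _ w)) =
        S.germ _ (B.form _ (V.res _ v) (V.res _ w))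
      rw [← S.germ_res h' (Opens.mem_inf.2 ⟨(OrderDual.ofDual W'').2, hx⟩), ← B.form_res,
        V.res_res, V.res_res, V.res_res])

theorem SkewForm.stalkPairing_germ (B : V.SkewForm) (hx : x ∈ W) (w : V.obj W) {W' : Opens S.X}
    (hx' : x ∈ W') (v : V.obj W') : B.stalkPairing hx w (V.germ hx' v) =
      S.germ (Opens.mem_inf.2 ⟨hx', hx⟩)
        (B.form (W' ⊓ W) (V.res inf_le_left v) (V.res inf_le_right w)) := by
  classical
  exact AddCommGroup.DirectLimit.lift_of _ _ _ _ _

/-- The pairing of a section with zero value is not invertible. -/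
theorem SkewForm.germ_form_mem_nonunits (B : V.SkewForm) (hx : x ∈ W) {v : V.obj W}
    (hv : V.value hx v = 0) (w : V.obj W) : S.germ hx (B.form W v w) ∈ nonunits (S.stalk x) := by
  have hv' : V.germ hx v ∈ V.maximalIdealSMul x := (QuotientAddGroup.eq_zero_iff _).1 hv
  -- The form is linear on the left, so pairing with `w` carries `𝔪_x V_x` into the non-units.
  have key : ∀ ξ ∈ V.maximalIdealSMul x, B.stalkPairing hx w ξ ∈ nonunits (S.stalk x) := by
    intro ξ hξ
    induction hξ using AddSubgroup.closure_induction with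
    | mem ξ h =>
      obtain ⟨W', hx', a, v', ha, rfl⟩ := h
      rw [B.stalkPairing_germ, V.res_smul, B.smul_left, map_mul, S.germ_res]
      exact IsLocalRing.mul_mem_nonunits ha _
    | zero =>
      rw [map_zero]
      exact zero_mem_nonunits.2 zero_ne_one
    | add ξ ξ' _ _ h h' =>
      rw [map_add]
      exact IsLocalRing.nonunits_add h h'
    | neg ξ _ h =>
      rw [map_neg]
      intro hu
      exact h ((IsUnit.neg_iff _).1 hu)
  have := key _ hv'
  rwa [B.stalkPairing_germ, B.form_res, S.germ_res] at this

/-- A coordinate of a frame, as a functional. -/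
def Frame.coordFunctional {M : SuperModule S} (e : M.Frame m n W) (i : Fin m ⊕ Fin n) :
    Functional W M where
  app W' h :=
    { toFun := fun v => (e.restrict h).basis.repr v i
      map_add' := fun v v' => by rw [map_add, Finsupp.add_apply]
      map_smul' := fun a v => by rw [map_smul, Finsupp.smul_apply]; rfl }
  app_res W' W'' h h' v := by
    simp only [LinearMap.coe_mk, AddHom.coe_mk, ← e.restrict_restrict h h', Frame.repr_restrict]

/-- The coordinates of a frame of a maximal isotropic subbundle are given locally by pairing with
sections. -/
theorem SkewForm.exists_dual_section {B : V.SkewForm} {L : V.Subsheaf} (hL : B.SurjectsOntoDual L)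
    (e : L.toSuperModule.Frame m n W) (hx : x ∈ W) (i : Fin m ⊕ Fin n) :
    ∃ (W' : Opens S.X) (h : W' ≤ W) (w : V.obj W'), x ∈ W' ∧
      ∀ (W'' : Opens S.X) (h' : W'' ≤ W') (l : L.toSuperModule.obj W''),
        B.form W'' (L.incl W'' l) (V.res h' w) = (e.restrict (h'.trans h)).basis.repr l i := by
  obtain ⟨W', h, w, hx', hw⟩ := hL W (e.coordFunctional i) x hx
  exact ⟨W', h, w, hx', fun W'' h' l => (hw W'' h' l).symm⟩

end SuperModule


/-! ### Normal form of `δ` near the point. -/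

namespace SuperModule

open Matrix

variable {S : Superspace.{u}} {V E F : SuperModule S} {m n : ℕ} {W : Opens S.X} {x : S.X}

/-- The matrix of a morphism in a pair of frames. -/
def HomOver.matrix (d : HomOver ⊤ E F) (e : E.Frame m n W) (g : F.Frame m n W) :
    Matrix (Fin m ⊕ Fin n) (Fin m ⊕ Fin n) (S.fn W) :=
  g.coords fun j => d.app W le_top (e.vec j)

theorem HomOver.sum_matrix (d : HomOver ⊤ E F) (e : E.Frame m n W) (g : F.Frame m n W)
    (i : Fin m ⊕ Fin n) : ∑ j, d.matrix e g i j • g.vec j = d.app W le_top (e.vec i) :=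
  g.sum_coords (fun j => d.app W le_top (e.vec j)) i

theorem HomOver.isEvenMatrix_matrix (d : HomOver ⊤ E F) (e : E.Frame m n W) (g : F.Frame m n W) :
    (S.grading W).IsEvenMatrix (d.matrix e g) :=
  g.isEvenMatrix_coords fun j => d.app_mem_homog le_top (e.vec_mem_homog j)

theorem HomOver.matrix_apply (d : HomOver ⊤ E F) (e : E.Frame m n W) (g : F.Frame m n W)
    (i j : Fin m ⊕ Fin n) : d.matrix e g i j = g.basis.repr (d.app W le_top (e.vec i)) j := rfl

theorem HomOver.matrix_restrict (d : HomOver ⊤ E F) (e : E.Frame m n W) (g : F.Frame m n W)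
    {W' : Opens S.X} (h : W' ≤ W) :
    d.matrix (e.restrict h) (g.restrict h) = (d.matrix e g).map (S.res h) :=
  coords_app_restrict d e g h

theorem HomOver.matrix_change (d : HomOver ⊤ E F) (e e' : E.Frame m n W) (g g' : F.Frame m n W) :
    d.matrix e' g' = e.coords e'.vec * d.matrix e g * g'.coords g.vec :=
  coords_app_change d e e' g g'

theorem HomOver.matrix_mul_coords (d : HomOver ⊤ E F) (e : E.Frame m n W) (g g' : F.Frame m n W) :
    d.matrix e g' * g.coords g'.vec = d.matrix e g :=
  g.coords_mul g' _

theorem HomOver.coords_mul_matrix (d : HomOver ⊤ E F) (e e' : E.Frame m n W) (g : F.Frame m n W) :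
    e.coords e'.vec * d.matrix e g = d.matrix e' g :=
  (coords_app d e g _).symm

theorem Frame.coords_change {M : SuperModule S} (e : M.Frame m n W)
    {P : Matrix (Fin m ⊕ Fin n) (Fin m ⊕ Fin n) (S.fn W)} (hP : (S.grading W).IsEvenUnit P) :
    e.coords (e.change P hP).vec = P :=
  e.coords_eq fun _ => rfl

theorem Frame.change_coords {M : SuperModule S} (e : M.Frame m n W)
    {P P' : Matrix (Fin m ⊕ Fin n) (Fin m ⊕ Fin n) (S.fn W)} (hP : (S.grading W).IsEvenUnit P)
    (h : P * P' = 1) : (e.change P hP).coords e.vec = P' := by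
  have := e.coords_mul (e.change P hP) e.vec
  rw [coords_change, coords_self] at this
  calc _ = (e.change P hP).coords e.vec * (P * P') := by rw [h, Matrix.mul_one]
    _ = P' := by rw [← Matrix.mul_assoc, this, Matrix.one_mul]

theorem fromBlocks_map_res {W' : Opens S.X} (h : W' ≤ W)
    (A : Matrix (Fin m) (Fin m) (S.evenFn W)) (B : Matrix (Fin m) (Fin n) (S.fn W))
    (C : Matrix (Fin n) (Fin m) (S.fn W)) (D : Matrix (Fin n) (Fin n) (S.evenFn W)) :
    (fromBlocks ((S.grading W).up A) B C ((S.grading W).up D)).map (S.res h) =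
      fromBlocks ((S.grading W').up ((S.evenRes h).mapMatrix A)) (B.map (S.res h))
        (C.map (S.res h)) ((S.grading W').up ((S.evenRes h).mapMatrix D)) :=
  fromBlocks_map _ _ _ _ _

theorem isOddMatrix_map {W' : Opens S.X} (h : W' ≤ W) {ι κ : Type*} {B : Matrix ι κ (S.fn W)}
    (hB : (S.grading W).IsOddMatrix B) : (S.grading W').IsOddMatrix (B.map (S.res h)) :=
  fun i j => S.map_odd W W' h _ (hB i j)

theorem eval_mapMatrix_res {W' : Opens S.X} (h : W' ≤ W) (hx : x ∈ W') {ι : Type*} [Fintype ι]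
    [DecidableEq ι] (D : Matrix ι ι (S.evenFn W)) :
    (S.eval hx).mapMatrix ((S.evenRes h).mapMatrix D) = (S.eval (h hx)).mapMatrix D :=
  Matrix.ext fun i j => S.eval_res h hx (D i j)

theorem Frame.exists_lift {L : V.Subsheaf} (g : L.quotient.Frame m n W) :
    ∃ v : Fin m ⊕ Fin n → V.obj W, (∀ j, v j ∈ V.homog W j.isRight) ∧
      ∀ j, L.proj W (v j) = g.vec j := by
  choose v hv h using fun j => L.exists_proj_eq (g.vec_mem_homog j)
  exact ⟨v, hv, h⟩

/-- If the even parts of the fibres of `L₁` and `L₂` are disjoint, then the kernel of the even block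
of `δ` at the point is zero. -/
theorem eval_eq_zero_of_vecMul {β : V.SkewForm} {L₁ L₂ : V.Subsheaf}
    (hdual : β.SurjectsOntoDual L₁) (hs : L₁.fibreEven x ∩ L₂.fibreEven x = {0}) (hx : x ∈ W)
    (e : L₁.toSuperModule.Frame m n W) (g : L₂.quotient.Frame m n W)
    {A : Matrix (Fin m) (Fin m) (S.evenFn W)}
    (hA : ∀ i j, (L₁.delta L₂).matrix e g (Sum.inl i) (Sum.inl j) = A i j)
    (c : Fin m → S.evenFn W) (hc : ∀ j, S.eval hx (∑ i, c i * A i j) = 0) (i : Fin m) :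
    S.eval hx (c i) = 0 := by
  obtain ⟨gl, hgl, hproj⟩ := g.exists_lift
  -- The even section `v = ∑ c i • e i` of `L₁` has an image under `δ` whose coordinates `q` are all
  -- non-units at `x`: the even ones by `hc`, the odd ones by nilpotency.
  let a : Fin m ⊕ Fin n → S.fn W := Sum.elim (fun i => (c i : S.fn W)) 0
  let v : L₁.toSuperModule.obj W := ∑ k, a k • e.vec k
  have hN := (L₁.delta L₂).isEvenMatrix_matrix e g
  have hv : v ∈ L₁.toSuperModule.homog W false := by
    refine sum_mem fun k _ => ?_
    rcases k with k | k
    · exact smul_mem_homog (p := false) (q := false) (c k).2 (e.vec_mem_homog (Sum.inl k))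
    · change (0 : S.fn W) • _ ∈ _
      rw [zero_smul]
      exact zero_mem _
  let q : Fin m ⊕ Fin n → S.fn W := fun j =>
    ∑ i, (c i : S.fn W) * (L₁.delta L₂).matrix e g (Sum.inl i) j
  have hq : ∀ j, q j ∈ (S.grading W).homog j.isRight := fun j => sum_mem fun i _ => by
    have := (S.grading W).mul_mem_homog (p := false) (c i).2 (hN (Sum.inl i) j)
    rwa [Sum.isRight_inl, Bool.false_xor, Bool.false_xor] at this
  have hδ : (L₁.delta L₂).app W le_top v = ∑ j, q j • g.vec j := by
    rw [map_sum, Fintype.sum_sum_type]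
    have hz : ∑ k : Fin n, (L₁.delta L₂).app W le_top (a (Sum.inr k) • e.vec (Sum.inr k)) = 0 :=
      Finset.sum_eq_zero fun k _ => by
        change (L₁.delta L₂).app W le_top ((0 : S.fn W) • _) = 0
        rw [zero_smul, map_zero]
    rw [hz, add_zero]
    simp only [map_smul, ← (L₁.delta L₂).sum_matrix e g, Finset.smul_sum, smul_smul, q,
      Finset.sum_smul]
    exact Finset.sum_comm
  -- `r` lifts `δ v` and has value zero, so `v` and `v - r ∈ L₂` share their value, which therefore
  -- lies in `L₁⁺ ∩ L₂⁺`.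
  let r : V.obj W := ∑ j, q j • gl j
  have hr : r ∈ V.homog W false := sum_mem fun j _ => by
    have := smul_mem_homog (hq j) (hgl j)
    rwa [Bool.xor_self] at this
  have hl : L₁.incl W v - r ∈ L₂.carrier W := by
    rw [← L₂.proj_eq_zero_iff, map_sub, ← Subsheaf.delta_app, hδ, map_sum]
    simp only [map_smul, hproj, sub_self]
  have hnon : ∀ j, S.germ hx (q j) ∈ nonunits (S.stalk x) := by
    rintro (j | j)
    · have e : q (Sum.inl j) = ((∑ i, c i * A i j : S.evenFn W) : S.fn W) := by
        push_cast
        exact Finset.sum_congr rfl fun i _ => by rw [hA]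
      rw [e]
      intro hu
      exact S.eval_ne_zero_iff.2 hu (hc j)
    · exact S.germ_mem_nonunits_of_odd hx (hq (Sum.inr j))
  have hval : V.value hx (L₁.incl W v) = V.value hx (L₁.incl W v - r) := by
    refine (QuotientAddGroup.eq).2 ?_
    rw [map_sub, neg_add_eq_sub, sub_sub_cancel_left, neg_mem_iff, map_sum]
    exact sum_mem fun j _ => AddSubgroup.subset_closure ⟨W, hx, q j, gl j, hnon j, rfl⟩
  have hzero : V.value hx (L₁.incl W v) = 0 := by
    have : V.value hx (L₁.incl W v) ∈ L₁.fibreEven x ∩ L₂.fibreEven x :=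
      ⟨⟨W, hx, _, L₁.incl_mem v, L₁.incl_mem_homog hv, rfl⟩,
        ⟨W, hx, _, hl, sub_mem (L₁.incl_mem_homog hv) hr, hval⟩⟩
    rw [hs] at this
    exact this
  -- Pairing with a section dual to `e i` recovers `c i` from `v`; as `v` has value zero, `c i` is a
  -- non-unit.
  obtain ⟨W', h, w, hx', hw⟩ := SkewForm.exists_dual_section hdual e hx (Sum.inl i)
  have hzero' : V.value hx' (V.res h (L₁.incl W v)) = 0 := by
    rw [← hzero]
    exact congrArg QuotientAddGroup.mk (germ_res h hx' _)
  have hnu := β.germ_form_mem_nonunits hx' hzero' w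
  have hform := hw W' le_rfl (L₁.toSuperModule.res h v)
  rw [V.res_self, L₁.incl_res, e.repr_restrict, e.repr_sum] at hform
  rw [hform, S.germ_res] at hnu
  by_contra hne
  exact hnu (S.eval_ne_zero_iff.1 hne)

/-- A singular block would have a nonzero left kernel vector over the residue field; functions
lifting its entries contradict `eval_eq_zero_of_vecMul`. -/
theorem eval_det_ne_zero {β : V.SkewForm} {L₁ L₂ : V.Subsheaf}
    (hdual : β.SurjectsOntoDual L₁) (hs : L₁.fibreEven x ∩ L₂.fibreEven x = {0}) (hx : x ∈ W)
    (e : L₁.toSuperModule.Frame m n W) (g : L₂.quotient.Frame m n W)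
    {A : Matrix (Fin m) (Fin m) (S.evenFn W)}
    (hA : ∀ i j, (L₁.delta L₂).matrix e g (Sum.inl i) (Sum.inl j) = A i j) :
    S.eval hx A.det ≠ 0 := by
  intro h0
  rw [RingHom.map_det] at h0
  obtain ⟨c, hc, hcA⟩ := Matrix.exists_vecMul_eq_zero_iff.2 h0
  obtain ⟨W', h, hx', Q, hQ⟩ := S.exists_matrix_lift hx (Matrix.of fun (_ : Unit) i => c i)
  have hQ' : ∀ i, S.eval hx' (Q () i) = c i := fun i => congrFun (congrFun hQ ()) i
  refine hc (funext fun i => ?_)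
  rw [← hQ' i]
  refine eval_eq_zero_of_vecMul hdual hs hx' (e.restrict h) (g.restrict h)
    (A := (S.evenRes h).mapMatrix A) (fun i j => ?_) (fun i => Q () i) (fun j => ?_) i
  · rw [HomOver.matrix_restrict, Matrix.map_apply, hA]
    rfl
  · rw [map_sum]
    simp only [map_mul, hQ']
    have := congrFun hcA j
    rw [vecMul, dotProduct] at this
    refine Eq.trans (Finset.sum_congr rfl fun k _ => ?_) this
    congr 1
    exact S.eval_res h hx' _

/-- Near a point, frames can be chosen such that the odd block of a morphism is diagonal at the
point. -/
theorem exists_frames_diagonal (d : HomOver ⊤ E F) (hx : x ∈ W) (e : E.Frame m n W)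
    (g : F.Frame m n W) :
    ∃ (W' : Opens S.X) (hx' : x ∈ W') (e' : E.Frame m n W') (g' : F.Frame m n W')
      (A : Matrix (Fin m) (Fin m) (S.evenFn W')) (B : Matrix (Fin m) (Fin n) (S.fn W'))
      (C : Matrix (Fin n) (Fin m) (S.fn W')) (D : Matrix (Fin n) (Fin n) (S.evenFn W'))
      (t : Fin n → S.residueField x),
      (S.grading W').IsOddMatrix B ∧ (S.grading W').IsOddMatrix C ∧
      d.matrix e' g' = fromBlocks ((S.grading W').up A) B C ((S.grading W').up D) ∧
      (S.eval hx').mapMatrix D = diagonal t := by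
  obtain ⟨A, B, C, D, hB, hC, hN⟩ := (d.isEvenMatrix_matrix e g).exists_fromBlocks
  obtain ⟨l, l', t, ht⟩ :=
    Pivot.exists_list_transvec_mul_mul_list_transvec_eq_diagonal ((S.eval hx).mapMatrix D)
  -- Products of transvections have determinant one, so their lifts are invertible near `x`.
  obtain ⟨W₁, h₁, hx₁, P, hP, hPu⟩ := S.exists_matrix_lift_isUnit hx
    (l.map TransvectionStruct.toMatrix).prod (by simp)
  obtain ⟨W₂, h₂, hx₂, Q, hQ, hQu⟩ := S.exists_matrix_lift_isUnit hx₁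
    (l'.map TransvectionStruct.toMatrix).prod (by simp)
  let σ := S.grading W₂
  let P₂ := (S.evenRes h₂).mapMatrix P
  have hP₂u : IsUnit P₂.det := by
    have := hPu.map (S.evenRes h₂)
    rwa [RingHom.map_det] at this
  have hQi : IsUnit (Q⁻¹).det := by
    rw [det_nonsing_inv]
    exact hQu.ringInverse
  have hu := SuperGrading.isEvenUnit_diag (σ := σ) (A := (1 : Matrix (Fin m) (Fin m) _)) (by simp)
    hP₂u
  have hu' := SuperGrading.isEvenUnit_diag (σ := σ) (A := (1 : Matrix (Fin m) (Fin m) _)) (by simp)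
    hQi
  have hinv : fromBlocks (σ.up (1 : Matrix (Fin m) (Fin m) _)) 0 0 (σ.up Q⁻¹) *
      fromBlocks (σ.up (1 : Matrix (Fin m) (Fin m) _)) 0 0 (σ.up Q) = 1 := by
    have := SuperGrading.up_inv_mul (σ := σ) hQu
    simp [fromBlocks_multiply, this]
  have hle : W₂ ≤ W := h₂.trans h₁
  -- Changing `g` by `Q⁻¹` multiplies the matrix of `d` by `Q` on the right.
  refine ⟨W₂, hx₂, (e.restrict hle).change _ hu, (g.restrict hle).change _ hu',
    (S.evenRes hle).mapMatrix A, B.map (S.res hle) * σ.up Q, σ.up P₂ * C.map (S.res hle),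
    P₂ * (S.evenRes hle).mapMatrix D * Q, t, (isOddMatrix_map hle hB).mul_up _,
    (isOddMatrix_map hle hC).up_mul _, ?_, ?_⟩
  · rw [d.matrix_change (e.restrict hle) _ (g.restrict hle), d.matrix_restrict,
      Frame.coords_change, Frame.change_coords _ _ hinv, hN, fromBlocks_map_res]
    simp [fromBlocks_multiply, σ]
  · rw [map_mul, map_mul, eval_mapMatrix_res, eval_mapMatrix_res, ← ht]
    congr 2

/-- Splitting off the part of a morphism that is invertible at a point. -/
theorem exists_frames_of_isUnit {d : HomOver ⊤ E F} (hx : x ∈ W) {e : E.Frame m n W}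
    {g : F.Frame m n W} {A : Matrix (Fin m) (Fin m) (S.evenFn W)}
    {B : Matrix (Fin m) (Fin n) (S.fn W)} {C : Matrix (Fin n) (Fin m) (S.fn W)}
    {D : Matrix (Fin n) (Fin n) (S.evenFn W)} (hB : (S.grading W).IsOddMatrix B)
    (hC : (S.grading W).IsOddMatrix C)
    (hN : d.matrix e g = fromBlocks ((S.grading W).up A) B C ((S.grading W).up D))
    (p : Fin n → Prop) [DecidablePred p]
    (hD : ∀ i j, p j → (i ≠ j ∨ p i) → S.eval hx (D i j) = 0) (hA : IsUnit A.det)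
    (hD' : IsUnit (of fun i j => if p i then (1 : Matrix _ _ _) i j else D i j).det) :
    ∃ (e' : E.Frame m n W) (g' : F.Frame m n W) (X : Matrix (Fin n) (Fin n) (S.evenFn W)),
      d.matrix e' g' = fromBlocks 1 0 0 ((S.grading W).up X) ∧
      (∀ i j, ¬(p i ∧ p j) → X i j = (1 : Matrix _ _ _) i j) ∧
      ∀ i j, p i → p j → S.eval hx (X i j) = 0 := by
  set σ := S.grading W
  set D' : Matrix (Fin n) (Fin n) (S.evenFn W) :=
    of fun i j => if p i then (1 : Matrix _ _ _) i j else D i j with hD'def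
  let C' : Matrix (Fin n) (Fin m) (S.fn W) := of fun i j => if p i then 0 else C i j
  have hC' : σ.IsOddMatrix C' := fun i j => by
    change (if p i then 0 else C i j) ∈ σ.odd
    split_ifs
    exacts [zero_mem _, hC i j]
  -- `T` is the matrix of `d` with the rows of the bad indices (odd ones satisfying `p`) replaced by
  -- unit rows. Thus `g'` consists of `d (e i)` for good `i` and of `g i` for bad `i`, and the good
  -- rows of `c` become unit rows.
  have hT := SuperGrading.isEvenUnit_fromBlocks (S.isUnit_two W) hB hC' hA hD'
  set T := fromBlocks (σ.up A) B C' (σ.up D') with hTdef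
  let g' := g.change T hT
  set c := d.matrix e g' with hc
  have hceven : σ.IsEvenMatrix c := d.isEvenMatrix_matrix e g'
  have hcT : c * T = d.matrix e g := by
    rw [← d.matrix_mul_coords e g g', Frame.coords_change]
  let bad : Fin m ⊕ Fin n → Prop := Sum.elim (fun _ => False) p
  have hbadr : ∀ i, bad (Sum.inr i) ↔ p i := fun _ => Iff.rfl
  have hbadl : ∀ i, ¬bad (Sum.inl i) := fun _ h => h
  classical
  have hgood : ∀ i, ¬bad i → ∀ j, c i j = (1 : Matrix _ _ _) i j := by
    intro i hi j
    have hrow : ∀ j, d.matrix e g i j = T i j := by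
      intro j
      rw [hN]
      rcases i with i | i
      · cases j <;> rfl
      · have hi' : ¬p i := hi
        rcases j with j | j
        · change C i j = if p i then 0 else C i j
          rw [if_neg hi']
        · simp [hTdef, hD'def, hi']
    have : d.app W le_top (e.vec i) = g'.vec i := by
      rw [← d.sum_matrix e g, Frame.change_vec]
      simp only [hrow]
    rw [hc, d.matrix_apply, this, ← Frame.basis_apply, Module.Basis.repr_self,
      Finsupp.single_apply, Matrix.one_apply]
  -- `Q` has only bad rows and good columns, so `Q² = 0`; as the good rows of `c` are unit rows, `(1
  -- - Q) c = c - Q`. This subtracts combinations of good frame vectors from the bad ones and clears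
  -- the bad rows in good columns.
  let Q : Matrix (Fin m ⊕ Fin n) (Fin m ⊕ Fin n) (S.fn W) :=
    of fun i j => if bad i ∧ ¬bad j then c i j else 0
  have hQeven : σ.IsEvenMatrix Q := fun i j => by
    change (if bad i ∧ ¬bad j then c i j else 0) ∈ _
    split_ifs
    exacts [hceven i j, zero_mem _]
  have honeeven : σ.IsEvenMatrix (1 : Matrix (Fin m ⊕ Fin n) (Fin m ⊕ Fin n) (S.fn W)) := by
    rw [← fromBlocks_one, ← map_one σ.up, ← map_one σ.up]
    exact SuperGrading.isEvenMatrix_fromBlocks SuperGrading.isOddMatrix_zero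
      SuperGrading.isOddMatrix_zero
  have hQQ : Q * Q = 0 := by
    ext i j
    rw [Matrix.mul_apply]
    refine Finset.sum_eq_zero fun k _ => ?_
    by_cases hk : bad k <;> simp [Q, hk]
  have hu : σ.IsEvenUnit (1 - Q) := by
    refine ⟨fun i j => sub_mem (honeeven i j) (hQeven i j), 1 + Q,
      fun i j => add_mem (honeeven i j) (hQeven i j), ?_, ?_⟩
    · rw [sub_mul, mul_add, mul_add, hQQ]
      simp
    · rw [add_mul, mul_sub, mul_sub, hQQ]
      simp
  have hQc : Q * c = Q := by
    refine Matrix.ext fun i j => ?_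
    rw [Matrix.mul_apply]
    have : ∀ k, Q i k * c k j = Q i k * (1 : Matrix _ _ _) k j := by
      intro k
      by_cases hk : bad k
      · simp [Q, hk]
      · rw [hgood k hk]
    simp only [this, ← Matrix.mul_apply, Matrix.mul_one]
  have hmat : d.matrix (e.change _ hu) g' = c - Q := by
    rw [← d.coords_mul_matrix e, Frame.coords_change, ← hc, sub_mul, one_mul, hQc]
  have hcrr : ∀ i j, c (Sum.inr i) (Sum.inr j) ∈ σ.even := fun i j => hceven (Sum.inr i) (Sum.inr j)
  let Y : Matrix (Fin n) (Fin n) (S.evenFn W) := of fun i j => ⟨_, hcrr i j⟩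
  let X : Matrix (Fin n) (Fin n) (S.evenFn W) :=
    of fun i j => if p i ∧ p j then Y i j else (1 : Matrix _ _ _) i j
  refine ⟨e.change _ hu, g', X, ?_, fun i j hij => if_neg hij, fun i j hi hj => ?_⟩
  · rw [hmat]
    have hne : ∀ {i j}, bad i → ¬bad j → (1 : Matrix (Fin m ⊕ Fin n) _ (S.fn W)) i j = 0 :=
      fun hi hj => Matrix.one_apply_ne fun h => hj (h ▸ hi)
    have hQ1 : ∀ i j, (c - Q) i j = if bad i ∧ bad j then c i j else (1 : Matrix _ _ _) i j := by
      intro i j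
      rw [Matrix.sub_apply]
      change c i j - (if bad i ∧ ¬bad j then c i j else 0) = _
      by_cases hi : bad i
      · by_cases hj : bad j
        · simp [hi, hj]
        · simp [hi, hj, hne hi hj]
      · simp [hi, hgood i hi]
    refine Matrix.ext fun i j => ?_
    rw [hQ1]
    rcases i with i | i <;> rcases j with j | j
    · simp [hbadl, Matrix.one_apply]
    · simp [hbadl]
    · simp [hbadl]
    · simp only [hbadr, fromBlocks_apply₂₂, SuperGrading.up_apply, X, of_apply]
      split_ifs
      · rfl
      · rcases eq_or_ne i j with rfl | hij
        · rw [Matrix.one_apply_eq, Matrix.one_apply_eq]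
          rfl
        · rw [Matrix.one_apply_ne hij, Matrix.one_apply_ne (Sum.inr_injective.ne hij)]
          rfl
  · change S.eval hx (if p i ∧ p j then Y i j else (1 : Matrix _ _ _) i j) = 0
    rw [if_pos ⟨hi, hj⟩]
    have hodd : ∀ k : Fin m, c (Sum.inr i) (Sum.inl k) ∈ σ.odd := fun k =>
      hceven (Sum.inr i) (Sum.inl k)
    -- The entry of `c T = d.matrix e g` at bad `i`, `j`, evaluated at `x`: the odd products vanish,
    -- column `j` of `D'` is a unit column, and `D i j` is zero.
    have hent := congrFun (congrFun hcT (Sum.inr i)) (Sum.inr j)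
    rw [hN, Matrix.mul_apply, Fintype.sum_sum_type, fromBlocks_apply₂₂] at hent
    let b : Fin m → S.evenFn W := fun k =>
      ⟨c (Sum.inr i) (Sum.inl k) * B k j, σ.odd_mul_odd _ (hodd k) _ (hB k j)⟩
    have hent' : (∑ k, b k) + ∑ k, Y i k * D' k j = D i j := by
      apply Subtype.ext
      push_cast
      exact hent
    have hev := congrArg (S.eval hx) hent'
    rw [map_add, map_sum, map_sum, hD i j hj (Or.inr hi),
      Finset.sum_eq_zero fun k _ => S.eval_odd_mul_odd hx (hodd k) (hB k j) rfl, zero_add,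
      Finset.sum_eq_single j] at hev
    · rw [← hev, map_mul]
      simp [hD'def, hj]
    · intro k _ hk
      rw [map_mul]
      by_cases hpk : p k
      · simp [hD'def, hpk, hk]
      · simp [hD'def, hpk, hD k j hj (Or.inl hk)]
    · simp

end SuperModule


/-! ### Isotropy and the square root of the determinant. -/

namespace SuperModule

open Matrix

variable {S : Superspace.{u}} {V : SuperModule S} {m n : ℕ} {W : Opens S.X} {x : S.X}

/-- Near a point where the even parts of the fibres of `L₁` and `L₂` are disjoint, there are frames
in which `δ` is the identity up to an odd block that vanishes at the point. -/
theorem exists_adapted_frames {β : V.SkewForm} {L₁ L₂ : V.Subsheaf}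
    (hdual : β.SurjectsOntoDual L₁) (hs : L₁.fibreEven x ∩ L₂.fibreEven x = {0}) (hx : x ∈ W)
    (e : L₁.toSuperModule.Frame m n W) (g : L₂.quotient.Frame m n W) :
    ∃ (W' : Opens S.X) (hx' : x ∈ W') (e' : L₁.toSuperModule.Frame m n W')
      (g' : L₂.quotient.Frame m n W') (X : Matrix (Fin n) (Fin n) (S.evenFn W'))
      (p : Fin n → Prop),
      (L₁.delta L₂).matrix e' g' = fromBlocks 1 0 0 ((S.grading W').up X) ∧
      (∀ i j, ¬(p i ∧ p j) → X i j = (1 : Matrix _ _ _) i j) ∧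
      ∀ i j, p i → p j → S.eval hx' (X i j) = 0 := by
  classical
  obtain ⟨W₁, hx₁, e₁, g₁, A, B, C, D, t, hB, hC, hN, hD⟩ :=
    exists_frames_diagonal (L₁.delta L₂) hx e g
  -- The bad indices: zeros on the diagonal of the odd block at `x`.
  let p : Fin n → Prop := fun i => t i = 0
  have hDij : ∀ i j, S.eval hx₁ (D i j) = diagonal t i j := fun i j => congrFun (congrFun hD i) j
  have hA : S.eval hx₁ A.det ≠ 0 :=
    eval_det_ne_zero hdual hs hx₁ e₁ g₁ fun i j => by rw [hN]; rfl
  let D' : Matrix (Fin n) (Fin n) (S.evenFn W₁) :=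
    of fun i j => if p i then (1 : Matrix _ _ _) i j else D i j
  have hD' : S.eval hx₁ D'.det ≠ 0 := by
    have e : (S.eval hx₁).mapMatrix D' = diagonal fun i => if t i = 0 then 1 else t i := by
      refine Matrix.ext fun i j => ?_
      change S.eval hx₁ (if t i = 0 then (1 : Matrix _ _ _) i j else D i j) = _
      rcases eq_or_ne i j with rfl | hij
      · rw [diagonal_apply_eq]
        split_ifs with h
        · rw [one_apply_eq, map_one]
        · rw [hDij, diagonal_apply_eq]
      · rw [diagonal_apply_ne _ hij]
        split_ifs with h
        · rw [one_apply_ne hij, map_zero]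
        · rw [hDij, diagonal_apply_ne _ hij]
    rw [RingHom.map_det, e, det_diagonal, Finset.prod_ne_zero_iff]
    intro i _
    split_ifs with h
    exacts [one_ne_zero, h]
  have hAD : S.eval hx₁ (A.det * D'.det) ≠ 0 := by
    rw [map_mul]
    exact mul_ne_zero hA hD'
  obtain ⟨W₂, h₂, hx₂, hu⟩ := S.exists_isUnit_of_eval_ne_zero hAD
  rw [map_mul, RingHom.map_det, RingHom.map_det] at hu
  have hD'' : (S.evenRes h₂).mapMatrix D' =
      of fun i j => if p i then (1 : Matrix _ _ _) i j else (S.evenRes h₂).mapMatrix D i j := by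
    refine Matrix.ext fun i j => ?_
    change S.evenRes h₂ (if p i then (1 : Matrix _ _ _) i j else D i j) =
      if p i then (1 : Matrix _ _ _) i j else S.evenRes h₂ (D i j)
    split_ifs
    · rcases eq_or_ne i j with rfl | hij
      · rw [one_apply_eq, one_apply_eq, map_one]
      · rw [one_apply_ne hij, one_apply_ne hij, map_zero]
    · rfl
  obtain ⟨e', g', X, h⟩ := exists_frames_of_isUnit (d := L₁.delta L₂) hx₂
    (isOddMatrix_map h₂ hB) (isOddMatrix_map h₂ hC)
    (by rw [HomOver.matrix_restrict, hN, fromBlocks_map_res]) p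
    (fun i j hj hij => by
      change S.eval hx₂ (S.evenRes h₂ (D i j)) = 0
      rw [S.eval_res, hDij]
      by_cases h : i = j
      · rw [h, diagonal_apply_eq]
        exact hj
      · rw [diagonal_apply_ne _ h])
    (isUnit_of_mul_isUnit_left hu) (hD'' ▸ isUnit_of_mul_isUnit_right hu)
  exact ⟨W₂, hx₂, e', g', X, p, h⟩

/-- Sections dual to the odd part of a frame of a maximal isotropic subbundle. -/
theorem SkewForm.exists_dual_sections {β : V.SkewForm} {L : V.Subsheaf}
    (hdual : β.SurjectsOntoDual L) (hx : x ∈ W) (e : L.toSuperModule.Frame m n W) :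
    ∃ (W' : Opens S.X) (h : W' ≤ W) (w : Fin n → V.obj W'), x ∈ W' ∧ (∀ j, w j ∈ V.odd W') ∧
      ∀ i j, β.form W' (L.incl W' ((e.restrict h).vec (Sum.inr i))) (w j) =
        (1 : Matrix (Fin n) (Fin n) (S.fn W')) i j := by
  choose U hU w hxU hw using fun j : Fin n => β.exists_dual_section hdual e hx (Sum.inr j)
  obtain ⟨W₁, hx₁, hle⟩ := S.exists_le_of_finite U hxU
  let W' := W ⊓ W₁
  have hW : ∀ j, W' ≤ U j := fun j => inf_le_right.trans (hle j)
  -- The odd component of a dual section is already dual: the even component pairs with an odd frame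
  -- vector to an odd function, which must vanish because the total pairing is `0` or `1`.
  choose w₀ h₀ w₁ h₁ hsum using fun j => exists_even_add_odd (V.res (hW j) (w j))
  refine ⟨W', inf_le_left, w₁, Opens.mem_inf.2 ⟨hx, hx₁⟩, h₁, fun i j => ?_⟩
  set v := (e.restrict (inf_le_left : W' ≤ W)).vec (Sum.inr i) with hv
  have hodd : L.incl W' v ∈ V.odd W' :=
    L.incl_mem_homog ((e.restrict (inf_le_left : W' ≤ W)).vec_mem_homog (Sum.inr i))
  have hform := hw j W' (hW j) v
  rw [hsum, map_add, hv, ← Frame.basis_apply, Module.Basis.repr_self, Finsupp.single_apply,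
    Frame.basis_apply, ← hv] at hform
  have hone : (if Sum.inr i = (Sum.inr j : Fin m ⊕ Fin n) then (1 : S.fn W') else 0) =
      (1 : Matrix (Fin n) (Fin n) (S.fn W')) i j := by
    rw [Matrix.one_apply]
    simp only [Sum.inr.injEq]
  rw [hone] at hform
  have hmem : (1 : Matrix (Fin n) (Fin n) (S.fn W')) i j ∈ (S.grading W').even := by
    rw [Matrix.one_apply]
    split_ifs
    exacts [one_mem _, zero_mem _]
  have hev := β.odd_odd W' _ hodd _ (h₁ j)
  have hod : β.form W' (L.incl W' v) (w₀ j) ∈ (S.grading W').odd := by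
    have := β.skew_even W' _ (h₀ j) (L.incl W' v)
    rw [← neg_eq_iff_eq_neg] at this
    rw [← this]
    exact neg_mem (β.even_odd W' _ (h₀ j) _ hodd)
  have hz : β.form W' (L.incl W' v) (w₀ j) = 0 := by
    refine (S.grading W').eq_zero_of_mem ?_ hod
    rw [eq_sub_of_add_eq hform]
    exact sub_mem hmem hev
  rw [← hform, hz, zero_add]

theorem SkewForm.form_sum_left (β : V.SkewForm) {ι : Type*} (s : Finset ι) (a : ι → S.fn W)
    (v : ι → V.obj W) (w : V.obj W) :
    β.form W (∑ i ∈ s, a i • v i) w = ∑ i ∈ s, a i * β.form W (v i) w := by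
  rw [map_sum, AddMonoidHom.finsetSum_apply]
  simp only [β.smul_left]

/-- Linearity is given only in the first argument; symmetry on odd sections moves even scalars out
of the second. -/
theorem SkewForm.form_smul_right (β : V.SkewForm) {v w : V.obj W} (hv : v ∈ V.odd W)
    (hw : w ∈ V.odd W) (a : S.evenFn W) :
    β.form W v ((a : S.fn W) • w) = a * β.form W v w := by
  rw [β.symm_odd W v hv _ (V.even_smul_odd W a a.2 w hw), β.smul_left, β.symm_odd W w hw v hv]

/-- The matrix of the form on two families of odd sections. -/
def SkewForm.oddMatrix (β : V.SkewForm) {ι κ : Type*} (v : ι → V.obj W) (w : κ → V.obj W)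
    (hv : ∀ i, v i ∈ V.odd W) (hw : ∀ j, w j ∈ V.odd W) : Matrix ι κ (S.evenFn W) :=
  of fun i j => ⟨β.form W (v i) (w j), β.odd_odd W _ (hv i) _ (hw j)⟩

section Adapted

variable {β : V.SkewForm} {L₁ L₂ : V.Subsheaf} {e : L₁.toSuperModule.Frame m n W}
  {g : L₂.quotient.Frame m n W} {X : Matrix (Fin n) (Fin n) (S.evenFn W)} {p : Fin n → Prop}
  [DecidablePred p]

/-- A section of `L₁` is the lift of its image under `δ` up to a section of `L₂`. -/
theorem incl_sub_sum_mem
    (hX : (L₁.delta L₂).matrix e g = fromBlocks 1 0 0 ((S.grading W).up X))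
    (hXp : ∀ i j, ¬(p i ∧ p j) → X i j = (1 : Matrix _ _ _) i j)
    {v : Fin m ⊕ Fin n → V.obj W} (hproj : ∀ j, L₂.proj W (v j) = g.vec j) {i : Fin n} (hi : p i) :
    L₁.incl W (e.vec (Sum.inr i)) - ∑ a : {i // p i}, (X i a : S.fn W) • v (Sum.inr a) ∈
      L₂.carrier W := by
  rw [← L₂.proj_eq_zero_iff, map_sub, ← Subsheaf.delta_app, ← (L₁.delta L₂).sum_matrix e g, hX,
    Fintype.sum_sum_type, ← Fintype.sum_subtype_add_sum_subtype p, map_sum]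
  simp only [map_smul, hproj, fromBlocks_apply₂₁, fromBlocks_apply₂₂, Matrix.zero_apply, zero_smul,
    Finset.sum_const_zero, zero_add, SuperGrading.up_apply]
  rw [add_sub_cancel_left]
  refine Finset.sum_eq_zero fun a _ => ?_
  rw [hXp i a fun h => a.2 h.2, one_apply_ne (show i ≠ a from fun h => a.2 (h ▸ hi))]
  exact zero_smul _ _

/-- Expand `(l i, l j) = 0` for the sections `l i = e i - ∑ X₀ i a • v a` of `L₂`; the term `(e i, e
j)` drops out because `L₁` is isotropic. -/
theorem mul_oddMatrix_skew
    (hX : (L₁.delta L₂).matrix e g = fromBlocks 1 0 0 ((S.grading W).up X))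
    (hXp : ∀ i j, ¬(p i ∧ p j) → X i j = (1 : Matrix _ _ _) i j)
    (hiso₁ : ∀ W, ∀ l ∈ L₁.carrier W, ∀ l' ∈ L₁.carrier W, β.form W l l' = 0)
    (hiso₂ : ∀ W, ∀ l ∈ L₂.carrier W, ∀ l' ∈ L₂.carrier W, β.form W l l' = 0)
    {v : Fin m ⊕ Fin n → V.obj W} (hproj : ∀ j, L₂.proj W (v j) = g.vec j)
    {X₀ H G : Matrix {i // p i} {i // p i} (S.evenFn W)}
    (hX₀ : X₀ = X.submatrix Subtype.val Subtype.val)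
    (he : ∀ i, L₁.incl W (e.vec (Sum.inr i)) ∈ V.odd W) (hv : ∀ i, v (Sum.inr i) ∈ V.odd W)
    (hH : H = β.oddMatrix (fun i : {i // p i} => L₁.incl W (e.vec (Sum.inr i)))
      (fun i : {i // p i} => v (Sum.inr i)) (fun _ => he _) (fun _ => hv _))
    (hG : G = β.oddMatrix (fun i : {i // p i} => v (Sum.inr i))
      (fun i : {i // p i} => v (Sum.inr i)) (fun _ => hv _) (fun _ => hv _)) :
    X₀ * G * X₀ᵀ = H * X₀ᵀ + X₀ * Hᵀ := by
  refine Matrix.ext fun i j => Subtype.ext ?_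
  have hXe : ∀ a b : {i // p i}, X a b = X₀ a b := fun a b => by rw [hX₀]; rfl
  have hl : ∀ i : {i // p i}, L₁.incl W (e.vec (Sum.inr i)) -
      ∑ a, (X₀ i a : S.fn W) • v (Sum.inr a) ∈ L₂.carrier W := fun i => by
    simpa only [hXe] using incl_sub_sum_mem hX hXp hproj i.2
  have h0 := hiso₂ W _ (hl i) _ (hl j)
  have hHe : ∀ a b : {i // p i}, β.form W (L₁.incl W (e.vec (Sum.inr a))) (v (Sum.inr b)) = H a b :=
    fun a b => by rw [hH]; rfl
  have hHe' : ∀ a b : {i // p i}, β.form W (v (Sum.inr b)) (L₁.incl W (e.vec (Sum.inr a))) = H a b :=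
    fun a b => by rw [β.symm_odd W _ (hv _) _ (he _), hHe]
  have hGe : ∀ a b : {i // p i}, β.form W (v (Sum.inr a)) (v (Sum.inr b)) = G a b :=
    fun a b => by rw [hG]; rfl
  have hr : ∀ u ∈ V.odd W, ∀ k : {i // p i},
      β.form W u (∑ a : {i // p i}, (X₀ k a : S.fn W) • v (Sum.inr a)) =
        ∑ a, (X₀ k a : S.fn W) * β.form W u (v (Sum.inr a)) := fun u hu k => by
    rw [map_sum]
    simp only [β.form_smul_right hu (hv _)]
  rw [map_sub, map_sub, AddMonoidHom.sub_apply, AddMonoidHom.sub_apply,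
    hiso₁ W _ (L₁.incl_mem _) _ (L₁.incl_mem _), hr _ (he i) j, β.form_sum_left, β.form_sum_left]
    at h0
  simp only [hr _ (hv _), hHe, hHe', hGe] at h0
  simp only [Matrix.mul_apply, Matrix.add_apply, transpose_apply, Subring.coe_add,
    AddSubmonoidClass.coe_finsetSum, Subring.coe_mul]
  have e₁ : ∀ a b, (X₀ i a : S.fn W) * ((X₀ j b : S.fn W) * G a b) = X₀ i a * G a b * X₀ j b :=
    fun a b => by rw [(S.grading W).even_comm _ (X₀ j b).2, mul_assoc]
  have e₂ : ∀ a, (X₀ j a : S.fn W) * H i a = H i a * X₀ j a := fun a =>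
    (S.grading W).even_comm _ (X₀ j a).2 _
  simp only [Finset.mul_sum, e₁, e₂] at h0
  rw [Finset.sum_comm] at h0
  simp only [Finset.sum_mul]
  rw [zero_sub, sub_eq_zero, eq_sub_iff_add_eq, neg_add_eq_iff_eq_add] at h0
  exact h0.trans (add_comm _ _)

/-- Pairing of an adapted frame with an odd section. -/
theorem exists_form_eq_sum
    (hX : (L₁.delta L₂).matrix e g = fromBlocks 1 0 0 ((S.grading W).up X))
    (hXp : ∀ i j, ¬(p i ∧ p j) → X i j = (1 : Matrix _ _ _) i j)
    (hiso₁ : ∀ W, ∀ l ∈ L₁.carrier W, ∀ l' ∈ L₁.carrier W, β.form W l l' = 0)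
    (hiso₂ : ∀ W, ∀ l ∈ L₂.carrier W, ∀ l' ∈ L₂.carrier W, β.form W l l' = 0)
    {v : Fin m ⊕ Fin n → V.obj W} (hproj : ∀ j, L₂.proj W (v j) = g.vec j)
    (he : ∀ i, L₁.incl W (e.vec (Sum.inr i)) ∈ V.odd W) (hv : ∀ i, v (Sum.inr i) ∈ V.odd W)
    {w : V.obj W} (hw : w ∈ V.odd W) :
    ∃ b ρ : {i // p i} → S.evenFn W, ∀ i : {i // p i},
      β.form W (L₁.incl W (e.vec (Sum.inr i))) w =
        ∑ a : {i // p i}, (b a : S.fn W) *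
          β.form W (L₁.incl W (e.vec (Sum.inr i))) (v (Sum.inr a)) +
        ∑ a : {i // p i}, (X i a : S.fn W) * ρ a := by
  let y := L₂.proj W w
  have hy : y ∈ L₂.quotient.homog W true := ⟨w, hw, rfl⟩
  have hpar := g.repr_mem_homog hy
  let b : Fin n → S.evenFn W := fun k => ⟨g.basis.repr y (Sum.inr k), hpar (Sum.inr k)⟩
  -- Decompose `w = u + z + r` with `u` in the span of the good frame vectors of `L₁`, `z` in the
  -- span of the bad lifts and `r` in `L₂`. Then `u` is orthogonal to `e i`, and against `r` the
  -- vector `e i` may be replaced by `∑ X i a • v a`.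
  let u : L₁.toSuperModule.obj W := ∑ k : Fin m, g.basis.repr y (Sum.inl k) • e.vec (Sum.inl k) +
    ∑ k : {i // ¬p i}, (b k : S.fn W) • e.vec (Sum.inr k)
  have hu : L₁.incl W u ∈ V.odd W := by
    refine L₁.incl_mem_homog (b := true) (add_mem (sum_mem fun k _ => ?_) (sum_mem fun k _ => ?_))
    · exact smul_mem_homog (hpar (Sum.inl k)) (e.vec_mem_homog (Sum.inl k))
    · exact smul_mem_homog (p := false) (b k).2 (e.vec_mem_homog (Sum.inr k))
  let z : V.obj W := ∑ a : {i // p i}, (b a : S.fn W) • v (Sum.inr a)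
  have hz : z ∈ V.odd W := sum_mem fun a _ => V.even_smul_odd W _ (b a).2 _ (hv _)
  let r := w - L₁.incl W u - z
  have hr : r ∈ V.odd W := sub_mem (sub_mem hw hu) hz
  have hδl : ∀ k, (L₁.delta L₂).app W le_top (e.vec (Sum.inl k)) = g.vec (Sum.inl k) := fun k => by
    rw [← (L₁.delta L₂).sum_matrix e g, hX, Fintype.sum_sum_type]
    simp [Matrix.one_apply]
  have hδr : ∀ k : {i // ¬p i}, (L₁.delta L₂).app W le_top (e.vec (Sum.inr k)) =
      g.vec (Sum.inr k) := fun k => by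
    rw [← (L₁.delta L₂).sum_matrix e g, hX, Fintype.sum_sum_type]
    simp only [fromBlocks_apply₂₁, fromBlocks_apply₂₂, Matrix.zero_apply, zero_smul,
      Finset.sum_const_zero, zero_add, SuperGrading.up_apply]
    rw [Finset.sum_eq_single k.1]
    · rw [hXp _ _ fun h => k.2 h.1, one_apply_eq]
      exact one_smul _ _
    · intro j _ hj
      rw [hXp _ _ fun h => k.2 h.1, one_apply_ne hj.symm]
      exact zero_smul _ _
    · simp
  have hrL : r ∈ L₂.carrier W := by
    rw [← L₂.proj_eq_zero_iff, map_sub, map_sub, ← Subsheaf.delta_app, map_add, map_sum, map_sum,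
      map_sum]
    simp only [map_smul, hδl, hδr, hproj]
    change y - _ - _ = 0
    have hsum := g.sum_repr y
    rw [Fintype.sum_sum_type, ← Fintype.sum_subtype_add_sum_subtype p] at hsum
    rw [sub_sub, sub_eq_zero]
    refine hsum.symm.trans ?_
    simp only [b]
    abel
  refine ⟨fun a => b a, fun a => ⟨β.form W (v (Sum.inr a)) r, β.odd_odd W _ (hv _) _ hr⟩,
    fun i => ?_⟩
  have hwsum : w = L₁.incl W u + z + r := by
    simp only [r]
    abel
  have hr' : β.form W (L₁.incl W (e.vec (Sum.inr i))) r =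
      ∑ a : {i // p i}, (X i a : S.fn W) * β.form W (v (Sum.inr a)) r := by
    have h0 := hiso₂ W _ (incl_sub_sum_mem hX hXp hproj i.2) r hrL
    rwa [map_sub (β.form W), AddMonoidHom.sub_apply, sub_eq_zero, β.form_sum_left] at h0
  have hz' : β.form W (L₁.incl W (e.vec (Sum.inr i))) z = ∑ a : {i // p i}, (b a : S.fn W) *
      β.form W (L₁.incl W (e.vec (Sum.inr i))) (v (Sum.inr a)) := by
    rw [map_sum]
    exact Finset.sum_congr rfl fun a _ => β.form_smul_right (he _) (hv _) _
  calc β.form W (L₁.incl W (e.vec (Sum.inr i))) w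
      = β.form W (L₁.incl W (e.vec (Sum.inr i))) (L₁.incl W u + z + r) :=
        congrArg _ hwsum
    _ = _ := by
      rw [map_add, map_add, hiso₁ W _ (L₁.incl_mem _) _ (L₁.incl_mem _), zero_add, hz', hr']

end Adapted

theorem matrix_restrict_of_eq {E F : SuperModule S} {d : HomOver ⊤ E F} {e : E.Frame m n W}
    {g : F.Frame m n W} {X : Matrix (Fin n) (Fin n) (S.evenFn W)}
    (hX : d.matrix e g = fromBlocks 1 0 0 ((S.grading W).up X)) {W' : Opens S.X} (h : W' ≤ W) :
    d.matrix (e.restrict h) (g.restrict h) =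
      fromBlocks 1 0 0 ((S.grading W').up ((S.evenRes h).mapMatrix X)) := by
  rw [d.matrix_restrict, hX, fromBlocks_map, Matrix.map_one _ (map_zero _) (map_one _)]
  congr 1 <;> ext i j <;> exact map_zero (S.res h)

theorem mapMatrix_apply_of_eq_one {R R' ι : Type*} [CommRing R] [CommRing R'] [Fintype ι]
    [DecidableEq ι] (φ : R →+* R') {X : Matrix ι ι R} {i j : ι}
    (h : X i j = (1 : Matrix ι ι R) i j) : φ.mapMatrix X i j = (1 : Matrix ι ι R') i j := by
  rw [RingHom.mapMatrix_apply, map_apply, h, one_apply, one_apply]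
  split_ifs
  exacts [map_one φ, map_zero φ]

/-- In adapted frames near a point, the determinant of the odd block of `δ` is a square up to a
unit, and the square root annihilates the cokernel of `δ`. -/
theorem exists_frames_sqrt_det {β : V.SkewForm} {L₁ L₂ : V.Subsheaf}
    (hdual : β.SurjectsOntoDual L₁)
    (hiso₁ : ∀ W, ∀ l ∈ L₁.carrier W, ∀ l' ∈ L₁.carrier W, β.form W l l' = 0)
    (hiso₂ : ∀ W, ∀ l ∈ L₂.carrier W, ∀ l' ∈ L₂.carrier W, β.form W l l' = 0)
    (hs : L₁.fibreEven x ∩ L₂.fibreEven x = {0}) (hx : x ∈ W)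
    (e : L₁.toSuperModule.Frame m n W) (g : L₂.quotient.Frame m n W) :
    ∃ (W' : Opens S.X) (_ : x ∈ W') (e' : L₁.toSuperModule.Frame m n W')
      (g' : L₂.quotient.Frame m n W') (X K : Matrix (Fin n) (Fin n) (S.evenFn W'))
      (f c : S.evenFn W'),
      (L₁.delta L₂).matrix e' g' = fromBlocks 1 0 0 ((S.grading W').up X) ∧ IsUnit c ∧
      f ^ 2 * c = X.det ∧ X * K = f • (1 : Matrix _ _ _) ∧ K * X = f • (1 : Matrix _ _ _) := by
  classical
  obtain ⟨W₁, hx₁, e₁, g₁, X₁, p, hX₁, hp₁, hev₁⟩ := exists_adapted_frames hdual hs hx e g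
  obtain ⟨W₂, h₂, w, hx₂, hw, hdw⟩ := SkewForm.exists_dual_sections hdual hx₁ e₁
  have hX := matrix_restrict_of_eq hX₁ h₂
  set e₂ := e₁.restrict h₂
  set g₂ := g₁.restrict h₂
  set X := (S.evenRes h₂).mapMatrix X₁ with hXdef
  have hp : ∀ i j, ¬(p i ∧ p j) → X i j = (1 : Matrix _ _ _) i j := fun i j hij =>
    mapMatrix_apply_of_eq_one _ (hp₁ i j hij)
  have hev : ∀ i j, p i → p j → S.eval hx₂ (X i j) = 0 := fun i j hi hj =>
    (S.eval_res h₂ hx₂ _).trans (hev₁ i j hi hj)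
  obtain ⟨v, hvh, hproj⟩ := g₂.exists_lift
  have hv : ∀ i, v (Sum.inr i) ∈ V.odd W₂ := fun i => hvh (Sum.inr i)
  have he : ∀ i, L₁.incl W₂ (e₂.vec (Sum.inr i)) ∈ V.odd W₂ := fun i =>
    L₁.incl_mem_homog (e₂.vec_mem_homog (Sum.inr i))
  set X₀ : Matrix {i // p i} {i // p i} (S.evenFn W₂) := X.submatrix Subtype.val Subtype.val
    with hX₀
  set H := β.oddMatrix (fun i : {i // p i} => L₁.incl W₂ (e₂.vec (Sum.inr i)))
      (fun i : {i // p i} => v (Sum.inr i)) (fun _ => he _) (fun _ => hv _) with hH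
  set G := β.oddMatrix (fun i : {i // p i} => v (Sum.inr i))
      (fun i : {i // p i} => v (Sum.inr i)) (fun _ => hv _) (fun _ => hv _) with hG
  have hrel := mul_oddMatrix_skew hX hp hiso₁ hiso₂ hproj hX₀ he hv hH hG
  have hGsymm : Gᵀ = G := Matrix.ext fun i j => Subtype.ext (β.symm_odd W₂ _ (hv _) _ (hv _))
  obtain ⟨c, hc⟩ := (S.isUnit_two W₂).exists_left_inv
  -- Here `c = ½`. Giving half of the symmetric term `X₀ G X₀ᵀ` to each of `H X₀ᵀ` and `X₀ Hᵀ` turns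
  -- the isotropy relation into skewness of `X₀ Yᵀ`.
  let Y := H - c • (X₀ * G)
  have hY : X₀ * Yᵀ + Y * X₀ᵀ = 0 := by
    have hc' : c + c = 1 := by linear_combination hc
    simp only [Y, transpose_sub, transpose_smul, transpose_mul, hGsymm, Matrix.mul_sub,
      Matrix.sub_mul, Matrix.mul_smul, Matrix.smul_mul, ← Matrix.mul_assoc]
    rw [sub_add_sub_comm, ← add_smul, hc', one_smul, hrel]
    abel
  have hYdet : S.eval hx₂ Y.det ≠ 0 := by
    -- Since `X₀` vanishes at the point, `Y` equals `H` there, and the expansions of the pairings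
    -- `(e i, w j)` with the dual sections exhibit a right inverse of `H`.
    choose b ρ hbρ using fun j => exists_form_eq_sum (β := β) hX hp hiso₁ hiso₂ hproj he hv (hw j)
    have hYH : (S.eval hx₂).mapMatrix Y = (S.eval hx₂).mapMatrix H := by
      have hz : (S.eval hx₂).mapMatrix X₀ = 0 := Matrix.ext fun i j => hev i j i.2 j.2
      refine Matrix.ext fun i j => ?_
      have hz' := congrFun (congrFun (map_mul (S.eval hx₂).mapMatrix X₀ G) i) j
      rw [hz, Matrix.zero_mul] at hz'
      change S.eval hx₂ (H i j - c * (X₀ * G) i j) = S.eval hx₂ (H i j)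
      rw [map_sub, map_mul]
      change _ - _ * (S.eval hx₂).mapMatrix (X₀ * G) i j = _
      rw [hz']
      simp
    have hone : (S.eval hx₂).mapMatrix H *
        (of fun (a : {i // p i}) (j : {i // p i}) => S.eval hx₂ (b j a)) = 1 := by
      refine Matrix.ext fun i j => ?_
      have hij : (∑ a, b j a * H i a) + ∑ a : {i // p i}, X i a * ρ j a =
          (1 : Matrix (Fin n) (Fin n) (S.evenFn W₂)) i j := by
        apply Subtype.ext
        have := hbρ j i
        rw [hdw] at this
        push_cast
        refine this.symm.trans ?_
        rw [one_apply, one_apply]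
        split_ifs <;> rfl
      have hij' := congrArg (S.eval hx₂) hij
      rw [map_add, map_sum, map_sum, Finset.sum_eq_zero (s := Finset.univ)
        (f := fun a : {i // p i} => S.eval hx₂ (X i a * ρ j a)), add_zero] at hij'
      · rw [Matrix.mul_apply]
        simp only [map_mul] at hij'
        refine Eq.trans (Finset.sum_congr rfl fun a _ => mul_comm _ _) (hij'.trans ?_)
        rw [one_apply, one_apply]
        simp only [Subtype.ext_iff]
        split_ifs
        exacts [map_one _, map_zero _]
      · intro a _
        rw [map_mul, hev i a i.2 a.2, zero_mul]
    rw [RingHom.map_det, hYH]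
    exact (Matrix.isUnit_det_of_right_inverse hone).ne_zero
  obtain ⟨W₃, h₃, hx₃, hu⟩ := S.exists_isUnit_of_eval_ne_zero hYdet
  rw [RingHom.map_det] at hu
  let ψ : Matrix {i // p i} {i // p i} (S.evenFn W₂) →+* Matrix {i // p i} {i // p i} (S.evenFn W₃) :=
    (S.evenRes h₃).mapMatrix
  have hY₃ : ψ X₀ * (ψ Y)ᵀ + ψ Y * (ψ X₀)ᵀ = 0 := by
    have := congrArg ψ hY
    rwa [map_add, map_mul, map_mul, map_zero] at this
  obtain ⟨f, K₀, hf, hK₁, hK₂⟩ :=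
    exists_sqrt_det_of_mul_transpose_skew (S.isUnit_two W₃) hu hY₃
  obtain ⟨hdet, K, hXK, hKX⟩ := exists_extension_by_one p
    (X := (S.evenRes h₃).mapMatrix X)
    (fun i j hij => mapMatrix_apply_of_eq_one _ (hp i j hij)) (X₀ := ψ X₀) rfl hK₁ hK₂
  -- The unit `y = (det Y)⁻¹` turns `f² = det X₀ · det Y` into `f² y = det X`; it becomes the
  -- coefficient of the trivialization.
  obtain ⟨y, hy⟩ := hu.exists_right_inv
  refine ⟨W₃, hx₃, e₂.restrict h₃, g₂.restrict h₃, (S.evenRes h₃).mapMatrix X, K, f, y,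
    matrix_restrict_of_eq hX h₃, .of_mul_eq_one_right _ hy, ?_, hXK, hKX⟩
  rw [hf, hdet, mul_assoc]
  change _ * ((ψ Y).det * y) = _
  rw [hy, mul_one]

end SuperModule

end

/-! ### Conclusion. -/

theorem theorem4p5 (S : Superspace.{u}) (m n : ℕ)
    (V : SuperModule S) (hV : V.IsSheaf) (hVrank : V.IsLocallyFree (2 * m) (2 * n))
    (B : V.SkewForm) (hB : B.IsSymplectic)
    (L₁ L₂ : V.Subsheaf)
    (hL₁ : L₁.IsSubbundle m n m n) (hL₂ : L₂.IsSubbundle m n m n)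
    (hmax₁ : B.IsMaximalIsotropic L₁) (hmax₂ : B.IsMaximalIsotropic L₂)
    (U : Opens S.X) (hU : L₁.TransversalOver L₂ U)
    (hinj : ∀ W : Opens S.X, Function.Injective (S.res (inf_le_left : W ⊓ U ≤ W)))
    (s : S.X) (hs : L₁.fibreEven s ∩ L₂.fibreEven s = {0}) :
    ∃ W : Opens S.X, s ∈ W ∧
      ∃ (t : SuperModule.BerSection L₁.toSuperModule L₂.quotient m n W) (f : S.evenFn W),
        t.IsTrivialization ∧
        -- `θ⁻¹ = f² t` over `W ∩ U`
        (∀ (W' : Opens S.X) (h : W' ≤ W ⊓ U)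
          (e : L₁.toSuperModule.Frame m n W') (g : L₂.quotient.Frame m n W'),
          SuperModule.theta (L₁.delta L₂) e g *
            (S.evenRes (h.trans inf_le_left) f ^ 2 * t.coeff (h.trans inf_le_left) e g) = 1) ∧
        SuperModule.MemSupportIdeal (L₁.delta L₂) f ∧
        -- `f δ⁻¹` extends from `W ∩ U` to a morphism over `W`
        ∃ k : SuperModule.HomOver W L₂.quotient L₁.toSuperModule,
          ∀ (W' : Opens S.X) (h : W' ≤ W ⊓ U) (l : L₁.carrier W'),
            k.app W' (h.trans inf_le_left) ((L₁.delta L₂).app W' le_top l) =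
              (S.evenRes (h.trans inf_le_left) f : S.fn W') • l := by
  obtain ⟨W₁, hs₁, ⟨e₁⟩⟩ := hL₁.1 s
  obtain ⟨W₂, hs₂, ⟨g₂⟩⟩ := hL₂.2 s
  obtain ⟨W, hsW, e, g, X, K, f, c, hX, hc, hf, hXK, hKX⟩ :=
    SuperModule.exists_frames_sqrt_det hmax₁.2.2 hmax₁.1 hmax₂.1 hs
      (Opens.mem_inf.2 ⟨hs₁, hs₂⟩ : s ∈ W₁ ⊓ W₂) (e₁.restrict inf_le_left) (g₂.restrict inf_le_right)
  obtain ⟨k, hk⟩ := SuperModule.exists_homotopy hX hXK hKX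
  refine ⟨W, hsW, SuperModule.BerSection.ofFrames e g c, f,
    SuperModule.BerSection.isTrivialization_ofFrames e g hc, fun W' h e' g' => ?_,
    fun x hx => ⟨W, le_rfl, k, hx, fun W'' h' => hk W'' h'⟩,
    k, fun W' h l => (hk W' (h.trans inf_le_left)).1 l⟩
  -- Transversality makes `δ` surjective over `W'`: the `L₁`-component of a section of `V` has the
  -- same class modulo `L₂`.
  refine SuperModule.theta_mul_coeff hX hf _ (fun y => ?_) e' g'
  obtain ⟨v, rfl⟩ := Submodule.mkQ_surjective (L₂.carrier W') y
  have hv : v ∈ L₁.carrier W' ⊔ L₂.carrier W' := by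
    rw [(hU W' (h.trans inf_le_right)).sup_eq_top]
    trivial
  obtain ⟨l₁, h₁, l₂, h₂, rfl⟩ := Submodule.mem_sup.1 hv
  refine ⟨⟨l₁, h₁⟩, (Submodule.Quotient.eq _).2 ?_⟩
  change l₁ - (l₁ + l₂) ∈ _
  rw [sub_add_cancel_left]
  exact neg_mem h₂
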